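/- **Setting.** Distributions on $\mathbb T=\mathbb R/2\pi\mathbb Z$ are identified with their Fourier coefficients $f=(f_n)_{n\in\mathbb Z}$, and $\|f\|_{H^r}^2=\sum_n\langle n\rangle^{2r}|f_n|^2$ with $\langle n\rangle=(1+n^2)^{1/2}$. For $N\in\mathbb N\cup\{\infty\}$ let $\mathbf P_{\le N}$ be the projection onto the frequencies $|n|\le N$ ($\mathbf P_{\le\infty}=\mathrm{Id}$), and consider $$i\partial_tu=\partial_x^4u+\mathbf P_{\le N}\Big(\big(|u|^2-2\textstyle\frac1{2\pi}\int_{\mathbb T}|u|^2dx\big)u\Big),\qquad u|_{t=0}=\mathbf P_{\le N}u|_{t=0}.\tag{1}$$ Let $s\in(\frac3{10},\frac12]$ and $\sigma=s-\frac12-\varepsilon$. A *finite-energy solution* is a $u\in C(\mathbb R;H^s(\mathbb T))$ that satisfies (1) for every Fourier mode. For $N<\infty$, a *solution* in $C(\mathbb R;H^\sigma(\mathbb T))$ is a $u\in C(\mathbb R;H^\sigma(\mathbb T))$ that satisfies (1) for every Fourier mode. For $N=\infty$, it is a $u\in C(\mathbb R;H^\sigma(\mathbb T))$ that is the limit in $C([-T',T'];H^\sigma(\mathbb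 T))$, for every $T'>0$, of a sequence of finite-energy solutions. **Ordered bi-trees.** A bi-tree consists of two finite planar rooted trees with roots $r_1,r_2$, in which every non-terminal node $a$ has exactly three ordered children $a_1,a_2,a_3$, and in which $r_1$ is non-terminal. An ordered bi-tree $\mathcal T$ of generation $J\ge1$ is a bi-tree with $J$ non-terminal nodes together with the order $a^{(1)}=r_1,a^{(2)},\dots,a^{(J)}$ in which these were expanded (each $a^{(j+1)}$ is a terminal node of the bi-tree with non-terminal nodes $a^{(1)},\dots,a^{(j)}$). The set of these is $\mathfrak{BT}(J)$, and $\mathcal T^\infty$ is the set of the $2J+2$ terminal nodes of $\mathcal T$. Every node $a$ has a sign $\epsilon_a=\pm1$: $\epsilon_{r_1}=1$, $\epsilon_{r_2}=-1$, $\epsilon_{a_1}=\epsilon_{a_3}=\epsilon_a=-\epsilon_{a_2}$. Let $\mathfrak N_N(\mathcal T)$ be the set of functions $\mathbf n:\mathcal T\to\mathbb Z$ with $n_{r_1}=n_{r_2}$ and, at every non-terminal node $a$, $|n_a|\le N$, $n_a=n_{a_1}-n_{a_2}+n_{a_3}$ and $\{n_a,n_{a_2}\}\cap\{n_{a_1},n_{a_3}\}=\emptyset$.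 Put $$\phi_j=\epsilon_a\big(n_{a_1}^4-n_{a_2}^4+n_{a_3}^4-n_a^4\big)\ \text{ with } a=a^{(j)},\qquad \widetilde\phi_j=\sum_{k=1}^j\phi_k .$$ Fix $K>0$ and let $A_j=\{|\widetilde\phi_{j+1}|\le K(2j+4)^3|\widetilde\phi_j|\}\cup\{|\widetilde\phi_{j+1}|\le K(2j+4)^3|\phi_1|\}$. **Modified energy.** With $f^{+1}=f$ and $f^{-1}=\overline f$, for $J\ge1$ let $$\mathcal N^{(J+1)}_{0,N}(f)=\operatorname{Re}\sum_{\mathcal T\in\mathfrak{BT}(J)}\ \sum_{\mathbf n\in\mathfrak N_N(\mathcal T)}\mathbf 1_{\bigcap_{j=1}^{J-1}A_j^c}\;\frac{\langle n_{r_1}\rangle^{2s}\prod_{j=2}^J(-\epsilon_{a^{(j)}})}{\prod_{j=1}^J\widetilde\phi_j}\prod_{a\in\mathcal T^\infty}f_{n_a}^{\,\epsilon_a},\qquad \mathcal E_N(f)=\tfrac12\|f\|_{H^s}^2-\sum_{j=2}^\infty\mathcal N^{(j)}_{0,N}(f).$$ **Proposition (energy estimate).** Let $\frac3{10}<s\le\frac12$.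 There is $\varepsilon_0=\varepsilon_0(s)>0$ such that for all $0<\varepsilon<\varepsilon_0$, with $\sigma=s-\frac12-\varepsilon$, and all $K>0$ the following holds. For every $N\in\mathbb N\cup\{\infty\}$ and $f\in H^\sigma(\mathbb T)$, the sums over $\mathbf n$ and the series $\sum_{j\ge2}\mathcal N^{(j)}_{0,N}(f)$ converge absolutely. For every $R>0$ there is a constant $C$, depending only on $s,\varepsilon,K,R$, such that for all $T>0$, all $N\in\mathbb N\cup\{\infty\}$ and every solution $u\in C(\mathbb R;H^\sigma(\mathbb T))$ of (1) with $\sup_{t\in[0,T]}\|u(t)\|_{H^\sigma}\le R$, $$\sup_{t\in[0,T]}\Big|\frac{d}{dt}\mathcal E_N(u)(t)\Big|\le C .$$ Here $\frac{d}{dt}\mathcal E_N(u)$ is the derivative of $t\mapsto\mathcal E_N(u(t))$ if $N<\infty$ or if $u$ is a finite-energy solution. In general, since $\|u(t)\|_{H^s}$ may be infinite when $N=\infty$, it is understood in the limiting sense, and its existence is part of the claim: for every sequence of finite-energy solutions $w_k$ of (1) with $w_k\to u$ in $C([0,T];H^\sigma(\mathbb T))$, the derivatives $\frac{d}{dt}\mathcal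 E_N(w_k(t))$ exist for $t\in[0,T]$ and converge, uniformly on $[0,T]$, to $\frac{d}{dt}\mathcal E_N(u)$, which does not depend on the sequence. -/

import Mathlib

open Filter Topology Set

noncomputable section

namespace FourNLS

/-! ### Sobolev spaces on the circle

A periodic distribution on `𝕋 = ℝ / 2πℤ` is given by its Fourier coefficients `f : ℤ → ℂ`. -/

/-- The Japanese bracket `⟨n⟩ = (1 + |n|²)^{1/2}`. -/
def bracket (n : ℤ) : ℝ := Real.sqrt (1 + (n : ℝ) ^ 2)

/-- `f ∈ H^r(𝕋)`. -/
def MemH (r : ℝ) (f : ℤ → ℂ) : Prop :=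
  Summable fun n : ℤ => bracket n ^ (2 * r) * ‖f n‖ ^ 2

/-- The `H^r(𝕋)`-norm (meaningful for `f` with `MemH r f`). -/
def normH (r : ℝ) (f : ℤ → ℂ) : ℝ :=
  Real.sqrt (∑' n : ℤ, bracket n ^ (2 * r) * ‖f n‖ ^ 2)

/-- `u ∈ C(ℝ; H^r(𝕋))`. -/
def ContinuousInH (r : ℝ) (u : ℝ → ℤ → ℂ) : Prop :=
  (∀ t, MemH r (u t)) ∧
    ∀ t₀, Tendsto (fun t => normH r (u t - u t₀)) (𝓝 t₀) (𝓝 0)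

/-- `w k → u` in `C([a, b]; H^r(𝕋))`. -/
def ConvergesInCH (r a b : ℝ) (w : ℕ → ℝ → ℤ → ℂ) (u : ℝ → ℤ → ℂ) : Prop :=
  ∀ δ > 0, ∀ᶠ k in atTop, ∀ t ∈ Icc a b, normH r (w k t - u t) ≤ δ

/-! ### The renormalized equation -/

/-- The `n`-th Fourier coefficient of `(|f|² - 2 ⨍ |f|²) f`: the coefficient of `|f|² f` is the
sum over `n = n₁ - n₂ + n₃`, and `⨍ |f|² = ∑ |f_m|²`. -/
def nonlinearity (f : ℤ → ℂ) (n : ℤ) : ℂ :=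
  (∑' p : ℤ × ℤ, f p.1 * starRingEnd ℂ (f p.2) * f (n - p.1 + p.2))
    - 2 * ((∑' m : ℤ, ‖f m‖ ^ 2 : ℝ) : ℂ) * f n

/-- `|n| ≤ N`, where `N ∈ ℕ ∪ {∞}`. -/
def LowFreq (N : ℕ∞) (n : ℤ) : Prop := ((n.natAbs : ℕ) : ℕ∞) ≤ N

open Classical in
/-- On the Fourier side, `i ∂ₜ u = ∂ₓ⁴ u + P_{≤N} ((|u|² - 2 ⨍ |u|²) u)` with
`u(0) = P_{≤N} u(0)`. For `N = ∞` there is no truncation. -/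
def Solves (N : ℕ∞) (u : ℝ → ℤ → ℂ) : Prop :=
  (∀ n, ¬ LowFreq N n → u 0 n = 0) ∧
    ∀ t n, HasDerivAt (fun τ => u τ n)
      (-Complex.I *
        ((n : ℂ) ^ 4 * u t n + if LowFreq N n then nonlinearity (u t) n else 0)) t

/-- A solution in `C(ℝ; H^s(𝕋))`. It is used for `s > 3/10`, where the sums in `nonlinearity`
converge absolutely and the `H^s`-energy is finite. -/
def IsFiniteEnergySolution (N : ℕ∞) (s : ℝ) (u : ℝ → ℤ → ℂ) : Prop :=
  ContinuousInH s u ∧ Solves N u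

/-- A solution in `C(ℝ; H^σ(𝕋))`, where `σ` may be negative. For finite `N` the solution has
finitely many modes and the equation is a system of ODEs. For `N = ∞` the cubic nonlinearity is
not defined on all of `H^σ(𝕋)`, and, as usual, a solution is a limit of more regular solutions,
locally uniformly in time with values in `H^σ(𝕋)`. -/
def IsSolution (N : ℕ∞) (s σ : ℝ) (u : ℝ → ℤ → ℂ) : Prop :=
  ContinuousInH σ u ∧
    (N ≠ ⊤ → Solves N u) ∧
    (N = ⊤ → ∃ w : ℕ → ℝ → ℤ → ℂ, (∀ k, IsFiniteEnergySolution ⊤ s (w k)) ∧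
      ∀ T > 0, ConvergesInCH σ (-T) T w u)

/-! ### Ordered bi-trees

A node is addressed by its root (`false` for `r₁`, `true` for `r₂`) and by the path from that
root, most recent step first; the three children carry the labels `0, 1, 2`. -/

abbrev Node : Type := Bool × List (Fin 3)

/-- The root `r₁`, which is never terminal. -/
def root₁ : Node := (false, [])

/-- The root `r₂`. -/
def root₂ : Node := (true, [])

/-- The `k`-th child of a node. -/
def child (a : Node) (k : Fin 3) : Node := (a.1, k :: a.2)

/-- `1` if the node carries `f_n`, and `-1` if it carries the complex conjugate of `f_n`. The sign
is `1` at `r₁` and `-1` at `r₂`, and it changes exactly when one passes to a middle child. -/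
def sign (a : Node) : ℤ := (if a.1 then -1 else 1) * (-1) ^ (a.2.count 1)

/-- The nodes of the bi-tree whose non-terminal nodes are the members of `c`. -/
def nodes (c : List Node) : Finset Node :=
  {root₁, root₂} ∪ c.toFinset.biUnion fun a => {child a 0, child a 1, child a 2}

/-- The terminal nodes. -/
def leaves (c : List Node) : Finset Node := nodes c \ c.toFinset

/-- The ordered bi-trees of the `J`-th generation (`J ≥ 1`). Such a tree is given by the list of
its `J` non-terminal nodes in the order in which they were expanded: the first one is `r₁`, and
each later one is a terminal node of the bi-tree before it. -/
def orderedBiTrees : ℕ → Finset (List Node)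
  | 0 => ∅
  | 1 => {[root₁]}
  | J + 2 => (orderedBiTrees (J + 1)).biUnion fun c => (leaves c).image fun b => c ++ [b]

/-- The index functions on a bi-tree, with the truncation `|n_a| ≤ N` at the non-terminal nodes.
An index function is extended by `0` to the addresses which are not nodes of the bi-tree. -/
def indexFunctions (N : ℕ∞) (c : List Node) : Set (Node → ℤ) :=
  {n | (∀ a, a ∉ nodes c → n a = 0) ∧
    n root₁ = n root₂ ∧
    ∀ a ∈ c, LowFreq N (n a) ∧
      n a = n (child a 0) - n (child a 1) + n (child a 2) ∧
      Disjoint ({n a, n (child a 1)} : Set ℤ) {n (child a 0), n (child a 2)}}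

/-- The phase `n₁⁴ - n₂⁴ + n₃⁴ - n⁴` at a non-terminal node, with the sign of the node (it enters
with a minus sign when the time derivative falls on a complex conjugate). -/
def phase (n : Node → ℤ) (a : Node) : ℤ :=
  sign a * (n (child a 0) ^ 4 - n (child a 1) ^ 4 + n (child a 2) ^ 4 - n a ^ 4)

/-- The phase `φ̃_j`, the sum of the signed phases of the first `j` generations. -/
def cumPhase (n : Node → ℤ) (c : List Node) (j : ℕ) : ℤ := ((c.take j).map (phase n)).sum

/-- The frequencies outside of all the nearly resonant sets
`A_j = {|φ̃_{j+1}| ≤ K (2j+4)³ |φ̃_j|} ∪ {|φ̃_{j+1}| ≤ K (2j+4)³ |φ₁|}`, `1 ≤ j < J`, where `J` is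
the generation of the tree. -/
def HighlyNonresonant (K : ℝ) (c : List Node) (n : Node → ℤ) : Prop :=
  ∀ j, 1 ≤ j → j < c.length →
    K * (2 * (j : ℝ) + 4) ^ 3 * max |(cumPhase n c j : ℝ)| |(cumPhase n c 1 : ℝ)|
      < |(cumPhase n c (j + 1) : ℝ)|

/-- The product of the Fourier coefficients, or of their conjugates, over the terminal nodes. -/
def leafProduct (c : List Node) (n : Node → ℤ) (f : ℤ → ℂ) : ℂ :=
  ∏ a ∈ leaves c, if sign a = 1 then f (n a) else starRingEnd ℂ (f (n a))

open Classical in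
/-- One summand of a boundary term of the normal form reduction. Each generation after the first
contributes the factor `-(sign a)`: the equation gives `-i (sign a)`, the differentiation by parts
gives `i` and `-1`. -/
def boundaryTerm (K s : ℝ) (c : List Node) (f : ℤ → ℂ) (n : Node → ℤ) : ℂ :=
  if HighlyNonresonant K c n then
    ((bracket (n root₁) ^ (2 * s) * (((c.tail.map fun a => -sign a).prod : ℤ) : ℝ)
      / (∏ j ∈ Finset.Icc 1 c.length, (cumPhase n c j : ℝ)) : ℝ) : ℂ) * leafProduct c n f
  else 0

/-- The correction term of degree `2J + 2` (`J ≥ 1`), that is, `𝓝_{0,N}^{(J+1)}(f)`. -/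
def boundaryForm (K : ℝ) (N : ℕ∞) (s : ℝ) (J : ℕ) (f : ℤ → ℂ) : ℝ :=
  (∑ c ∈ orderedBiTrees J, ∑' n : indexFunctions N c, boundaryTerm K s c f n).re

/-- All the series in the definition of the correction terms converge absolutely at `f`. -/
def CorrectionsConverge (K : ℝ) (N : ℕ∞) (s : ℝ) (f : ℤ → ℂ) : Prop :=
  (∀ J, ∀ c ∈ orderedBiTrees J,
      Summable fun n : indexFunctions N c => boundaryTerm K s c f n) ∧
    Summable fun J : ℕ => boundaryForm K N s (J + 1) f

/-- The modified energy `𝓔_N(f) = ½ ‖f‖²_{H^s} - ∑_{j ≥ 2} 𝓝_{0,N}^{(j)}(f)`. -/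
def modifiedEnergy (K : ℝ) (N : ℕ∞) (s : ℝ) (f : ℤ → ℂ) : ℝ :=
  (1 / 2) * normH s f ^ 2 - ∑' J : ℕ, boundaryForm K N s (J + 1) f

/-- `D` is the time derivative of `𝓔_N(u)` on `[0, T]`. It is the derivative in the literal sense
if `N` is finite or `u` is continuous with values in `H^s(𝕋)`. In general (`‖u(t)‖_{H^s}` can be
infinite if `N = ∞`) it is understood in the limiting sense: whatever sequence of solutions of
finite energy converges to `u` in `C([0, T]; H^σ(𝕋))`, the derivatives of their modified energies
exist and converge to `D`, uniformly on `[0, T]`. -/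
def IsEnergyDerivative (K : ℝ) (N : ℕ∞) (s σ T : ℝ) (u : ℝ → ℤ → ℂ) (D : ℝ → ℝ) : Prop :=
  (N ≠ ⊤ ∨ IsFiniteEnergySolution N s u →
    ∀ t ∈ Icc 0 T, HasDerivAt (fun τ => modifiedEnergy K N s (u τ)) (D t) t) ∧
  ∀ w : ℕ → ℝ → ℤ → ℂ, (∀ k, IsFiniteEnergySolution N s (w k)) →
    ConvergesInCH σ 0 T w u →
    (∀ k, ∀ t ∈ Icc 0 T, DifferentiableAt ℝ (fun τ => modifiedEnergy K N s (w k τ)) t) ∧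
    TendstoUniformlyOn (fun k t => deriv (fun τ => modifiedEnergy K N s (w k τ)) t) D atTop
      (Icc 0 T)

end FourNLS

end

noncomputable section

namespace FourNLS

open scoped ENNReal

/-! ### Combinatorics of bi-trees -/

/-- The set of children of a node. -/
def children (b : Node) : Finset Node := {child b 0, child b 1, child b 2}

/-- Bi-trees, built from the pair of roots by expanding terminal nodes one at a time. -/
inductive IsTree : List Node → Prop
  | nil : IsTree []
  | snoc {c : List Node} {b : Node} (hc : IsTree c) (hb : b ∈ leaves c) : IsTree (c ++ [b])

lemma nodes_nil : nodes [] = {root₁, root₂} := by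
  simp [nodes]

lemma leaves_nil : leaves [] = {root₁, root₂} := by
  simp [leaves, nodes_nil]

lemma nodes_snoc (c : List Node) (b : Node) : nodes (c ++ [b]) = nodes c ∪ children b := by
  ext a
  simp only [nodes, children, Finset.mem_union, Finset.mem_biUnion, List.mem_toFinset,
    List.mem_append, List.mem_singleton]
  constructor
  · rintro (h | ⟨x, hx | rfl, h⟩)
    · exact Or.inl (Or.inl h)
    · exact Or.inl (Or.inr ⟨x, hx, h⟩)
    · exact Or.inr h
  · rintro ((h | ⟨x, hx, h⟩) | h)
    · exact Or.inl h
    · exact Or.inr ⟨x, Or.inl hx, h⟩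
    · exact Or.inr ⟨b, Or.inr rfl, h⟩

lemma child_inj {a b : Node} {i j : Fin 3} : child a i = child b j ↔ a = b ∧ i = j := by
  obtain ⟨a1, a2⟩ := a
  obtain ⟨b1, b2⟩ := b
  simp only [child, Prod.mk.injEq, List.cons.injEq]
  tauto

lemma child_ne_root₁ (a : Node) (i : Fin 3) : child a i ≠ root₁ := by
  simp [child, root₁]

lemma child_ne_root₂ (a : Node) (i : Fin 3) : child a i ≠ root₂ := by
  simp [child, root₂]

lemma root₁_ne_root₂ : root₁ ≠ root₂ := by simp [root₁, root₂]

lemma child_ne_self (a : Node) (i : Fin 3) : child a i ≠ a := by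
  intro h
  have := congrArg (fun x : Node => x.2.length) h
  simp [child] at this

lemma child_mem_nodes {c : List Node} {a : Node} {i : Fin 3} :
    child a i ∈ nodes c ↔ a ∈ c := by
  simp only [nodes, Finset.mem_union, Finset.mem_insert, Finset.mem_singleton, child_ne_root₁,
    child_ne_root₂, or_self, false_or, Finset.mem_biUnion, List.mem_toFinset, child_inj]
  constructor
  · rintro ⟨x, hx, h⟩
    rcases h with h | h | h <;> exact h.1 ▸ hx
  · intro h
    refine ⟨a, h, ?_⟩
    fin_cases i <;> simp

lemma root₁_mem_nodes (c : List Node) : root₁ ∈ nodes c := by simp [nodes]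

lemma root₂_mem_nodes (c : List Node) : root₂ ∈ nodes c := by simp [nodes]

lemma mem_children {a b : Node} : a ∈ children b ↔ ∃ i, a = child b i := by
  simp only [children, Finset.mem_insert, Finset.mem_singleton]
  constructor
  · rintro (h | h | h)
    exacts [⟨_, h⟩, ⟨_, h⟩, ⟨_, h⟩]
  · rintro ⟨i, rfl⟩
    fin_cases i <;> simp

lemma mem_nodes {c : List Node} {a : Node} :
    a ∈ nodes c ↔ a = root₁ ∨ a = root₂ ∨ ∃ b ∈ c, ∃ i, a = child b i := by
  have h : ∀ b : Node, ({child b 0, child b 1, child b 2} : Finset Node) = children b :=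
    fun _ => rfl
  simp only [nodes, Finset.mem_union, Finset.mem_insert, Finset.mem_singleton, h,
    Finset.mem_biUnion, List.mem_toFinset, mem_children, or_assoc]

lemma not_mem_of_mem_leaves {c : List Node} {b : Node} (hb : b ∈ leaves c) : b ∉ c := by
  simp only [leaves, Finset.mem_sdiff, List.mem_toFinset] at hb
  exact hb.2

lemma mem_nodes_of_mem_leaves {c : List Node} {b : Node} (hb : b ∈ leaves c) : b ∈ nodes c := by
  simp only [leaves, Finset.mem_sdiff] at hb
  exact hb.1

lemma IsTree.mem_nodes {c : List Node} (hc : IsTree c) : ∀ a ∈ c, a ∈ nodes c := by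
  induction hc with
  | nil => simp
  | snoc hc hb ih =>
    intro a ha
    rw [nodes_snoc, Finset.mem_union]
    rcases List.mem_append.1 ha with h | h
    · exact Or.inl (ih a h)
    · rw [List.mem_singleton] at h
      exact Or.inl (h ▸ mem_nodes_of_mem_leaves hb)

lemma child_not_mem_nodes {c : List Node} {b : Node} (hb : b ∈ leaves c) (i : Fin 3) :
    child b i ∉ nodes c := fun h => not_mem_of_mem_leaves hb (child_mem_nodes.1 h)

lemma disjoint_nodes_children {c : List Node} {b : Node} (hb : b ∈ leaves c) :
    Disjoint (nodes c) (children b) := by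
  rw [Finset.disjoint_left]
  intro a ha hab
  obtain ⟨i, rfl⟩ := mem_children.1 hab
  exact child_not_mem_nodes hb i ha

lemma leaves_snoc {c : List Node} {b : Node} (hc : IsTree c) (hb : b ∈ leaves c) :
    leaves (c ++ [b]) = (leaves c).erase b ∪ children b := by
  ext a
  simp only [leaves, nodes_snoc, Finset.mem_sdiff, Finset.mem_union, List.mem_toFinset,
    List.mem_append, List.mem_singleton, Finset.mem_erase]
  have h1 : a ∈ children b → a ∉ c ∧ a ≠ b := by
    intro h
    obtain ⟨i, rfl⟩ := mem_children.1 h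
    exact ⟨fun h' => child_not_mem_nodes hb i (hc.mem_nodes _ h'), child_ne_self b i⟩
  tauto

lemma disjoint_leaves_children {c : List Node} {b : Node} (hb : b ∈ leaves c) :
    Disjoint ((leaves c).erase b) (children b) := by
  refine Finset.disjoint_of_subset_left ?_ (disjoint_nodes_children hb)
  exact (Finset.erase_subset _ _).trans Finset.sdiff_subset

@[to_additive]
lemma prod_children {M : Type*} [CommMonoid M] (b : Node) (h : Node → M) :
    ∏ a ∈ children b, h a = h (child b 0) * h (child b 1) * h (child b 2) := by
  rw [children, Finset.prod_insert, Finset.prod_insert, Finset.prod_singleton, mul_assoc]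
  · simp [child_inj]
  · simp [child_inj]

lemma card_children (b : Node) : (children b).card = 3 := by
  rw [Finset.card_eq_sum_ones, sum_children]

@[to_additive]
lemma prod_leaves_snoc {M : Type*} [CommMonoid M] {c : List Node} {b : Node} (hc : IsTree c)
    (hb : b ∈ leaves c) (h : Node → M) :
    ∏ a ∈ leaves (c ++ [b]), h a =
      (∏ a ∈ (leaves c).erase b, h a) * (h (child b 0) * h (child b 1) * h (child b 2)) := by
  rw [leaves_snoc hc hb, Finset.prod_union (disjoint_leaves_children hb), prod_children]

lemma card_leaves {c : List Node} (hc : IsTree c) : (leaves c).card = 2 * c.length + 2 := by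
  induction hc with
  | nil => simp [leaves_nil, root₁_ne_root₂]
  | snoc hc hb ih =>
    rw [leaves_snoc hc hb, Finset.card_union_of_disjoint (disjoint_leaves_children hb),
      card_children, Finset.card_erase_of_mem hb, ih, List.length_append, List.length_singleton]
    omega

lemma root₁_mem_leaves_nil : root₁ ∈ leaves [] := by simp [leaves_nil]

lemma isTree_root : IsTree [root₁] := IsTree.snoc IsTree.nil root₁_mem_leaves_nil

lemma orderedBiTrees_spec (J : ℕ) : ∀ c ∈ orderedBiTrees (J + 1),
    IsTree c ∧ c.length = J + 1 ∧ ∃ c', c = root₁ :: c' := by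
  induction J with
  | zero =>
    intro c hc
    simp only [orderedBiTrees, Finset.mem_singleton] at hc
    subst hc
    exact ⟨isTree_root, rfl, [], rfl⟩
  | succ J ih =>
    intro c hc
    simp only [orderedBiTrees, Finset.mem_biUnion, Finset.mem_image] at hc
    obtain ⟨c0, hc0, b, hb, rfl⟩ := hc
    obtain ⟨h1, h2, c', h3⟩ := ih c0 hc0
    refine ⟨h1.snoc hb, by simp [h2], c' ++ [b], by simp [h3]⟩

lemma sum_orderedBiTrees {M : Type*} [AddCommMonoid M] (J : ℕ) (F : List Node → M) :
    ∑ c ∈ orderedBiTrees (J + 2), F c =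
      ∑ c ∈ orderedBiTrees (J + 1), ∑ b ∈ leaves c, F (c ++ [b]) := by
  rw [orderedBiTrees, Finset.sum_biUnion]
  · refine Finset.sum_congr rfl fun c _ => ?_
    rw [Finset.sum_image]
    intro a _ b _ h
    simpa using h
  · intro c _ d _ hcd
    rw [Function.onFun, Finset.disjoint_left]
    intro x hx hx'
    obtain ⟨a, _, rfl⟩ := Finset.mem_image.1 hx
    obtain ⟨b, _, h⟩ := Finset.mem_image.1 hx'
    exact hcd ((List.append_inj' h rfl).1).symm

lemma card_orderedBiTrees_succ (J : ℕ) :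
    (orderedBiTrees (J + 2)).card = (orderedBiTrees (J + 1)).card * (2 * J + 4) := by
  rw [Finset.card_eq_sum_ones, sum_orderedBiTrees, Finset.sum_const_nat]
  intro c hc
  obtain ⟨h1, h2, -⟩ := orderedBiTrees_spec J c hc
  rw [← Finset.card_eq_sum_ones, card_leaves h1, h2]
  ring

lemma sign_eq (a : Node) : sign a = 1 ∨ sign a = -1 := by
  unfold sign
  rcases neg_one_pow_eq_or ℤ (a.2.count 1) with h | h <;> rw [h] <;> split_ifs <;> simp

lemma sign_child (a : Node) (i : Fin 3) :
    sign (child a i) = if i = 1 then -sign a else sign a := by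
  simp only [sign, child, List.count_cons]
  by_cases h : i = 1
  · split_ifs <;> simp [h, pow_succ] <;> simp_all
  · split_ifs <;> simp [h] <;> simp_all

/-! ### Index functions on an expanded bi-tree -/

/-- The extension of an index function to the children of `b`, the first two of which are given
the frequencies `z.1` and `z.2`. -/
def extend (n : Node → ℤ) (b : Node) (z : ℤ × ℤ) : Node → ℤ := fun a =>
  if a = child b 0 then z.1 else if a = child b 1 then z.2
  else if a = child b 2 then n b - z.1 + z.2 else n a

lemma extend_child_zero (n : Node → ℤ) (b : Node) (z : ℤ × ℤ) :
    extend n b z (child b 0) = z.1 := by simp [extend]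

lemma extend_child_one (n : Node → ℤ) (b : Node) (z : ℤ × ℤ) :
    extend n b z (child b 1) = z.2 := by simp [extend, child_inj]

lemma extend_child_two (n : Node → ℤ) (b : Node) (z : ℤ × ℤ) :
    extend n b z (child b 2) = n b - z.1 + z.2 := by simp [extend, child_inj]

lemma extend_of_not_mem (n : Node → ℤ) (b : Node) (z : ℤ × ℤ) {a : Node} (ha : a ∉ children b) :
    extend n b z a = n a := by
  simp only [children, Finset.mem_insert, Finset.mem_singleton, not_or] at ha
  simp [extend, ha.1, ha.2.1, ha.2.2]

lemma extend_of_mem_nodes {c : List Node} {b : Node} (hb : b ∈ leaves c) (n : Node → ℤ)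
    (z : ℤ × ℤ) {a : Node} (ha : a ∈ nodes c) : extend n b z a = n a :=
  extend_of_not_mem n b z fun h => Finset.disjoint_left.1 (disjoint_nodes_children hb) ha h

/-- The constraint on the frequencies of the first two children of a node of frequency `k`. -/
def Admissible (N : ℕ∞) (k : ℤ) (z : ℤ × ℤ) : Prop := LowFreq N k ∧ z.1 ≠ k ∧ z.1 ≠ z.2

lemma disjoint_pair_iff {k x y : ℤ} :
    Disjoint ({k, y} : Set ℤ) {x, k - x + y} ↔ x ≠ k ∧ x ≠ y := by
  simp only [Set.disjoint_insert_left, Set.disjoint_singleton_left, Set.mem_insert_iff,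
    Set.mem_singleton_iff]
  omega

lemma extend_mem {N : ℕ∞} {c : List Node} {b : Node} (hc : IsTree c) (hb : b ∈ leaves c)
    {n : Node → ℤ} (hn : n ∈ indexFunctions N c) {z : ℤ × ℤ} (hz : Admissible N (n b) z) :
    extend n b z ∈ indexFunctions N (c ++ [b]) := by
  obtain ⟨h0, h1, h2⟩ := hn
  refine ⟨?_, ?_, ?_⟩
  · intro a ha
    rw [nodes_snoc, Finset.mem_union, not_or] at ha
    rw [extend_of_not_mem n b z ha.2, h0 a ha.1]
  · rw [extend_of_mem_nodes hb n z (root₁_mem_nodes c),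
      extend_of_mem_nodes hb n z (root₂_mem_nodes c), h1]
  · intro a ha
    rcases List.mem_append.1 ha with ha | ha
    · have hch : ∀ i, child a i ∈ nodes c := fun i => child_mem_nodes.2 ha
      rw [extend_of_mem_nodes hb n z (hch 0), extend_of_mem_nodes hb n z (hch 1),
        extend_of_mem_nodes hb n z (hch 2), extend_of_mem_nodes hb n z (hc.mem_nodes a ha)]
      exact h2 a ha
    · rw [List.mem_singleton] at ha
      subst ha
      rw [extend_child_zero, extend_child_one, extend_child_two,
        extend_of_mem_nodes hb n z (mem_nodes_of_mem_leaves hb), disjoint_pair_iff]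
      exact ⟨hz.1, by ring, hz.2⟩

/-- The restriction of an index function to the nodes of the bi-tree. -/
def restrict (c : List Node) (n : Node → ℤ) : Node → ℤ := fun a => if a ∈ nodes c then n a else 0

lemma restrict_of_mem {c : List Node} (n : Node → ℤ) {a : Node} (ha : a ∈ nodes c) :
    restrict c n a = n a := by simp [restrict, ha]

lemma restrict_mem {N : ℕ∞} {c : List Node} {b : Node} (hc : IsTree c) {n : Node → ℤ}
    (hn : n ∈ indexFunctions N (c ++ [b])) : restrict c n ∈ indexFunctions N c := by
  obtain ⟨h0, h1, h2⟩ := hn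
  refine ⟨fun a ha => by simp [restrict, ha], ?_, ?_⟩
  · rw [restrict_of_mem n (root₁_mem_nodes c), restrict_of_mem n (root₂_mem_nodes c), h1]
  · intro a ha
    have hch : ∀ i, child a i ∈ nodes c := fun i => child_mem_nodes.2 ha
    rw [restrict_of_mem n (hch 0), restrict_of_mem n (hch 1), restrict_of_mem n (hch 2),
      restrict_of_mem n (hc.mem_nodes a ha)]
    exact h2 a (List.mem_append_left _ ha)

lemma admissible_of_mem {N : ℕ∞} {c : List Node} {a : Node} {n : Node → ℤ}
    (hn : n ∈ indexFunctions N c) (ha : a ∈ c) :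
    Admissible N (n a) (n (child a 0), n (child a 1)) := by
  obtain ⟨h1, h2, h3⟩ := hn.2.2 a ha
  have h4 : n (child a 2) = n a - n (child a 0) + n (child a 1) := by omega
  rw [h4, disjoint_pair_iff] at h3
  exact ⟨h1, h3⟩

lemma extend_restrict {N : ℕ∞} {c : List Node} {b : Node} (hb : b ∈ leaves c)
    {n : Node → ℤ} (hn : n ∈ indexFunctions N (c ++ [b])) :
    extend (restrict c n) b (n (child b 0), n (child b 1)) = n := by
  funext a
  by_cases ha : a ∈ children b
  · obtain ⟨i, rfl⟩ := mem_children.1 ha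
    have hi : i = 0 ∨ i = 1 ∨ i = 2 := by omega
    rcases hi with rfl | rfl | rfl
    · rw [extend_child_zero]
    · rw [extend_child_one]
    · rw [extend_child_two, restrict_of_mem n (mem_nodes_of_mem_leaves hb)]
      have := (hn.2.2 b (by simp)).2.1
      dsimp only
      omega
  · rw [extend_of_not_mem _ _ _ ha]
    by_cases ha' : a ∈ nodes c
    · rw [restrict_of_mem n ha']
    · have h0 := hn.1 a (by rw [nodes_snoc, Finset.mem_union]; tauto)
      simp [restrict, ha', h0]

lemma restrict_extend {N : ℕ∞} {c : List Node} {b : Node} (hb : b ∈ leaves c)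
    {n : Node → ℤ} (hn : n ∈ indexFunctions N c) (z : ℤ × ℤ) :
    restrict c (extend n b z) = n := by
  funext a
  by_cases ha : a ∈ nodes c
  · rw [restrict_of_mem _ ha, extend_of_mem_nodes hb n z ha]
  · simp [restrict, ha, hn.1 a ha]

/-- Index functions on `c ++ [b]` are index functions on `c` together with an admissible pair of
frequencies for the first two children of `b`. -/
def indexEquiv (N : ℕ∞) {c : List Node} {b : Node} (hc : IsTree c) (hb : b ∈ leaves c) :
    indexFunctions N (c ++ [b]) ≃
      {x : indexFunctions N c × (ℤ × ℤ) | Admissible N (x.1.1 b) x.2} where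
  toFun n := ⟨(⟨restrict c n.1, restrict_mem hc n.2⟩, (n.1 (child b 0), n.1 (child b 1))), by
    have := admissible_of_mem n.2 (a := b) (by simp)
    simpa [restrict_of_mem n.1 (mem_nodes_of_mem_leaves hb)] using this⟩
  invFun x := ⟨extend x.1.1.1 b x.1.2, extend_mem hc hb x.1.1.2 x.2⟩
  left_inv n := Subtype.ext (extend_restrict hb n.2)
  right_inv x := by
    refine Subtype.ext (Prod.ext (Subtype.ext (restrict_extend hb x.1.1.2 _)) ?_)
    simp [extend_child_zero, extend_child_one]

open Classical in
lemma tsum_indexFunctions_snoc_ennreal (N : ℕ∞) {c : List Node} {b : Node} (hc : IsTree c)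
    (hb : b ∈ leaves c) (F : (Node → ℤ) → ENNReal) :
    ∑' n : indexFunctions N (c ++ [b]), F n =
      ∑' n : indexFunctions N c, ∑' z : ℤ × ℤ,
        if Admissible N (n.1 b) z then F (extend n b z) else 0 := by
  rw [← (indexEquiv N hc hb).symm.tsum_eq, ← ENNReal.tsum_prod]
  rw [← tsum_subtype_eq_of_support_subset
    (s := {x : indexFunctions N c × (ℤ × ℤ) | Admissible N (x.1.1 b) x.2})]
  · refine tsum_congr fun x => ?_
    have hx : Admissible N (x.1.1.1 b) x.1.2 := x.2
    rw [if_pos hx]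
    rfl
  · intro x hx
    by_contra h
    exact hx (if_neg h)

open Classical in
lemma summable_indexFunctions_snoc (N : ℕ∞) {c : List Node} {b : Node} (hc : IsTree c)
    (hb : b ∈ leaves c) {F : (Node → ℤ) → ℂ}
    (hF : Summable fun n : indexFunctions N (c ++ [b]) => F n) :
    Summable fun x : indexFunctions N c × (ℤ × ℤ) =>
        if Admissible N (x.1.1 b) x.2 then F (extend x.1 b x.2) else 0 := by
  rw [← (indexEquiv N hc hb).symm.summable_iff] at hF
  have h : (fun x : indexFunctions N c × (ℤ × ℤ) =>
      if Admissible N (x.1.1 b) x.2 then F (extend x.1 b x.2) else 0) =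
      ({x : indexFunctions N c × (ℤ × ℤ) | Admissible N (x.1.1 b) x.2}).indicator
        fun x => F (extend x.1 b x.2) := by
    funext x
    simp [Set.indicator_apply]
  rw [h, ← summable_subtype_iff_indicator]
  exact hF

open Classical in
lemma tsum_indexFunctions_snoc (N : ℕ∞) {c : List Node} {b : Node} (hc : IsTree c)
    (hb : b ∈ leaves c) {F : (Node → ℤ) → ℂ}
    (hF : Summable fun n : indexFunctions N (c ++ [b]) => F n) :
    ∑' n : indexFunctions N (c ++ [b]), F n =
      ∑' n : indexFunctions N c, ∑' z : ℤ × ℤ,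
        if Admissible N (n.1 b) z then F (extend n b z) else 0 := by
  rw [← (indexEquiv N hc hb).symm.tsum_eq]
  have h := summable_indexFunctions_snoc N hc hb hF
  rw [← h.tsum_prod]
  rw [← tsum_subtype_eq_of_support_subset
    (s := {x : indexFunctions N c × (ℤ × ℤ) | Admissible N (x.1.1 b) x.2})]
  · refine tsum_congr fun x => ?_
    have hx : Admissible N (x.1.1.1 b) x.1.2 := x.2
    rw [if_pos hx]
    rfl
  · intro x hx
    by_contra h
    exact hx (if_neg h)

/-- Index functions on the pair of roots. -/
def indexEquivNil (N : ℕ∞) : indexFunctions N [] ≃ ℤ where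
  toFun n := n.1 root₁
  invFun m := ⟨fun a => if a = root₁ ∨ a = root₂ then m else 0, by
    refine ⟨fun a ha => ?_, by simp, by simp⟩
    rw [nodes_nil, Finset.mem_insert, Finset.mem_singleton] at ha
    simp [ha]⟩
  left_inv n := by
    refine Subtype.ext (funext fun a => ?_)
    by_cases ha : a = root₁ ∨ a = root₂
    · rcases ha with rfl | rfl
      · simp
      · simpa using n.2.2.1
    · have := n.2.1 a (by simpa [nodes_nil] using ha)
      simp [ha, this]
  right_inv m := by simp

instance (N : ℕ∞) (c : List Node) : Countable (indexFunctions N c) := by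
  have h : Function.Injective fun (n : indexFunctions N c) (a : nodes c) => n.1 a := by
    intro n n' hnn
    refine Subtype.ext (funext fun a => ?_)
    by_cases ha : a ∈ nodes c
    · exact congrFun hnn ⟨a, ha⟩
    · rw [n.2.1 a ha, n'.2.1 a ha]
  exact h.countable

/-! ### Phases on an expanded bi-tree -/

lemma phase_congr {n n' : Node → ℤ} {a : Node} (h : n a = n' a)
    (hi : ∀ i, n (child a i) = n' (child a i)) : phase n a = phase n' a := by
  simp only [phase, h, hi]

lemma cumPhase_congr {n n' : Node → ℤ} {c : List Node} (hc : IsTree c)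
    (h : ∀ a ∈ nodes c, n a = n' a) (j : ℕ) : cumPhase n c j = cumPhase n' c j := by
  unfold cumPhase
  congr 1
  refine List.map_congr_left fun a ha => ?_
  have ha' : a ∈ c := List.mem_of_mem_take ha
  exact phase_congr (h a (hc.mem_nodes a ha')) fun i => h _ (child_mem_nodes.2 ha')

lemma cumPhase_append (n : Node → ℤ) (c d : List Node) {j : ℕ} (hj : j ≤ c.length) :
    cumPhase n (c ++ d) j = cumPhase n c j := by
  rw [cumPhase, cumPhase, List.take_append_of_le_length hj]

lemma cumPhase_snoc (n : Node → ℤ) (c : List Node) (b : Node) :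
    cumPhase n (c ++ [b]) (c.length + 1) = cumPhase n c c.length + phase n b := by
  simp [cumPhase, List.take_of_length_le]

lemma highlyNonresonant_congr {K : ℝ} {n n' : Node → ℤ} {c : List Node} (hc : IsTree c)
    (h : ∀ a ∈ nodes c, n a = n' a) : HighlyNonresonant K c n ↔ HighlyNonresonant K c n' := by
  unfold HighlyNonresonant
  simp only [cumPhase_congr hc h]

lemma highlyNonresonant_snoc {K : ℝ} {n : Node → ℤ} {c : List Node} {b : Node} :
    HighlyNonresonant K (c ++ [b]) n ↔ HighlyNonresonant K c n ∧ (1 ≤ c.length →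
      K * (2 * (c.length : ℝ) + 4) ^ 3 *
        max |(cumPhase n c c.length : ℝ)| |(cumPhase n c 1 : ℝ)|
        < |((cumPhase n c c.length + phase n b : ℤ) : ℝ)|) := by
  unfold HighlyNonresonant
  rw [← cumPhase_snoc]
  constructor
  · intro h
    refine ⟨fun j h1 h2 => ?_, fun h1 => ?_⟩
    · have := h j h1 (by simp; omega)
      rwa [cumPhase_append n c _ h2.le, cumPhase_append n c _ (by omega : 1 ≤ c.length),
        cumPhase_append n c _ (by omega : j + 1 ≤ c.length)] at this
    · have := h c.length h1 (by simp)
      rwa [cumPhase_append n c _ le_rfl, cumPhase_append n c _ h1] at this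
  · rintro ⟨h, h'⟩ j h1 h2
    simp only [List.length_append, List.length_singleton] at h2
    rcases Nat.lt_succ_iff_lt_or_eq.1 h2 with h3 | rfl
    · rw [cumPhase_append n c _ h3.le, cumPhase_append n c _ (by omega : 1 ≤ c.length),
        cumPhase_append n c _ (by omega : j + 1 ≤ c.length)]
      exact h j h1 h3
    · rw [cumPhase_append n c _ le_rfl, cumPhase_append n c _ h1]
      exact h' h1

/-- The total phase is the alternating sum of the fourth powers of the terminal frequencies. -/
lemma sum_leaves_sign_mul {N : ℕ∞} {c : List Node} (hc : IsTree c) {n : Node → ℤ}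
    (hn : n ∈ indexFunctions N c) :
    ∑ a ∈ leaves c, sign a * n a ^ 4 = cumPhase n c c.length := by
  have key : ∀ n : Node → ℤ, ∑ a ∈ leaves c, sign a * n a ^ 4 =
      cumPhase n c c.length + (n root₁ ^ 4 - n root₂ ^ 4) := by
    clear hn n
    intro n
    induction hc with
    | nil =>
      rw [leaves_nil, Finset.sum_pair root₁_ne_root₂]
      simp [cumPhase, sign, root₁, root₂]
      ring
    | @snoc c b hc hb ih =>
      rw [sum_leaves_snoc hc hb, List.length_append, List.length_singleton, cumPhase_snoc]
      rw [← Finset.add_sum_erase _ _ hb] at ih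
      simp only [sign_child, phase] at ih ⊢
      simp only [Fin.isValue, zero_ne_one, if_false, if_true,
        show ((2 : Fin 3) = 1) = False by simp]
      linear_combination ih
  rw [key, hn.2.1]
  ring

/-- The factorization of the phase. -/
lemma phase_factorization (x y k : ℤ) :
    x ^ 4 - y ^ 4 + (k - x + y) ^ 4 - k ^ 4 =
      (x - k) * (x - y) *
        (k ^ 2 + x ^ 2 + y ^ 2 + (k - x + y) ^ 2 + 2 * (x + (k - x + y)) ^ 2) := by
  ring

/-! ### Multilinear estimates on bi-trees -/

/-- The `ℓ²`-norm of a nonnegative sequence. -/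
def l2norm {ι : Type*} (h : ι → ℝ≥0∞) : ℝ≥0∞ := (∑' n, h n ^ 2) ^ (1 / 2 : ℝ)

lemma l2norm_sq {ι : Type*} (h : ι → ℝ≥0∞) : l2norm h ^ 2 = ∑' n, h n ^ 2 := by
  rw [l2norm, ← ENNReal.rpow_natCast, ← ENNReal.rpow_mul]
  norm_num

lemma le_of_sq_le_sq_ennreal {a b : ℝ≥0∞} (h : a ^ 2 ≤ b ^ 2) : a ≤ b :=
  (ENNReal.pow_le_pow_left_iff two_ne_zero).1 h

lemma tsum_mul_le_l2norm {ι : Type*} (f g : ι → ℝ≥0∞) :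
    ∑' i, f i * g i ≤ l2norm f * l2norm g := by
  let _ : MeasurableSpace ι := ⊤
  have h := ENNReal.lintegral_mul_le_Lp_mul_Lq
    (MeasureTheory.Measure.count : MeasureTheory.Measure ι)
    Real.HolderConjugate.two_two (f := f) (g := g) measurable_from_top.aemeasurable
    measurable_from_top.aemeasurable
  simp only [MeasureTheory.lintegral_count, Pi.mul_apply] at h
  simpa only [l2norm, ← ENNReal.rpow_natCast, Nat.cast_ofNat] using h

lemma sq_tsum_mul_le {ι : Type*} (f g : ι → ℝ≥0∞) :
    (∑' i, f i * g i) ^ 2 ≤ (∑' i, f i ^ 2) * ∑' i, g i ^ 2 := by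
  rw [← l2norm_sq, ← l2norm_sq, ← mul_pow]
  exact pow_le_pow_left' (tsum_mul_le_l2norm f g) 2

lemma le_l2norm {ι : Type*} (h : ι → ℝ≥0∞) (n : ι) : h n ≤ l2norm h := by
  refine le_of_sq_le_sq_ennreal ?_
  rw [l2norm_sq]
  exact ENNReal.le_tsum n

/-- The trilinear operator attached to the expansion of one node. -/
def expansion (κ h₁ h₂ h₃ : ℤ → ℝ≥0∞) (k : ℤ) : ℝ≥0∞ :=
  ∑' z : ℤ × ℤ, κ (z.1 - k) * κ (z.1 - z.2) * (h₁ z.1 * h₂ z.2 * h₃ (k - z.1 + z.2))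

lemma tsum_kernel_sq (κ : ℤ → ℝ≥0∞) (k : ℤ) :
    ∑' z : ℤ × ℤ, (κ (z.1 - k) * κ (z.1 - z.2)) ^ 2 = (∑' n, κ n ^ 2) ^ 2 := by
  rw [ENNReal.tsum_prod (f := fun x y => (κ (x - k) * κ (x - y)) ^ 2)]
  have h1 : ∀ x : ℤ, ∑' y : ℤ, (κ (x - k) * κ (x - y)) ^ 2 = κ (x - k) ^ 2 * ∑' n, κ n ^ 2 := by
    intro x
    simp_rw [mul_pow]
    rw [ENNReal.tsum_mul_left]
    congr 1
    exact (Equiv.subLeft x).tsum_eq fun y => κ y ^ 2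
  simp_rw [h1]
  rw [ENNReal.tsum_mul_right, sq]
  congr 1
  exact (Equiv.subRight k).tsum_eq fun y => κ y ^ 2

lemma tsum_tsum_products (h₁ h₂ h₃ : ℤ → ℝ≥0∞) :
    ∑' k : ℤ, ∑' z : ℤ × ℤ, h₁ z.1 * h₂ z.2 * h₃ (k - z.1 + z.2) =
      (∑' n, h₁ n) * (∑' n, h₂ n) * ∑' n, h₃ n := by
  rw [ENNReal.tsum_comm]
  have h1 : ∀ z : ℤ × ℤ, ∑' k : ℤ, h₁ z.1 * h₂ z.2 * h₃ (k - z.1 + z.2) =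
      h₁ z.1 * h₂ z.2 * ∑' n, h₃ n := by
    intro z
    rw [ENNReal.tsum_mul_left]
    congr 1
    have := ((Equiv.subRight z.1).trans (Equiv.addRight z.2)).tsum_eq fun y => h₃ y
    simpa using this
  simp_rw [h1]
  rw [ENNReal.tsum_mul_right, ENNReal.tsum_prod (f := fun x y => h₁ x * h₂ y)]
  simp_rw [ENNReal.tsum_mul_left]
  rw [ENNReal.tsum_mul_right]

lemma l2norm_expansion_le (κ h₁ h₂ h₃ : ℤ → ℝ≥0∞) :
    l2norm (expansion κ h₁ h₂ h₃) ≤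
      (∑' n, κ n ^ 2) * (l2norm h₁ * l2norm h₂ * l2norm h₃) := by
  refine le_of_sq_le_sq_ennreal ?_
  rw [l2norm_sq]
  simp only [mul_pow, l2norm_sq]
  rw [← tsum_tsum_products (fun n => h₁ n ^ 2) (fun n => h₂ n ^ 2), ← ENNReal.tsum_mul_left]
  refine ENNReal.tsum_le_tsum fun k => ?_
  refine (sq_tsum_mul_le _ _).trans (le_of_eq ?_)
  rw [tsum_kernel_sq]
  simp only [mul_pow]

/-- The product over the non-terminal nodes of the kernels. -/
def kernelProd (κ : ℤ → ℝ≥0∞) (c : List Node) (n : Node → ℤ) : ℝ≥0∞ :=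
  (c.map fun a => κ (n (child a 0) - n a) * κ (n (child a 0) - n (child a 1))).prod

lemma kernelProd_extend (κ : ℤ → ℝ≥0∞) {c : List Node} {b : Node} (hc : IsTree c)
    (hb : b ∈ leaves c) (n : Node → ℤ) (z : ℤ × ℤ) :
    kernelProd κ (c ++ [b]) (extend n b z) =
      kernelProd κ c n * (κ (z.1 - n b) * κ (z.1 - z.2)) := by
  rw [kernelProd, List.map_append, List.prod_append, kernelProd]
  congr 1
  · congr 1
    refine List.map_congr_left fun a ha => ?_
    rw [extend_of_mem_nodes hb n z (hc.mem_nodes a ha),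
      extend_of_mem_nodes hb n z (child_mem_nodes.2 ha),
      extend_of_mem_nodes hb n z (child_mem_nodes.2 ha)]
  · simp [extend_child_zero, extend_child_one,
      extend_of_mem_nodes hb n z (mem_nodes_of_mem_leaves hb)]

lemma prod_leaves_extend {M : Type*} [CommMonoid M] {c : List Node} {b : Node} (hc : IsTree c)
    (hb : b ∈ leaves c) (n : Node → ℤ) (z : ℤ × ℤ) (h : Node → ℤ → M) :
    ∏ a ∈ leaves (c ++ [b]), h a (extend n b z a) =
      (∏ a ∈ (leaves c).erase b, h a (n a)) *
        (h (child b 0) z.1 * h (child b 1) z.2 * h (child b 2) (n b - z.1 + z.2)) := by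
  rw [prod_leaves_snoc hc hb, extend_child_zero, extend_child_one, extend_child_two]
  congr 1
  refine Finset.prod_congr rfl fun a ha => ?_
  rw [extend_of_mem_nodes hb n z (mem_nodes_of_mem_leaves (Finset.mem_of_mem_erase ha))]

lemma prod_update_erase {M : Type*} [CommMonoid M] {c : List Node} {b : Node}
    (hb : b ∈ leaves c) {X : Type*} (h : Node → X) (y : X) (G : Node → X → M) :
    ∏ a ∈ leaves c, G a (Function.update h b y a) =
      (∏ a ∈ (leaves c).erase b, G a (h a)) * G b y := by
  rw [← Finset.prod_erase_mul _ _ hb, Function.update_self]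
  congr 1
  refine Finset.prod_congr rfl fun a ha => ?_
  rw [Function.update_of_ne (Finset.ne_of_mem_erase ha)]

/-- The multilinear estimate on a bi-tree. -/
theorem tsum_kernelProd_le (κ : ℤ → ℝ≥0∞) (N : ℕ∞) {c : List Node} (hc : IsTree c)
    (h : Node → ℤ → ℝ≥0∞) :
    ∑' n : indexFunctions N c, kernelProd κ c n * ∏ a ∈ leaves c, h a (n.1 a) ≤
      (∑' n, κ n ^ 2) ^ c.length * ∏ a ∈ leaves c, l2norm (h a) := by
  classical
  induction hc generalizing h with
  | nil =>
    rw [← (indexEquivNil N).symm.tsum_eq]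
    simp only [leaves_nil, Finset.prod_pair root₁_ne_root₂, kernelProd, List.map_nil,
      List.prod_nil, one_mul, List.length_nil, pow_zero]
    refine le_trans (le_of_eq ?_) (tsum_mul_le_l2norm (h root₁) (h root₂))
    refine tsum_congr fun m => ?_
    simp [indexEquivNil]
  | @snoc c b hc hb ih =>
    rw [tsum_indexFunctions_snoc_ennreal N hc hb
      fun n => kernelProd κ (c ++ [b]) n * ∏ a ∈ leaves (c ++ [b]), h a (n a)]
    set T := expansion κ (h (child b 0)) (h (child b 1)) (h (child b 2)) with hT
    have h1 : ∀ n : indexFunctions N c, (∑' z : ℤ × ℤ, if Admissible N (n.1 b) z then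
        kernelProd κ (c ++ [b]) (extend n b z) *
          ∏ a ∈ leaves (c ++ [b]), h a (extend n b z a) else 0) ≤
        kernelProd κ c n * ∏ a ∈ leaves c, (Function.update h b T) a (n.1 a) := by
      intro n
      rw [prod_update_erase hb h T (fun a f => f (n.1 a)), hT, expansion,
        ← mul_assoc, ← ENNReal.tsum_mul_left]
      refine ENNReal.tsum_le_tsum fun z => ?_
      split_ifs
      · rw [kernelProd_extend κ hc hb, prod_leaves_extend hc hb]
        refine le_of_eq ?_
        ring
      · exact zero_le
    refine (ENNReal.tsum_le_tsum h1).trans ((ih _).trans ?_)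
    rw [prod_update_erase hb h T (fun _ f => l2norm f), prod_leaves_snoc hc hb,
      List.length_append, List.length_singleton, pow_succ]
    calc _ ≤ (∑' n, κ n ^ 2) ^ c.length * ((∏ a ∈ (leaves c).erase b, l2norm (h a)) *
          ((∑' n, κ n ^ 2) * (l2norm (h (child b 0)) * l2norm (h (child b 1)) *
            l2norm (h (child b 2))))) := by
          gcongr
          exact l2norm_expansion_le _ _ _ _
      _ = _ := by ring

/-! ### Pointwise bounds on the multipliers -/

/-- Bi-trees in which `r₁` is expanded first. -/
inductive IsRootedTree : List Node → Prop
  | base : IsRootedTree [root₁]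
  | snoc {c : List Node} {b : Node} (hc : IsRootedTree c) (hb : b ∈ leaves c) :
      IsRootedTree (c ++ [b])

lemma IsRootedTree.isTree {c : List Node} (hc : IsRootedTree c) : IsTree c := by
  induction hc with
  | base => exact isTree_root
  | snoc hc hb ih => exact ih.snoc hb

lemma IsRootedTree.one_le_length {c : List Node} (hc : IsRootedTree c) : 1 ≤ c.length := by
  cases hc <;> simp

lemma IsRootedTree.ne_nil {c : List Node} (hc : IsRootedTree c) : c ≠ [] := by
  cases hc <;> simp

lemma isRootedTree_of_mem {J : ℕ} : ∀ {c : List Node}, c ∈ orderedBiTrees (J + 1) →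
    IsRootedTree c := by
  induction J with
  | zero =>
    intro c hc
    simp only [orderedBiTrees, Finset.mem_singleton] at hc
    exact hc ▸ IsRootedTree.base
  | succ J ih =>
    intro c hc
    simp only [orderedBiTrees, Finset.mem_biUnion, Finset.mem_image] at hc
    obtain ⟨c0, hc0, b, hb, rfl⟩ := hc
    exact (ih hc0).snoc hb

lemma length_of_mem {J : ℕ} {c : List Node} (hc : c ∈ orderedBiTrees (J + 1)) :
    c.length = J + 1 := (orderedBiTrees_spec J c hc).2.1

/-- The relations between the frequencies of a node and of its children. -/
def IsIndex (c : List Node) (n : Node → ℤ) : Prop :=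
  n root₁ = n root₂ ∧ ∀ a ∈ c, n (child a 2) = n a - n (child a 0) + n (child a 1) ∧
    n (child a 0) ≠ n a ∧ n (child a 0) ≠ n (child a 1)

lemma isIndex_of_mem {N : ℕ∞} {c : List Node} {n : Node → ℤ} (hn : n ∈ indexFunctions N c) :
    IsIndex c n := by
  refine ⟨hn.2.1, fun a ha => ⟨?_, (admissible_of_mem hn ha).2⟩⟩
  have := (hn.2.2 a ha).2.1
  omega

lemma IsIndex.of_append {c d : List Node} {n : Node → ℤ} (hn : IsIndex (c ++ d) n) :
    IsIndex c n :=
  ⟨hn.1, fun a ha => hn.2 a (List.mem_append_left _ ha)⟩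

/-- Twice the sum of the squares of the frequencies of a node and of its children. -/
def nodeSize (n : Node → ℤ) (a : Node) : ℝ :=
  2 * ((n a : ℝ) ^ 2 + (n (child a 0) : ℝ) ^ 2 + (n (child a 1) : ℝ) ^ 2
    + (n (child a 2) : ℝ) ^ 2)

/-- The product of the two frequency differences at a node. -/
def nodeGap (n : Node → ℤ) (a : Node) : ℝ :=
  |((n (child a 0) - n a : ℤ) : ℝ)| * |((n (child a 0) - n (child a 1) : ℤ) : ℝ)|

lemma one_le_abs_cast {m : ℤ} (hm : m ≠ 0) : 1 ≤ |(m : ℝ)| := by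
  have := Int.one_le_abs hm
  exact_mod_cast this

section Node

variable {c : List Node} {n : Node → ℤ} {a : Node}

lemma one_le_nodeGap (hn : IsIndex c n) (ha : a ∈ c) : 1 ≤ nodeGap n a := by
  obtain ⟨-, h1, h2⟩ := hn.2 a ha
  have e1 := one_le_abs_cast (sub_ne_zero.2 h1)
  have e2 := one_le_abs_cast (sub_ne_zero.2 h2)
  unfold nodeGap
  nlinarith

lemma two_le_nodeSize (hn : IsIndex c n) (ha : a ∈ c) : 2 ≤ nodeSize n a := by
  obtain ⟨-, h1, -⟩ := hn.2 a ha
  unfold nodeSize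
  have : (1 : ℝ) ≤ (n a : ℝ) ^ 2 + (n (child a 0) : ℝ) ^ 2 := by
    have h : (1 : ℤ) ≤ (n a) ^ 2 + (n (child a 0)) ^ 2 := by
      by_contra h
      have e1 : n a = 0 := by nlinarith [sq_nonneg (n a), sq_nonneg (n (child a 0))]
      have e2 : n (child a 0) = 0 := by nlinarith [sq_nonneg (n a), sq_nonneg (n (child a 0))]
      exact h1 (e2.trans e1.symm)
    exact_mod_cast h
  nlinarith [sq_nonneg (n (child a 1) : ℝ), sq_nonneg (n (child a 2) : ℝ)]

lemma nodeGap_le_nodeSize : nodeGap n a ≤ nodeSize n a := by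
  unfold nodeGap nodeSize
  rw [← abs_mul, abs_le]
  push_cast
  constructor <;>
  nlinarith [sq_nonneg ((n (child a 0) : ℝ) + n a), sq_nonneg ((n (child a 0) : ℝ) + n (child a 1)),
    sq_nonneg ((n (child a 0) : ℝ) - n a + (n (child a 0) - n (child a 1))),
    sq_nonneg ((n (child a 0) : ℝ) - n a - (n (child a 0) - n (child a 1))),
    sq_nonneg (n (child a 0) : ℝ), sq_nonneg (n (child a 1) : ℝ), sq_nonneg (n a : ℝ),
    sq_nonneg (n (child a 2) : ℝ)]

lemma le_abs_phase (hn : IsIndex c n) (ha : a ∈ c) :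
    nodeGap n a * nodeSize n a / 2 ≤ |(phase n a : ℝ)| := by
  obtain ⟨h0, -, -⟩ := hn.2 a ha
  have h1 : |(phase n a : ℝ)| = nodeGap n a * |(n a : ℝ) ^ 2 + (n (child a 0) : ℝ) ^ 2 +
      (n (child a 1) : ℝ) ^ 2 + (n (child a 2) : ℝ) ^ 2 +
        2 * ((n (child a 0) : ℝ) + n (child a 2)) ^ 2| := by
    unfold nodeGap
    rw [← abs_mul, ← abs_mul, phase, h0, phase_factorization]
    rcases sign_eq a with h | h <;> rw [h] <;> push_cast
    · rw [one_mul]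
    · rw [neg_one_mul, abs_neg]
  rw [h1, mul_div_assoc]
  refine mul_le_mul_of_nonneg_left ?_ (by unfold nodeGap; positivity)
  refine le_trans ?_ (le_abs_self _)
  unfold nodeSize
  nlinarith [sq_nonneg ((n (child a 0) : ℝ) + n (child a 2))]

end Node

lemma one_le_bracket (m : ℤ) : 1 ≤ bracket m := by
  unfold bracket
  rw [Real.one_le_sqrt]
  nlinarith [sq_nonneg (m : ℝ)]

lemma bracket_pos (m : ℤ) : 0 < bracket m := one_pos.trans_le (one_le_bracket m)

lemma bracket_sq (m : ℤ) : bracket m ^ 2 = 1 + (m : ℝ) ^ 2 :=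
  Real.sq_sqrt (by positivity)

lemma bracket_rpow_le {m : ℤ} {Y β : ℝ} (hY : 2 ≤ Y) (h : (m : ℝ) ^ 2 ≤ Y / 2) (hβ : 0 ≤ β) :
    bracket m ^ β ≤ Y ^ (β / 2) := by
  have h1 : bracket m ^ β = (bracket m ^ 2) ^ (β / 2) := by
    rw [← Real.rpow_natCast, ← Real.rpow_mul (bracket_pos m).le]
    congr 1
    push_cast
    ring
  rw [h1, bracket_sq]
  exact Real.rpow_le_rpow (by positivity) (by linarith) (by positivity)

lemma sq_le_nodeSize (n : Node → ℤ) (a : Node) : (n a : ℝ) ^ 2 ≤ nodeSize n a / 2 := by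
  unfold nodeSize
  nlinarith [sq_nonneg (n (child a 0) : ℝ), sq_nonneg (n (child a 1) : ℝ),
    sq_nonneg (n (child a 2) : ℝ)]

lemma sq_child_le_nodeSize (n : Node → ℤ) (a : Node) (i : Fin 3) :
    (n (child a i) : ℝ) ^ 2 ≤ nodeSize n a / 2 := by
  unfold nodeSize
  have hi : i = 0 ∨ i = 1 ∨ i = 2 := by omega
  rcases hi with rfl | rfl | rfl <;>
  nlinarith [sq_nonneg (n (child a 0) : ℝ), sq_nonneg (n (child a 1) : ℝ),
    sq_nonneg (n (child a 2) : ℝ), sq_nonneg (n a : ℝ)]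

/-! ### Growth of the phases -/

/-- The lower bound for the phase of the `J`-th generation outside of the nearly resonant sets. -/
def growth (K : ℝ) (J : ℕ) : ℝ := ∏ i ∈ Finset.Ico 1 J, K * (2 * (i : ℝ) + 4) ^ 3

lemma growth_one (K : ℝ) : growth K 1 = 1 := by simp [growth]

lemma growth_succ (K : ℝ) {J : ℕ} (hJ : 1 ≤ J) :
    growth K (J + 1) = growth K J * (K * (2 * (J : ℝ) + 4) ^ 3) := by
  rw [growth, Finset.prod_Ico_succ_top hJ, growth]

lemma growth_pos {K : ℝ} (hK : 0 < K) (J : ℕ) : 0 < growth K J :=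
  Finset.prod_pos fun i _ => by positivity

lemma cumPhase_one {c : List Node} (hc : IsRootedTree c) (n : Node → ℤ) :
    cumPhase n c 1 = phase n root₁ := by
  induction hc with
  | base => simp [cumPhase]
  | snoc hc hb ih => rw [cumPhase_append n _ _ hc.one_le_length, ih]

lemma IsRootedTree.root₁_mem {c : List Node} (hc : IsRootedTree c) : root₁ ∈ c := by
  induction hc with
  | base => simp
  | snoc hc hb ih => exact List.mem_append_left _ ih

lemma one_le_abs_phase {c : List Node} {n : Node → ℤ} {a : Node} (hn : IsIndex c n)
    (ha : a ∈ c) : 1 ≤ |(phase n a : ℝ)| := by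
  refine le_trans ?_ (le_abs_phase hn ha)
  nlinarith [one_le_nodeGap hn ha, two_le_nodeSize hn ha]

lemma one_le_cube (J : ℕ) : (1 : ℝ) ≤ (2 * (J : ℝ) + 4) ^ 3 :=
  one_le_pow₀ (by linarith [(Nat.cast_nonneg J : (0 : ℝ) ≤ J)])

lemma phase_bounds {K : ℝ} (hK : 0 < K) {c : List Node} (hc : IsRootedTree c) {n : Node → ℤ}
    (hn : IsIndex c n) (h : HighlyNonresonant K c n) :
    growth K c.length ≤ |(cumPhase n c c.length : ℝ)| ∧
    |(cumPhase n c 1 : ℝ)| ≤ (1 + 1 / K) * |(cumPhase n c c.length : ℝ)| ∧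
    ∀ j ∈ Finset.Icc 1 c.length, 1 ≤ |(cumPhase n c j : ℝ)| := by
  induction hc with
  | base =>
    have h1 := one_le_abs_phase hn (a := root₁) (by simp)
    have h2 : cumPhase n [root₁] 1 = phase n root₁ := cumPhase_one IsRootedTree.base n
    simp only [List.length_singleton, growth_one, h2]
    refine ⟨h1, ?_, ?_⟩
    · have : 0 ≤ 1 / K := by positivity
      nlinarith
    · intro j hj
      simp only [Finset.Icc_self, Finset.mem_singleton] at hj
      subst hj
      rwa [h2]
  | @snoc c b hc hb ih =>
    rw [highlyNonresonant_snoc] at h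
    obtain ⟨i1, i2, i3⟩ := ih hn.of_append h.1
    have h2 := h.2 hc.one_le_length
    rw [← cumPhase_snoc] at h2
    have hcube := one_le_cube c.length
    simp only [List.length_append, List.length_singleton]
    rw [cumPhase_append n c [b] hc.one_le_length]
    have hA : 0 < K * (2 * (c.length : ℝ) + 4) ^ 3 := by positivity
    have hm1 := mul_le_mul_of_nonneg_left
      (le_max_left |(cumPhase n c c.length : ℝ)| |(cumPhase n c 1 : ℝ)|) hA.le
    have hm2 := mul_le_mul_of_nonneg_left
      (le_max_right |(cumPhase n c c.length : ℝ)| |(cumPhase n c 1 : ℝ)|) hA.le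
    have h0 := growth_pos hK c.length
    have hlast : growth K (c.length + 1) ≤ |(cumPhase n (c ++ [b]) (c.length + 1) : ℝ)| := by
      rw [growth_succ K hc.one_le_length]
      nlinarith
    refine ⟨hlast, ?_, ?_⟩
    · have h3 : K * |(cumPhase n c 1 : ℝ)| ≤ |(cumPhase n (c ++ [b]) (c.length + 1) : ℝ)| := by
        have : K * |(cumPhase n c 1 : ℝ)| ≤
            K * (2 * (c.length : ℝ) + 4) ^ 3 * |(cumPhase n c 1 : ℝ)| := by
          refine mul_le_mul_of_nonneg_right ?_ (abs_nonneg _)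
          nlinarith
        linarith
      have h4 : |(cumPhase n c 1 : ℝ)| ≤
          1 / K * |(cumPhase n (c ++ [b]) (c.length + 1) : ℝ)| := by
        rw [one_div, ← div_eq_inv_mul, le_div_iff₀ hK]
        linarith
      nlinarith [abs_nonneg (cumPhase n (c ++ [b]) (c.length + 1) : ℝ)]
    · intro j hj
      rw [Finset.mem_Icc] at hj
      rcases Nat.lt_succ_iff_lt_or_eq.1 (Nat.lt_succ_of_le hj.2) with h3 | rfl
      · rw [cumPhase_append n c [b] (by omega)]
        exact i3 j (Finset.mem_Icc.2 ⟨hj.1, by omega⟩)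
      · have : 0 < |(cumPhase n (c ++ [b]) (c.length + 1) : ℝ)| :=
          lt_of_lt_of_le (growth_pos hK _) hlast
        exact one_le_abs_cast fun h => by simp [h] at this

lemma abs_phase_le_of_highlyNonresonant {K : ℝ} (hK : 0 < K) {c : List Node} {b : Node}
    (hc : IsRootedTree c) {n : Node → ℤ} (h : HighlyNonresonant K (c ++ [b]) n) :
    |(phase n b : ℝ)| ≤ (1 + 1 / K) * |(cumPhase n (c ++ [b]) (c.length + 1) : ℝ)| := by
  rw [highlyNonresonant_snoc] at h
  have h2 := h.2 hc.one_le_length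
  rw [← cumPhase_snoc] at h2
  have hcube := one_le_cube c.length
  have hm1 := mul_le_mul_of_nonneg_left
      (le_max_left |(cumPhase n c c.length : ℝ)| |(cumPhase n c 1 : ℝ)|)
      (by positivity : 0 ≤ K * (2 * (c.length : ℝ) + 4) ^ 3)
  have h3 : K * |(cumPhase n c c.length : ℝ)| ≤
      |(cumPhase n (c ++ [b]) (c.length + 1) : ℝ)| := by
    have : K * |(cumPhase n c c.length : ℝ)| ≤
        K * (2 * (c.length : ℝ) + 4) ^ 3 * |(cumPhase n c c.length : ℝ)| := by
      refine mul_le_mul_of_nonneg_right ?_ (abs_nonneg _)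
      nlinarith
    linarith
  have h4 : |(cumPhase n c c.length : ℝ)| ≤
      1 / K * |(cumPhase n (c ++ [b]) (c.length + 1) : ℝ)| := by
    rw [one_div, ← div_eq_inv_mul, le_div_iff₀ hK]
    linarith
  have h5 : (phase n b : ℝ) =
      (cumPhase n (c ++ [b]) (c.length + 1) : ℝ) - (cumPhase n c c.length : ℝ) := by
    rw [cumPhase_snoc]
    push_cast
    ring
  rw [h5]
  have := abs_sub (cumPhase n (c ++ [b]) (c.length + 1) : ℝ) (cumPhase n c c.length : ℝ)
  linarith

lemma abs_phase_le_of_not_highlyNonresonant {K : ℝ} (hK : 0 < K) {c : List Node} {b : Node}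
    (hc : IsRootedTree c) {n : Node → ℤ} (hn : IsIndex c n) (h : HighlyNonresonant K c n)
    (h' : ¬ HighlyNonresonant K (c ++ [b]) n) :
    |(phase n b : ℝ)| ≤
      ((K + 2) * (2 * (c.length : ℝ) + 4) ^ 3) * |(cumPhase n c c.length : ℝ)| := by
  rw [highlyNonresonant_snoc] at h'
  push Not at h'
  obtain ⟨-, h2⟩ := h' h
  obtain ⟨-, h3, -⟩ := phase_bounds hK hc hn h
  have hcube := one_le_cube c.length
  set P := |(cumPhase n c c.length : ℝ)| with hP
  have hP0 : 0 ≤ P := abs_nonneg _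
  have h4 : max P |(cumPhase n c 1 : ℝ)| ≤ (1 + 1 / K) * P := by
    refine max_le ?_ h3
    have : 0 ≤ 1 / K := by positivity
    nlinarith
  have h5 : K * (2 * (c.length : ℝ) + 4) ^ 3 * max P |(cumPhase n c 1 : ℝ)| ≤
      (K + 1) * (2 * (c.length : ℝ) + 4) ^ 3 * P := by
    calc _ ≤ K * (2 * (c.length : ℝ) + 4) ^ 3 * ((1 + 1 / K) * P) := by gcongr
      _ = _ := by field_simp
  have h6 : (phase n b : ℝ) =
      ((cumPhase n c c.length + phase n b : ℤ) : ℝ) - (cumPhase n c c.length : ℝ) := by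
    push_cast
    ring
  rw [h6]
  have := abs_sub ((cumPhase n c c.length + phase n b : ℤ) : ℝ) (cumPhase n c c.length : ℝ)
  nlinarith

/-! ### Weights -/

lemma rpow_step {x Y φ Φ Λ C e₁ e₂ θ η : ℝ} (hx : 1 ≤ x) (hY : 1 ≤ Y) (hφ : x * Y / 2 ≤ φ)
    (hC : 1 ≤ C) (hφΦ : φ ≤ C * Φ) (hΛ : 0 < Λ) (hΛΦ : Λ ≤ Φ) (h1 : e₁ ≤ e₂ - θ)
    (h2 : η ≤ e₂ - θ) (hη : 0 ≤ η) (h3 : e₂ - θ ≤ 1) (hθ : 0 ≤ θ) :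
    Y ^ e₁ * Φ ^ (-e₂) ≤ 2 * C * Λ ^ (-θ) * x ^ (-η) := by
  have hΦ : 0 < Φ := hΛ.trans_le hΛΦ
  have hx0 : 0 < x := by linarith
  have hY0 : 0 < Y := by linarith
  have a1 : Φ ^ (-e₂) = Φ ^ (-θ) * Φ ^ (-(e₂ - θ)) := by
    rw [← Real.rpow_add hΦ]
    congr 1
    ring
  have a2 : Φ ^ (-θ) ≤ Λ ^ (-θ) := Real.rpow_le_rpow_of_nonpos hΛ hΛΦ (by linarith)
  have a3 : Φ ^ (-(e₂ - θ)) ≤ (x * Y / (2 * C)) ^ (-(e₂ - θ)) := by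
    refine Real.rpow_le_rpow_of_nonpos (by positivity) ?_ (by linarith)
    rw [div_le_iff₀ (by positivity)]
    nlinarith
  have a4 : (x * Y / (2 * C)) ^ (-(e₂ - θ)) =
      x ^ (-(e₂ - θ)) * Y ^ (-(e₂ - θ)) * (2 * C) ^ (e₂ - θ) := by
    rw [Real.div_rpow (by positivity) (by positivity), Real.mul_rpow hx0.le hY0.le,
      Real.rpow_neg (by positivity : 0 ≤ 2 * C), div_inv_eq_mul]
  have a5 : (2 * C) ^ (e₂ - θ) ≤ 2 * C := by
    conv_rhs => rw [← Real.rpow_one (2 * C)]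
    exact Real.rpow_le_rpow_of_exponent_le (by linarith) h3
  have a6 : x ^ (-(e₂ - θ)) ≤ x ^ (-η) := Real.rpow_le_rpow_of_exponent_le hx (by linarith)
  have a7 : Y ^ e₁ * Y ^ (-(e₂ - θ)) ≤ 1 := by
    rw [← Real.rpow_add hY0]
    exact Real.rpow_le_one_of_one_le_of_nonpos hY (by linarith)
  rw [a1]
  calc Y ^ e₁ * (Φ ^ (-θ) * Φ ^ (-(e₂ - θ)))
      ≤ Y ^ e₁ * (Λ ^ (-θ) * (x ^ (-(e₂ - θ)) * Y ^ (-(e₂ - θ)) * (2 * C) ^ (e₂ - θ))) := by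
        rw [← a4]
        gcongr
    _ = (2 * C) ^ (e₂ - θ) * Λ ^ (-θ) * x ^ (-(e₂ - θ)) * (Y ^ e₁ * Y ^ (-(e₂ - θ))) := by ring
    _ ≤ 2 * C * Λ ^ (-θ) * x ^ (-η) * 1 := by gcongr
    _ = _ := by ring

lemma rpow_last_step {x Y φ α δ : ℝ} (hx : 1 ≤ x) (hY : 1 ≤ Y) (hxY : x ≤ Y)
    (hφ : x * Y / 2 ≤ φ) (h : 3 * α / 2 + δ ≤ 3 / 10) (hδ : 0 < δ) :
    Y ^ (3 * α / 2) * φ ^ (-(2 / 5) : ℝ) ≤ 2 * x ^ (-(1 / 2 + δ)) := by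
  have hx0 : 0 < x := by linarith
  have hY0 : 0 < Y := by linarith
  have a1 : φ ^ (-(2 / 5) : ℝ) ≤ (x * Y / 2) ^ (-(2 / 5) : ℝ) :=
    Real.rpow_le_rpow_of_nonpos (by positivity) hφ (by norm_num)
  have a2 : (x * Y / 2) ^ (-(2 / 5) : ℝ) =
      x ^ (-(2 / 5) : ℝ) * Y ^ (-(2 / 5) : ℝ) * 2 ^ (2 / 5 : ℝ) := by
    rw [Real.div_rpow (by positivity) (by positivity), Real.mul_rpow hx0.le hY0.le,
      Real.rpow_neg (by norm_num : (0 : ℝ) ≤ 2), div_inv_eq_mul]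
  have a3 : (2 : ℝ) ^ (2 / 5 : ℝ) ≤ 2 := by
    conv_rhs => rw [← Real.rpow_one 2]
    exact Real.rpow_le_rpow_of_exponent_le (by norm_num) (by norm_num)
  have a4 : Y ^ (3 * α / 2) * Y ^ (-(2 / 5) : ℝ) ≤ x ^ (-(1 / 10 + δ)) := by
    rw [← Real.rpow_add hY0]
    calc _ ≤ Y ^ (-(1 / 10 + δ)) := Real.rpow_le_rpow_of_exponent_le hY (by linarith)
      _ ≤ _ := Real.rpow_le_rpow_of_nonpos hx0 hxY (by linarith)
  have a5 : x ^ (-(1 / 2 + δ)) = x ^ (-(2 / 5) : ℝ) * x ^ (-(1 / 10 + δ)) := by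
    rw [← Real.rpow_add hx0]
    congr 1
    ring
  calc _ ≤ Y ^ (3 * α / 2) * (x ^ (-(2 / 5) : ℝ) * Y ^ (-(2 / 5) : ℝ) * 2 ^ (2 / 5 : ℝ)) := by
        rw [← a2]; gcongr
    _ = 2 ^ (2 / 5 : ℝ) * (x ^ (-(2 / 5) : ℝ) * (Y ^ (3 * α / 2) * Y ^ (-(2 / 5) : ℝ))) := by ring
    _ ≤ 2 * (x ^ (-(2 / 5) : ℝ) * x ^ (-(1 / 10 + δ))) := by gcongr
    _ = _ := by rw [a5]

/-- The product of the weights `⟨n_a⟩^α` over the terminal nodes. -/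
def leafWeight (α : ℝ) (c : List Node) (n : Node → ℤ) : ℝ :=
  ∏ a ∈ leaves c, bracket (n a) ^ α

/-- The product over the non-terminal nodes of a power of the frequency differences. -/
def gapProd (η : ℝ) (c : List Node) (n : Node → ℤ) : ℝ :=
  (c.map fun a => nodeGap n a ^ (-η)).prod

/-- The product over the non-terminal nodes of a power of the size. -/
def sizeProd (β : ℝ) (c : List Node) (n : Node → ℤ) : ℝ :=
  (c.map fun a => nodeSize n a ^ β).prod

/-- The product of powers of the phases of all generations. -/
def phaseProd (e : ℝ) (c : List Node) (n : Node → ℤ) : ℝ :=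
  ∏ j ∈ Finset.Icc 1 c.length, |(cumPhase n c j : ℝ)| ^ (-e)

/-- The constant in the pointwise bound for the multipliers of the `J`-th generation. -/
def treeConst (K θ : ℝ) (J : ℕ) : ℝ :=
  ∏ j ∈ Finset.Icc 1 J, 2 * (1 + 1 / K) * growth K j ^ (-θ)

lemma nodeSize_nonneg (n : Node → ℤ) (a : Node) : 0 ≤ nodeSize n a := by
  unfold nodeSize; positivity

lemma nodeGap_nonneg (n : Node → ℤ) (a : Node) : 0 ≤ nodeGap n a := by
  unfold nodeGap; positivity

lemma list_prod_nonneg {ι : Type*} (l : List ι) {f : ι → ℝ} (h : ∀ i ∈ l, 0 ≤ f i) :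
    0 ≤ (l.map f).prod := by
  refine List.prod_nonneg fun x hx => ?_
  obtain ⟨i, hi, rfl⟩ := List.mem_map.1 hx
  exact h i hi

lemma leafWeight_nonneg (α : ℝ) (c : List Node) (n : Node → ℤ) : 0 ≤ leafWeight α c n :=
  Finset.prod_nonneg fun _ _ => Real.rpow_nonneg (bracket_pos _).le _

lemma gapProd_nonneg (η : ℝ) (c : List Node) (n : Node → ℤ) : 0 ≤ gapProd η c n :=
  list_prod_nonneg c fun a _ => Real.rpow_nonneg (nodeGap_nonneg n a) _

lemma sizeProd_nonneg (β : ℝ) (c : List Node) (n : Node → ℤ) : 0 ≤ sizeProd β c n :=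
  list_prod_nonneg c fun a _ => Real.rpow_nonneg (nodeSize_nonneg n a) _

lemma phaseProd_nonneg (e : ℝ) (c : List Node) (n : Node → ℤ) : 0 ≤ phaseProd e c n :=
  Finset.prod_nonneg fun _ _ => Real.rpow_nonneg (abs_nonneg _) _

lemma treeConst_nonneg {K θ : ℝ} (hK : 0 < K) (J : ℕ) : 0 ≤ treeConst K θ J :=
  Finset.prod_nonneg fun j _ => by
    have := growth_pos hK j
    positivity

lemma gapProd_snoc (η : ℝ) (c : List Node) (b : Node) (n : Node → ℤ) :
    gapProd η (c ++ [b]) n = gapProd η c n * nodeGap n b ^ (-η) := by simp [gapProd]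

lemma sizeProd_snoc (β : ℝ) (c : List Node) (b : Node) (n : Node → ℤ) :
    sizeProd β (c ++ [b]) n = sizeProd β c n * nodeSize n b ^ β := by simp [sizeProd]

lemma phaseProd_snoc (e : ℝ) (c : List Node) (b : Node) (n : Node → ℤ) :
    phaseProd e (c ++ [b]) n =
      phaseProd e c n * |(cumPhase n (c ++ [b]) (c.length + 1) : ℝ)| ^ (-e) := by
  rw [phaseProd, List.length_append, List.length_singleton,
    Finset.prod_Icc_succ_top (by omega), phaseProd]
  congr 1
  refine Finset.prod_congr rfl fun j hj => ?_
  rw [cumPhase_append n c [b] (Finset.mem_Icc.1 hj).2]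

lemma treeConst_succ (K θ : ℝ) (J : ℕ) :
    treeConst K θ (J + 1) = treeConst K θ J * (2 * (1 + 1 / K) * growth K (J + 1) ^ (-θ)) := by
  rw [treeConst, Finset.prod_Icc_succ_top (by omega), treeConst]

lemma prod_children_bracket_le {c : List Node} {n : Node → ℤ} {b : Node} (hn : IsIndex c n)
    (hb : b ∈ c) {α : ℝ} (hα : 0 ≤ α) :
    bracket (n (child b 0)) ^ α * bracket (n (child b 1)) ^ α * bracket (n (child b 2)) ^ α ≤
      nodeSize n b ^ (3 * α / 2) := by
  have hY := two_le_nodeSize hn hb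
  have h : ∀ i, bracket (n (child b i)) ^ α ≤ nodeSize n b ^ (α / 2) := fun i =>
    bracket_rpow_le hY (sq_child_le_nodeSize n b i) hα
  have h0 : ∀ i, 0 ≤ bracket (n (child b i)) ^ α := fun i =>
    Real.rpow_nonneg (bracket_pos _).le _
  have hY0 : 0 < nodeSize n b := by linarith
  calc _ ≤ nodeSize n b ^ (α / 2) * nodeSize n b ^ (α / 2) * nodeSize n b ^ (α / 2) := by
        gcongr <;> first | exact h0 _ | exact h _
    _ = _ := by
        rw [← Real.rpow_add hY0, ← Real.rpow_add hY0]
        congr 1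
        ring

lemma leafWeight_snoc_le {c : List Node} {n : Node → ℤ} {b : Node} (hc : IsTree c)
    (hb : b ∈ leaves c) (hn : IsIndex (c ++ [b]) n) {α : ℝ} (hα : 0 ≤ α) :
    leafWeight α (c ++ [b]) n ≤
      leafWeight α c n * bracket (n b) ^ (-α) * nodeSize n b ^ (3 * α / 2) := by
  rw [leafWeight, prod_leaves_snoc hc hb, leafWeight, ← Finset.prod_erase_mul _ _ hb,
    mul_assoc _ (bracket (n b) ^ α), ← Real.rpow_add (bracket_pos _), add_neg_cancel,
    Real.rpow_zero, mul_one]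
  refine mul_le_mul_of_nonneg_left (prod_children_bracket_le hn (by simp) hα) ?_
  exact Finset.prod_nonneg fun a _ => Real.rpow_nonneg (bracket_pos _).le _

/-- The pointwise bound for the multipliers. -/
lemma multiplier_bound {K s α β γ e θ η : ℝ} (hK : 0 < K) (hs : 0 ≤ s) (hγ : 0 ≤ γ) (hγα : γ ≤ α)
    (hθ : 0 ≤ θ) (hη : 0 ≤ η) (he : e ≤ 1) (hηe : η ≤ e - θ)
    (h1 : s + 2 * α - γ / 2 + β ≤ e) (h2 : 3 * α / 2 + β ≤ e - θ)
    {c : List Node} (hc : IsRootedTree c) {n : Node → ℤ} (hn : IsIndex c n)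
    (h : HighlyNonresonant K c n) {b : Node} (hb : b ∈ leaves c) :
    bracket (n root₁) ^ (2 * s) * leafWeight α c n * sizeProd β c n * phaseProd e c n *
      bracket (n b) ^ (-γ) ≤ treeConst K θ c.length * gapProd η c n := by
  have hC : 1 ≤ 1 + 1 / K := by
    have : 0 ≤ 1 / K := by positivity
    linarith
  have hα : 0 ≤ α := hγ.trans hγα
  induction hc generalizing b with
  | base =>
    have hr : root₁ ∈ [root₁] := by simp
    have hY := two_le_nodeSize hn hr
    have hY0 : 0 < nodeSize n root₁ := by linarith
    have hroot : leaves [root₁] = insert root₂ (children root₁) := by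
      have := leaves_snoc IsTree.nil root₁_mem_leaves_nil
      rw [List.nil_append] at this
      rw [this, leaves_nil]
      ext a
      have h12 := root₁_ne_root₂
      simp only [Finset.mem_union, Finset.mem_erase, Finset.mem_insert, Finset.mem_singleton]
      by_cases h : a = root₂
      · subst h
        simp [h12.symm]
      · simp only [h, or_false, false_or]
        tauto
    have hle : ∀ a ∈ leaves [root₁], (n a : ℝ) ^ 2 ≤ nodeSize n root₁ / 2 := by
      intro a ha
      rw [hroot, Finset.mem_insert] at ha
      rcases ha with rfl | ha
      · rw [← hn.1]
        exact sq_le_nodeSize n root₁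
      · obtain ⟨i, rfl⟩ := mem_children.1 ha
        exact sq_child_le_nodeSize n root₁ i
    have hcard : ((leaves [root₁]).erase b).card = 3 := by
      rw [Finset.card_erase_of_mem hb, card_leaves isTree_root]
      rfl
    have hlw : leafWeight α [root₁] n * bracket (n b) ^ (-γ) ≤
        nodeSize n root₁ ^ (2 * α - γ / 2) := by
      rw [leafWeight, ← Finset.prod_erase_mul _ _ hb, mul_assoc,
        ← Real.rpow_add (bracket_pos _)]
      calc _ ≤ (∏ a ∈ (leaves [root₁]).erase b, nodeSize n root₁ ^ (α / 2)) *
            nodeSize n root₁ ^ ((α + -γ) / 2) := by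
            refine mul_le_mul
              (Finset.prod_le_prod (fun a _ => Real.rpow_nonneg (bracket_pos _).le _)
              fun a ha => bracket_rpow_le hY (hle a (Finset.mem_of_mem_erase ha)) hα)
              (bracket_rpow_le hY (hle b hb) (by linarith))
              (Real.rpow_nonneg (bracket_pos _).le _) (by positivity)
        _ = _ := by
            rw [Finset.prod_const, hcard, ← Real.rpow_natCast, ← Real.rpow_mul hY0.le,
              ← Real.rpow_add hY0]
            congr 1
            push_cast
            ring
    have hm : bracket (n root₁) ^ (2 * s) ≤ nodeSize n root₁ ^ s := by
      have := bracket_rpow_le hY (sq_le_nodeSize n root₁) (by linarith : 0 ≤ 2 * s)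
      rwa [mul_div_cancel_left₀ s two_ne_zero] at this
    have hph : cumPhase n [root₁] 1 = phase n root₁ := cumPhase_one IsRootedTree.base n
    have hone := one_le_abs_phase hn hr
    have step := rpow_step (Λ := 1) (C := 1 + 1 / K) (e₁ := s + 2 * α - γ / 2 + β) (e₂ := e)
      (θ := 0) (η := η) (one_le_nodeGap hn hr) (by linarith) (le_abs_phase hn hr) hC
      (by nlinarith : |(phase n root₁ : ℝ)| ≤ (1 + 1 / K) * |(phase n root₁ : ℝ)|) one_pos hone
      (by linarith) (by linarith) hη (by linarith) le_rfl
    have hg : treeConst K θ 1 = 2 * (1 + 1 / K) := by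
      simp [treeConst, growth_one]
    simp only [List.length_singleton, hg, gapProd, sizeProd, phaseProd, List.map_cons, List.map_nil,
      List.prod_cons, List.prod_nil, mul_one, Finset.Icc_self, Finset.prod_singleton, hph]
    calc _ = bracket (n root₁) ^ (2 * s) * (leafWeight α [root₁] n * bracket (n b) ^ (-γ)) *
          nodeSize n root₁ ^ β * |(phase n root₁ : ℝ)| ^ (-e) := by ring
      _ ≤ nodeSize n root₁ ^ s * nodeSize n root₁ ^ (2 * α - γ / 2) * nodeSize n root₁ ^ β *
          |(phase n root₁ : ℝ)| ^ (-e) := by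
          have h0 := mul_nonneg (leafWeight_nonneg α [root₁] n)
            (Real.rpow_nonneg (bracket_pos (n b)).le (-γ))
          gcongr
      _ = nodeSize n root₁ ^ (s + 2 * α - γ / 2 + β) * |(phase n root₁ : ℝ)| ^ (-e) := by
          rw [← Real.rpow_add hY0, ← Real.rpow_add hY0]
          congr 2
          ring
      _ ≤ _ := by simpa using step
  | @snoc c b₀ hc hb₀ ih =>
    have hmem : b₀ ∈ c ++ [b₀] := by simp
    have IH := ih hn.of_append ((highlyNonresonant_snoc.1 h).1) hb₀
    have hY := two_le_nodeSize hn hmem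
    have hY0 : 0 < nodeSize n b₀ := by linarith
    obtain ⟨p1, -, -⟩ := phase_bounds hK (hc.snoc hb₀) hn h
    rw [List.length_append, List.length_singleton] at p1
    have step := rpow_step (Λ := growth K (c.length + 1)) (C := 1 + 1 / K)
      (e₁ := 3 * α / 2 + β) (e₂ := e) (θ := θ) (η := η) (one_le_nodeGap hn hmem) (by linarith)
      (le_abs_phase hn hmem) hC (abs_phase_le_of_highlyNonresonant hK hc h) (growth_pos hK _) p1
      h2 hηe hη (by linarith) hθ
    have hlw := leafWeight_snoc_le hc.isTree hb₀ hn hα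
    have hbr : bracket (n b) ^ (-γ) ≤ 1 :=
      Real.rpow_le_one_of_one_le_of_nonpos (one_le_bracket _) (by linarith)
    have hbr₀ : bracket (n b₀) ^ (-α) ≤ bracket (n b₀) ^ (-γ) :=
      Real.rpow_le_rpow_of_exponent_le (one_le_bracket _) (by linarith)
    rw [List.length_append, List.length_singleton, treeConst_succ, gapProd_snoc, sizeProd_snoc,
      phaseProd_snoc]
    set Φ := |(cumPhase n (c ++ [b₀]) (c.length + 1) : ℝ)| with hΦ
    have n1 : 0 ≤ bracket (n root₁) ^ (2 * s) := Real.rpow_nonneg (bracket_pos _).le _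
    have n2 := leafWeight_nonneg α c n
    have n3 := sizeProd_nonneg β c n
    have n4 := phaseProd_nonneg e c n
    have n5 : 0 ≤ bracket (n b₀) ^ (-γ) := Real.rpow_nonneg (bracket_pos _).le _
    have n6 : 0 ≤ Φ ^ (-e) := Real.rpow_nonneg (abs_nonneg _) _
    have n7 := leafWeight_nonneg α (c ++ [b₀]) n
    have n8 : 0 ≤ nodeSize n b₀ ^ β := Real.rpow_nonneg hY0.le _
    have n9 : 0 ≤ nodeSize n b₀ ^ (3 * α / 2) := Real.rpow_nonneg hY0.le _
    calc _ ≤ bracket (n root₁) ^ (2 * s) * leafWeight α (c ++ [b₀]) n *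
          (sizeProd β c n * nodeSize n b₀ ^ β) * (phaseProd e c n * Φ ^ (-e)) * 1 := by gcongr
      _ ≤ bracket (n root₁) ^ (2 * s) *
          (leafWeight α c n * bracket (n b₀) ^ (-γ) * nodeSize n b₀ ^ (3 * α / 2)) *
          (sizeProd β c n * nodeSize n b₀ ^ β) * (phaseProd e c n * Φ ^ (-e)) * 1 := by
          have : leafWeight α (c ++ [b₀]) n ≤
              leafWeight α c n * bracket (n b₀) ^ (-γ) * nodeSize n b₀ ^ (3 * α / 2) :=
            hlw.trans (by gcongr)
          gcongr
      _ = (bracket (n root₁) ^ (2 * s) * leafWeight α c n * sizeProd β c n * phaseProd e c n *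
          bracket (n b₀) ^ (-γ)) * (nodeSize n b₀ ^ (3 * α / 2 + β) * Φ ^ (-e)) := by
          rw [Real.rpow_add hY0]
          ring
      _ ≤ (treeConst K θ c.length * gapProd η c n) *
          (2 * (1 + 1 / K) * growth K (c.length + 1) ^ (-θ) * nodeGap n b₀ ^ (-η)) := by
          have := mul_nonneg (treeConst_nonneg (θ := θ) hK c.length) (gapProd_nonneg η c n)
          gcongr
      _ = _ := by ring

/-! ### Absolute estimates for the forms of one bi-tree -/

/-- The admissible range of regularities. -/
structure Regime (s σ : ℝ) : Prop where
  lower : 3 / 10 < s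
  upper : s ≤ 1 / 2
  sigma_lt : σ < s - 1 / 2
  lt_sigma : s - 1 / 2 - (s - 3 / 10) / 3 < σ

/-- The decay exponent of the kernels. -/
def kernelExp (s : ℝ) : ℝ := 1 / 2 + (s - 3 / 10) / 4

/-- The kernel `|m|^{-η}`. -/
def kernel (η : ℝ) (m : ℤ) : ℝ≥0∞ := ENNReal.ofReal (|(m : ℝ)| ^ (-η))

/-- The square of the `ℓ²`-norm of the kernel. -/
def kernelConst (η : ℝ) : ℝ := ∑' m : ℤ, |(m : ℝ)| ^ (-(2 * η))

lemma tsum_kernel {η : ℝ} (hη : 1 / 2 < η) :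
    ∑' m, kernel η m ^ 2 = ENNReal.ofReal (kernelConst η) := by
  rw [kernelConst, ENNReal.ofReal_tsum_of_nonneg (fun m => Real.rpow_nonneg (abs_nonneg _) _)
    (Real.summable_abs_int_rpow (by linarith))]
  refine tsum_congr fun m => ?_
  rw [kernel, ← ENNReal.ofReal_pow (Real.rpow_nonneg (abs_nonneg _) _), ← Real.rpow_natCast,
    ← Real.rpow_mul (abs_nonneg _)]
  congr 2
  push_cast
  ring

lemma one_le_kernelConst {η : ℝ} (hη : 1 / 2 < η) : 1 ≤ kernelConst η := by
  have h := (Real.summable_abs_int_rpow (b := 2 * η) (by linarith)).le_tsum (1 : ℤ)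
    (fun m _ => Real.rpow_nonneg (abs_nonneg _) _)
  simpa [kernelConst] using h

lemma ofReal_list_prod {ι : Type*} (l : List ι) {f : ι → ℝ} (h : ∀ i ∈ l, 0 ≤ f i) :
    ENNReal.ofReal (l.map f).prod = (l.map fun i => ENNReal.ofReal (f i)).prod := by
  induction l with
  | nil => simp
  | cons a l ih =>
    simp only [List.map_cons, List.prod_cons]
    rw [ENNReal.ofReal_mul (h a (by simp)), ih fun i hi => h i (by simp [hi])]

lemma kernelProd_eq (η : ℝ) (c : List Node) (n : Node → ℤ) :
    kernelProd (kernel η) c n = ENNReal.ofReal (gapProd η c n) := by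
  rw [gapProd, ofReal_list_prod _ fun a _ => Real.rpow_nonneg (nodeGap_nonneg n a) _, kernelProd]
  congr 1
  refine List.map_congr_left fun a _ => ?_
  rw [kernel, kernel, ← ENNReal.ofReal_mul (Real.rpow_nonneg (abs_nonneg _) _),
    ← Real.mul_rpow (abs_nonneg _) (abs_nonneg _), nodeGap]

/-- The norm of `H^σ` for sequences of nonnegative numbers. -/
def eNormH (σ : ℝ) (H : ℤ → ℝ≥0∞) : ℝ≥0∞ :=
  l2norm fun k => ENNReal.ofReal (bracket k ^ σ) * H k

lemma tsum_le_of_leafWeight_le {η σ C : ℝ} (hη : 1 / 2 < η) (N : ℕ∞) {c : List Node}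
    (hc : IsTree c) {w : (Node → ℤ) → ℝ≥0∞}
    (hw : ∀ n ∈ indexFunctions N c,
      w n * ENNReal.ofReal (leafWeight (-σ) c n) ≤ ENNReal.ofReal (C * gapProd η c n))
    (hC : 0 ≤ C) (H : ℤ → ℝ≥0∞) :
    ∑' n : indexFunctions N c, w n * ∏ a ∈ leaves c, H (n.1 a) ≤
      ENNReal.ofReal (C * kernelConst η ^ c.length) * eNormH σ H ^ (2 * c.length + 2) := by
  have h1 : ∀ n : indexFunctions N c, w n * ∏ a ∈ leaves c, H (n.1 a) ≤ ENNReal.ofReal C *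
      (kernelProd (kernel η) c n *
        ∏ a ∈ leaves c, (ENNReal.ofReal (bracket (n.1 a) ^ σ) * H (n.1 a))) := by
    intro n
    have h2 : ∏ a ∈ leaves c, H (n.1 a) = ENNReal.ofReal (leafWeight (-σ) c n) *
        ∏ a ∈ leaves c, (ENNReal.ofReal (bracket (n.1 a) ^ σ) * H (n.1 a)) := by
      rw [leafWeight, ENNReal.ofReal_prod_of_nonneg
        fun a _ => Real.rpow_nonneg (bracket_pos _).le _, ← Finset.prod_mul_distrib]
      refine Finset.prod_congr rfl fun a _ => ?_
      rw [← mul_assoc, ← ENNReal.ofReal_mul (Real.rpow_nonneg (bracket_pos _).le _),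
        ← Real.rpow_add (bracket_pos _), neg_add_cancel, Real.rpow_zero, ENNReal.ofReal_one,
        one_mul]
    rw [h2, ← mul_assoc, ← mul_assoc, kernelProd_eq, ← ENNReal.ofReal_mul hC]
    gcongr
    exact hw n n.2
  refine (ENNReal.tsum_le_tsum h1).trans ?_
  rw [ENNReal.tsum_mul_left]
  have h3 := tsum_kernelProd_le (kernel η) N hc
    fun _ k => ENNReal.ofReal (bracket k ^ σ) * H k
  rw [Finset.prod_const, card_leaves hc, tsum_kernel hη] at h3
  have hk : 0 ≤ kernelConst η := zero_le_one.trans (one_le_kernelConst hη)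
  rw [ENNReal.ofReal_mul hC, ENNReal.ofReal_pow hk, mul_assoc]
  gcongr
  exact h3

open Classical in
/-- The absolute value of the multiplier of a boundary term. -/
def absMultiplier (K s : ℝ) (c : List Node) (n : Node → ℤ) : ℝ≥0∞ :=
  if HighlyNonresonant K c n then
    ENNReal.ofReal (bracket (n root₁) ^ (2 * s) * phaseProd 1 c n) else 0

/-- The decay exponent of the phases. -/
def decayExp : ℝ := 1 / 20

lemma exists_mem_leaves {c : List Node} (hc : IsTree c) : ∃ b, b ∈ leaves c := by
  have : (leaves c).Nonempty := by
    rw [← Finset.card_pos, card_leaves hc]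
    omega
  exact this

lemma Regime.half_lt {s σ : ℝ} (h : Regime s σ) : 1 / 2 < kernelExp s := by
  unfold kernelExp
  linarith [h.lower]

lemma le_list_prod {ι : Type*} (l : List ι) {f : ι → ℝ} (h : ∀ i ∈ l, 1 ≤ f i) :
    1 ≤ (l.map f).prod ∧ ∀ i ∈ l, f i ≤ (l.map f).prod := by
  induction l with
  | nil => simp
  | cons a l ih =>
    obtain ⟨h1, h2⟩ := ih fun i hi => h i (by simp [hi])
    have ha := h a (by simp)
    simp only [List.map_cons, List.prod_cons, List.mem_cons, forall_eq_or_imp]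
    refine ⟨one_le_mul_of_one_le_of_one_le ha h1, by nlinarith, fun i hi => ?_⟩
    have := h2 i hi
    nlinarith

lemma bracket_le_sizeProd {α : ℝ} (hα : 0 ≤ α) {c : List Node} (hc : IsRootedTree c)
    {n : Node → ℤ} (hn : IsIndex c n) {b : Node} (hb : b ∈ leaves c) :
    bracket (n b) ^ (2 * α) ≤ sizeProd α c n := by
  have hone : ∀ a ∈ c, 1 ≤ nodeSize n a ^ α := fun a ha =>
    Real.one_le_rpow (by linarith [two_le_nodeSize hn ha]) hα
  have key : ∀ a ∈ c, (n b : ℝ) ^ 2 ≤ nodeSize n a / 2 →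
      bracket (n b) ^ (2 * α) ≤ sizeProd α c n := by
    intro a ha h
    refine le_trans ?_ ((le_list_prod c hone).2 a ha)
    have := bracket_rpow_le (two_le_nodeSize hn ha) h (by linarith : 0 ≤ 2 * α)
    rwa [mul_div_cancel_left₀ α two_ne_zero] at this
  rcases mem_nodes.1 (mem_nodes_of_mem_leaves hb) with rfl | rfl | ⟨a, ha, i, rfl⟩
  · exact key root₁ hc.root₁_mem (sq_le_nodeSize n root₁)
  · refine key root₁ hc.root₁_mem ?_
    rw [← hn.1]
    exact sq_le_nodeSize n root₁
  · exact key a ha (sq_child_le_nodeSize n a i)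

section

variable {K s σ : ℝ}

lemma Regime.multiplier_bound_size (hr : Regime s σ) (hK : 0 < K) {c : List Node}
    (hc : IsRootedTree c) {n : Node → ℤ} (hn : IsIndex c n) (h : HighlyNonresonant K c n) :
    bracket (n root₁) ^ (2 * s) * leafWeight (-σ) c n * sizeProd (-σ) c n * phaseProd 1 c n ≤
      treeConst K decayExp c.length * gapProd (kernelExp s) c n := by
  obtain ⟨b, hb⟩ := exists_mem_leaves hc.isTree
  have h1 := hr.lower
  have h2 := hr.upper
  have h3 := hr.sigma_lt
  have h4 := hr.lt_sigma
  have := multiplier_bound (s := s) (α := -σ) (β := -σ) (γ := 0) (e := 1) (θ := decayExp)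
    (η := kernelExp s) hK (by linarith) le_rfl (by linarith) (by norm_num [decayExp])
    (by unfold kernelExp; linarith) le_rfl (by unfold kernelExp decayExp; linarith) (by linarith)
    (by unfold decayExp; linarith) hc hn h hb
  simpa using this

lemma Regime.tsum_absMultiplier_size_le (hr : Regime s σ) (hK : 0 < K) (N : ℕ∞) {c : List Node}
    (hc : IsRootedTree c) (H : ℤ → ℝ≥0∞) :
    ∑' n : indexFunctions N c, absMultiplier K s c n * ENNReal.ofReal (sizeProd (-σ) c n) *
        ∏ a ∈ leaves c, H (n.1 a) ≤
      ENNReal.ofReal (treeConst K decayExp c.length * kernelConst (kernelExp s) ^ c.length) *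
        eNormH σ H ^ (2 * c.length + 2) := by
  refine tsum_le_of_leafWeight_le hr.half_lt N hc.isTree
    (w := fun n => absMultiplier K s c n * ENNReal.ofReal (sizeProd (-σ) c n)) ?_
    (treeConst_nonneg hK _) H
  intro n hn
  unfold absMultiplier
  split_ifs with h
  · rw [← ENNReal.ofReal_mul (mul_nonneg (Real.rpow_nonneg (bracket_pos _).le _)
      (phaseProd_nonneg _ _ _)), ← ENNReal.ofReal_mul (mul_nonneg (mul_nonneg
      (Real.rpow_nonneg (bracket_pos _).le _) (phaseProd_nonneg _ _ _)) (sizeProd_nonneg _ _ _))]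
    refine ENNReal.ofReal_le_ofReal ((le_of_eq ?_).trans
      (hr.multiplier_bound_size hK hc (isIndex_of_mem hn) h))
    ring
  · simp

/-- The absolute estimate for the boundary terms. -/
lemma Regime.tsum_absMultiplier_le (hr : Regime s σ) (hK : 0 < K) (N : ℕ∞) {c : List Node}
    (hc : IsRootedTree c) (H : ℤ → ℝ≥0∞) :
    ∑' n : indexFunctions N c, absMultiplier K s c n * ∏ a ∈ leaves c, H (n.1 a) ≤
      ENNReal.ofReal (treeConst K decayExp c.length * kernelConst (kernelExp s) ^ c.length) *
        eNormH σ H ^ (2 * c.length + 2) := by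
  refine le_trans (ENNReal.tsum_le_tsum fun n => ?_) (hr.tsum_absMultiplier_size_le hK N hc H)
  gcongr
  refine le_mul_of_one_le_right zero_le ?_
  rw [ENNReal.one_le_ofReal]
  refine (le_list_prod c fun a ha => Real.one_le_rpow ?_ ?_).1
  · linarith [two_le_nodeSize (isIndex_of_mem n.2) ha]
  · linarith [hr.upper, hr.sigma_lt]

/-- The absolute estimate for the resonant terms. -/
lemma Regime.tsum_resonant_le (hr : Regime s σ) (hK : 0 < K) (N : ℕ∞) {c : List Node}
    (hc : IsRootedTree c) {b : Node} (hb : b ∈ leaves c) (H : ℤ → ℝ≥0∞) :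
    ∑' n : indexFunctions N c, absMultiplier K s c n * H (n.1 b) ^ 2 *
        ∏ a ∈ leaves c, H (n.1 a) ≤
      ENNReal.ofReal (treeConst K decayExp c.length * kernelConst (kernelExp s) ^ c.length) *
        eNormH σ H ^ (2 * c.length + 4) := by
  have h1 : ∀ n : indexFunctions N c, absMultiplier K s c n * H (n.1 b) ^ 2 *
      ∏ a ∈ leaves c, H (n.1 a) ≤ eNormH σ H ^ 2 * (absMultiplier K s c n *
        ENNReal.ofReal (sizeProd (-σ) c n) * ∏ a ∈ leaves c, H (n.1 a)) := by
    intro n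
    have h2 : H (n.1 b) ^ 2 ≤ eNormH σ H ^ 2 * ENNReal.ofReal (sizeProd (-σ) c n) := by
      have h3 : H (n.1 b) = ENNReal.ofReal (bracket (n.1 b) ^ (-σ)) *
          (ENNReal.ofReal (bracket (n.1 b) ^ σ) * H (n.1 b)) := by
        rw [← mul_assoc, ← ENNReal.ofReal_mul (Real.rpow_nonneg (bracket_pos _).le _),
          ← Real.rpow_add (bracket_pos _), neg_add_cancel, Real.rpow_zero, ENNReal.ofReal_one,
          one_mul]
      have h4 : ENNReal.ofReal (bracket (n.1 b) ^ σ) * H (n.1 b) ≤ eNormH σ H :=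
        le_l2norm (fun k => ENNReal.ofReal (bracket k ^ σ) * H k) (n.1 b)
      have h5 : ENNReal.ofReal (bracket (n.1 b) ^ (-σ)) ^ 2 ≤
          ENNReal.ofReal (sizeProd (-σ) c n) := by
        rw [← ENNReal.ofReal_pow (Real.rpow_nonneg (bracket_pos _).le _), ← Real.rpow_natCast,
          ← Real.rpow_mul (bracket_pos _).le]
        refine ENNReal.ofReal_le_ofReal ?_
        have := bracket_le_sizeProd (α := -σ) (by linarith [hr.upper, hr.sigma_lt]) hc
          (isIndex_of_mem n.2) hb
        convert this using 2
        push_cast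
        ring
      rw [h3, mul_pow, mul_comm]
      gcongr
    calc _ ≤ absMultiplier K s c n * (eNormH σ H ^ 2 * ENNReal.ofReal (sizeProd (-σ) c n)) *
          ∏ a ∈ leaves c, H (n.1 a) := by gcongr
      _ = _ := by ring
  refine (ENNReal.tsum_le_tsum h1).trans ?_
  rw [ENNReal.tsum_mul_left]
  calc _ ≤ eNormH σ H ^ 2 * (ENNReal.ofReal
        (treeConst K decayExp c.length * kernelConst (kernelExp s) ^ c.length) *
        eNormH σ H ^ (2 * c.length + 2)) := by
        gcongr
        exact hr.tsum_absMultiplier_size_le hK N hc H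
    _ = _ := by ring

open Classical in
/-- The absolute value of the multiplier of a nearly resonant term. -/
def absNearMultiplier (K s : ℝ) (c : List Node) (b : Node) (n : Node → ℤ) : ℝ≥0∞ :=
  if HighlyNonresonant K (c ++ [b]) n then 0 else absMultiplier K s c n

lemma Regime.near_multiplier_bound (hr : Regime s σ) (hK : 0 < K) {c : List Node}
    (hc : IsRootedTree c) {b : Node} (hb : b ∈ leaves c) {n : Node → ℤ}
    (hn : IsIndex (c ++ [b]) n) (h : HighlyNonresonant K c n)
    (h' : ¬ HighlyNonresonant K (c ++ [b]) n) :
    bracket (n root₁) ^ (2 * s) * phaseProd 1 c n * leafWeight (-σ) (c ++ [b]) n ≤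
      (2 * ((K + 2) * (2 * (c.length : ℝ) + 4) ^ 3) * treeConst K decayExp c.length) *
        gapProd (kernelExp s) (c ++ [b]) n := by
  have h1 := hr.lower
  have h2 := hr.upper
  have h3 := hr.sigma_lt
  have h4 := hr.lt_sigma
  have hα : 0 ≤ -σ := by linarith
  have hmem : b ∈ c ++ [b] := by simp
  have hY := two_le_nodeSize hn hmem
  have hG := one_le_nodeGap hn hmem
  have key := multiplier_bound (s := s) (α := -σ) (β := 0) (γ := -σ) (e := 3 / 5) (θ := decayExp)
    (η := kernelExp s) hK (by linarith) hα le_rfl (by norm_num [decayExp])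
    (by unfold kernelExp; linarith) (by norm_num) (by unfold kernelExp decayExp; linarith)
    (by linarith) (by unfold decayExp; linarith) hc hn.of_append h hb
  have hsize : sizeProd 0 c n = 1 := by simp [sizeProd]
  rw [hsize, mul_one, neg_neg] at key
  have last := rpow_last_step (α := -σ) (δ := (s - 3 / 10) / 4) hG (by linarith)
    nodeGap_le_nodeSize (le_abs_phase hn hmem) (by linarith) (by linarith)
  obtain ⟨-, -, p3⟩ := phase_bounds hK hc hn.of_append h
  have p4 := p3 c.length (Finset.mem_Icc.2 ⟨hc.one_le_length, le_rfl⟩)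
  have p5 := abs_phase_le_of_not_highlyNonresonant hK hc hn.of_append h h'
  have hlw := leafWeight_snoc_le hc.isTree hb hn hα
  set A := (K + 2) * (2 * (c.length : ℝ) + 4) ^ 3 with hA
  have hA1 : 1 ≤ A := one_le_mul_of_one_le_of_one_le (by linarith) (one_le_cube _)
  set Φ := |(cumPhase n c c.length : ℝ)| with hΦ
  have hφ1 := one_le_abs_phase hn hmem
  have hlast : Φ ^ (-(2 / 5) : ℝ) ≤ A * |(phase n b : ℝ)| ^ (-(2 / 5) : ℝ) := by
    have e1 : Φ ^ (-(2 / 5) : ℝ) ≤ (|(phase n b : ℝ)| / A) ^ (-(2 / 5) : ℝ) := by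
      refine Real.rpow_le_rpow_of_nonpos (by positivity) ?_ (by norm_num)
      rw [div_le_iff₀ (by positivity)]
      linarith
    have e2 : (|(phase n b : ℝ)| / A) ^ (-(2 / 5) : ℝ) =
        A ^ (2 / 5 : ℝ) * |(phase n b : ℝ)| ^ (-(2 / 5) : ℝ) := by
      rw [Real.div_rpow (by positivity) (by positivity), Real.rpow_neg (by positivity : 0 ≤ A),
        div_inv_eq_mul, mul_comm]
    have e3 : A ^ (2 / 5 : ℝ) ≤ A := by
      conv_rhs => rw [← Real.rpow_one A]
      exact Real.rpow_le_rpow_of_exponent_le hA1 (by norm_num)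
    rw [e2] at e1
    exact e1.trans (mul_le_mul_of_nonneg_right e3 (Real.rpow_nonneg (abs_nonneg _) _))
  have hpp : phaseProd 1 c n ≤ phaseProd (3 / 5) c n * Φ ^ (-(2 / 5) : ℝ) := by
    have hlen := hc.one_le_length
    obtain ⟨L, hL⟩ : ∃ L, c.length = L + 1 := ⟨c.length - 1, by omega⟩
    rw [phaseProd, phaseProd, hΦ, hL]
    rw [hΦ, hL] at p4
    rw [hL] at p3
    rw [Finset.prod_Icc_succ_top (by omega), Finset.prod_Icc_succ_top (by omega), mul_assoc,
      ← Real.rpow_add (by linarith)]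
    norm_num only
    refine mul_le_mul_of_nonneg_right (Finset.prod_le_prod (fun j _ => ?_) fun j hj => ?_) ?_
    · exact Real.rpow_nonneg (abs_nonneg _) _
    · refine Real.rpow_le_rpow_of_exponent_le (p3 j ?_) (by norm_num)
      rw [Finset.mem_Icc] at hj ⊢
      omega
    · exact Real.rpow_nonneg (abs_nonneg _) _
  have n1 : 0 ≤ bracket (n root₁) ^ (2 * s) := Real.rpow_nonneg (bracket_pos _).le _
  have n2 := leafWeight_nonneg (-σ) c n
  have n3 := phaseProd_nonneg (3 / 5) c n
  have n4 := phaseProd_nonneg 1 c n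
  have n5 : 0 ≤ bracket (n b) ^ σ := Real.rpow_nonneg (bracket_pos _).le _
  have n6 : 0 ≤ nodeSize n b ^ (3 * -σ / 2) := Real.rpow_nonneg (by linarith) _
  have n7 := leafWeight_nonneg (-σ) (c ++ [b]) n
  have n8 : 0 ≤ |(phase n b : ℝ)| ^ (-(2 / 5) : ℝ) := Real.rpow_nonneg (abs_nonneg _) _
  rw [neg_neg] at hlw
  rw [gapProd_snoc]
  calc _ ≤ bracket (n root₁) ^ (2 * s) *
        (phaseProd (3 / 5) c n * (A * |(phase n b : ℝ)| ^ (-(2 / 5) : ℝ))) *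
        (leafWeight (-σ) c n * bracket (n b) ^ σ * nodeSize n b ^ (3 * -σ / 2)) := by
        have := hpp.trans (mul_le_mul_of_nonneg_left hlast n3)
        gcongr
    _ = A * (bracket (n root₁) ^ (2 * s) * leafWeight (-σ) c n * phaseProd (3 / 5) c n *
        bracket (n b) ^ σ) * (nodeSize n b ^ (3 * -σ / 2) *
          |(phase n b : ℝ)| ^ (-(2 / 5) : ℝ)) := by ring
    _ ≤ A * (treeConst K decayExp c.length * gapProd (kernelExp s) c n) *
        (2 * nodeGap n b ^ (-(1 / 2 + (s - 3 / 10) / 4))) := by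
        have := mul_nonneg (treeConst_nonneg (θ := decayExp) hK c.length)
          (gapProd_nonneg (kernelExp s) c n)
        gcongr
    _ = _ := by
        unfold kernelExp
        ring

/-- The absolute estimate for the nearly resonant terms. -/
lemma Regime.tsum_near_le (hr : Regime s σ) (hK : 0 < K) (N : ℕ∞) {c : List Node}
    (hc : IsRootedTree c) {b : Node} (hb : b ∈ leaves c) (H : ℤ → ℝ≥0∞) :
    ∑' n : indexFunctions N (c ++ [b]), absNearMultiplier K s c b n *
        ∏ a ∈ leaves (c ++ [b]), H (n.1 a) ≤
      ENNReal.ofReal (2 * ((K + 2) * (2 * (c.length : ℝ) + 4) ^ 3) *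
        treeConst K decayExp c.length * kernelConst (kernelExp s) ^ (c.length + 1)) *
        eNormH σ H ^ (2 * c.length + 4) := by
  have h0 := treeConst_nonneg (θ := decayExp) hK c.length
  have key := tsum_le_of_leafWeight_le (σ := σ) (C := 2 * ((K + 2) * (2 * (c.length : ℝ) + 4) ^ 3) *
        treeConst K decayExp c.length) hr.half_lt N (hc.isTree.snoc hb)
    (w := absNearMultiplier K s c b) ?_ (by positivity) H
  · simpa only [List.length_append, List.length_singleton, mul_add, mul_one, add_assoc] using key
  intro n hn
  have hn' := isIndex_of_mem hn
  unfold absNearMultiplier absMultiplier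
  split_ifs with h1 h2
  · simp
  · rw [← ENNReal.ofReal_mul (mul_nonneg (Real.rpow_nonneg (bracket_pos _).le _)
      (phaseProd_nonneg _ _ _))]
    exact ENNReal.ofReal_le_ofReal (hr.near_multiplier_bound hK hc hb hn' h2 h1)
  · simp

end

/-! ### Summation over the generations -/

lemma eventually_pow_le_growth {K : ℝ} (hK : 0 < K) (p : ℕ) :
    ∀ᶠ J : ℕ in atTop, (J : ℝ) ^ p ≤ growth K J := by
  have hs : Summable fun J : ℕ => (J : ℝ) ^ p / growth K J := by
    refine summable_of_ratio_norm_eventually_le (r := 1 / 2) (by norm_num) ?_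
    have h1 : Tendsto (fun J : ℕ => K * (2 * (J : ℝ) + 4) ^ 3) atTop atTop := by
      refine Tendsto.const_mul_atTop hK ((tendsto_pow_atTop (by norm_num)).comp ?_)
      refine tendsto_atTop_add_const_right _ _ ?_
      exact tendsto_natCast_atTop_atTop.const_mul_atTop two_pos
    filter_upwards [h1.eventually_ge_atTop (2 * 2 ^ p), eventually_ge_atTop 1] with J hJ hJ1
    have hg := growth_pos hK J
    have hA : 0 < K * (2 * (J : ℝ) + 4) ^ 3 := by positivity
    rw [Real.norm_of_nonneg (by have := growth_pos hK (J + 1); positivity),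
      Real.norm_of_nonneg (by positivity), growth_succ K hJ1]
    have h2 : ((J + 1 : ℕ) : ℝ) ^ p ≤ 2 ^ p * (J : ℝ) ^ p := by
      rw [← mul_pow]
      gcongr
      have : (1 : ℝ) ≤ J := by exact_mod_cast hJ1
      push_cast
      linarith
    rw [div_le_iff₀ (by positivity)]
    have h3 : 1 / 2 * ((J : ℝ) ^ p / growth K J) * (growth K J * (K * (2 * (J : ℝ) + 4) ^ 3)) =
        1 / 2 * (J : ℝ) ^ p * (K * (2 * (J : ℝ) + 4) ^ 3) := by
      field_simp
    rw [h3]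
    refine h2.trans ?_
    have : 0 ≤ (J : ℝ) ^ p := by positivity
    nlinarith
  filter_upwards [hs.tendsto_atTop_zero.eventually_le_const one_pos] with J hJ
  rwa [div_le_one (growth_pos hK J)] at hJ

/-- A bound for all the forms of a given generation. -/
def genBound (K s ρ : ℝ) (J : ℕ) : ℝ :=
  (orderedBiTrees (J + 1)).card * (2 * (K + 2) * (2 * (J : ℝ) + 6) ^ 5 *
    treeConst K decayExp (J + 1) * kernelConst (kernelExp s) ^ (J + 2) * ρ ^ (2 * J + 6))

lemma genBound_nonneg {K s ρ : ℝ} (hK : 0 < K) (hs : 3 / 10 < s) (hρ : 0 ≤ ρ) (J : ℕ) :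
    0 ≤ genBound K s ρ J := by
  have h1 := treeConst_nonneg (θ := decayExp) hK (J + 1)
  have h2 := one_le_kernelConst (η := kernelExp s) (by unfold kernelExp; linarith)
  unfold genBound
  positivity

lemma summable_genBound {K s ρ : ℝ} (hK : 0 < K) (hs : 3 / 10 < s) (hρ : 0 ≤ ρ) :
    Summable (genBound K s ρ) := by
  have hS := one_le_kernelConst (η := kernelExp s) (by unfold kernelExp; linarith)
  set S := kernelConst (kernelExp s) with hSdef
  set M : ℝ := 2 * 2 ^ 5 * (2 * (1 + 1 / K)) * S * ρ ^ 2 with hM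
  have hM0 : 0 ≤ M := by positivity
  refine summable_of_ratio_norm_eventually_le (r := 1 / 2) (by norm_num) ?_
  have h1 : ∀ᶠ J : ℕ in atTop, ((J + 2 : ℕ) : ℝ) ^ 40 ≤ growth K (J + 2) :=
    (tendsto_add_atTop_nat 2).eventually (eventually_pow_le_growth hK 40)
  have h2 : ∀ᶠ J : ℕ in atTop, 2 * M ≤ (J : ℝ) :=
    tendsto_natCast_atTop_atTop.eventually_ge_atTop _
  filter_upwards [h1, h2] with J hJ hJ2
  rw [Real.norm_of_nonneg (genBound_nonneg hK hs hρ _),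
    Real.norm_of_nonneg (genBound_nonneg hK hs hρ _)]
  have hJ0 : (0 : ℝ) ≤ J := Nat.cast_nonneg J
  have hdec : growth K (J + 2) ^ (-decayExp) ≤ 1 / ((J : ℝ) + 2) ^ 2 := by
    have hb : (0 : ℝ) < ((J + 2 : ℕ) : ℝ) ^ 40 := by positivity
    refine (Real.rpow_le_rpow_of_nonpos hb hJ (by norm_num [decayExp])).trans (le_of_eq ?_)
    rw [← Real.rpow_natCast, ← Real.rpow_mul (by positivity), decayExp]
    norm_num
  have hT := treeConst_nonneg (θ := decayExp) hK (J + 1)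
  have h6 : (2 * ((J + 1 : ℕ) : ℝ) + 6) ^ 5 ≤ 2 ^ 5 * (2 * (J : ℝ) + 6) ^ 5 := by
    rw [← mul_pow]
    gcongr
    push_cast
    linarith
  unfold genBound
  rw [card_orderedBiTrees_succ, treeConst_succ]
  have hg := growth_pos hK (J + 2)
  have hg' : 0 ≤ growth K (J + 1 + 1) ^ (-decayExp) := Real.rpow_nonneg (growth_pos hK _).le _
  set X : ℝ := (orderedBiTrees (J + 1)).card * (2 * (K + 2) * (2 * (J : ℝ) + 6) ^ 5 *
    treeConst K decayExp (J + 1) * S ^ (J + 2) * ρ ^ (2 * J + 6)) with hX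
  have hX0 : 0 ≤ X := by positivity
  calc _ ≤ (((orderedBiTrees (J + 1)).card * (2 * J + 4) : ℕ) : ℝ) *
        (2 * (K + 2) * (2 ^ 5 * (2 * (J : ℝ) + 6) ^ 5) *
        (treeConst K decayExp (J + 1) * (2 * (1 + 1 / K) * (1 / ((J : ℝ) + 2) ^ 2))) *
        S ^ (J + 1 + 2) * ρ ^ (2 * (J + 1) + 6)) := by
        gcongr
    _ = X * (M * (1 / ((J : ℝ) + 2))) := by
        rw [hX, hM]
        push_cast
        field_simp
        ring
    _ ≤ X * (1 / 2) := by
        gcongr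
        rw [mul_one_div, div_le_iff₀ (by positivity)]
        linarith
    _ = _ := by ring

/-! ### Norms -/

lemma l2norm_add_le {ι : Type*} (f g : ι → ℝ≥0∞) : l2norm (f + g) ≤ l2norm f + l2norm g := by
  let _ : MeasurableSpace ι := ⊤
  have h := ENNReal.lintegral_Lp_add_le
    (μ := (MeasureTheory.Measure.count : MeasureTheory.Measure ι))
    (f := f) (g := g) measurable_from_top.aemeasurable
    measurable_from_top.aemeasurable (p := 2) (by norm_num)
  simp only [MeasureTheory.lintegral_count] at h
  simpa only [l2norm, ← ENNReal.rpow_natCast, Nat.cast_ofNat] using h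

lemma l2norm_const_mul {ι : Type*} (a : ℝ≥0∞) (f : ι → ℝ≥0∞) :
    l2norm (fun i => a * f i) = a * l2norm f := by
  refine le_antisymm (le_of_sq_le_sq_ennreal ?_) (le_of_sq_le_sq_ennreal ?_) <;>
  · rw [mul_pow, l2norm_sq, l2norm_sq, ← ENNReal.tsum_mul_left]
    simp only [mul_pow, le_refl]

lemma l2norm_mono {ι : Type*} {f g : ι → ℝ≥0∞} (h : ∀ i, f i ≤ g i) : l2norm f ≤ l2norm g := by
  refine le_of_sq_le_sq_ennreal ?_
  rw [l2norm_sq, l2norm_sq]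
  exact ENNReal.tsum_le_tsum fun i => pow_le_pow_left' (h i) 2

lemma eNormH_add_le (σ : ℝ) (f g : ℤ → ℝ≥0∞) : eNormH σ (f + g) ≤ eNormH σ f + eNormH σ g := by
  unfold eNormH
  refine le_trans (le_of_eq ?_) (l2norm_add_le _ _)
  congr 1
  funext k
  simp [mul_add]

lemma eNormH_const_mul (σ : ℝ) (a : ℝ≥0∞) (f : ℤ → ℝ≥0∞) :
    eNormH σ (fun k => a * f k) = a * eNormH σ f := by
  unfold eNormH
  rw [← l2norm_const_mul]
  congr 1
  funext k
  ring

lemma eNormH_mono_fun (σ : ℝ) {f g : ℤ → ℝ≥0∞} (h : ∀ i, f i ≤ g i) :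
    eNormH σ f ≤ eNormH σ g :=
  l2norm_mono fun i => by gcongr; exact h i

lemma eNormH_mono {σ s : ℝ} (h : σ ≤ s) (f : ℤ → ℝ≥0∞) : eNormH σ f ≤ eNormH s f :=
  l2norm_mono fun i => by
    gcongr
    exact one_le_bracket i

lemma weighted_sq_nonneg (r : ℝ) (f : ℤ → ℂ) (n : ℤ) :
    0 ≤ bracket n ^ (2 * r) * ‖f n‖ ^ 2 :=
  mul_nonneg (Real.rpow_nonneg (bracket_pos _).le _) (by positivity)

lemma eNormH_sq (r : ℝ) (f : ℤ → ℂ) :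
    eNormH r (fun k => ‖f k‖ₑ) ^ 2 = ∑' n, ENNReal.ofReal (bracket n ^ (2 * r) * ‖f n‖ ^ 2) := by
  rw [eNormH, l2norm_sq]
  refine tsum_congr fun n => ?_
  rw [mul_pow, ← ENNReal.ofReal_pow (Real.rpow_nonneg (bracket_pos _).le _),
    ENNReal.ofReal_mul (Real.rpow_nonneg (bracket_pos _).le _), ← ofReal_norm,
    ENNReal.ofReal_pow (norm_nonneg _), ← Real.rpow_natCast, ← Real.rpow_mul (bracket_pos _).le]
  congr 3
  push_cast
  ring

lemma normH_nonneg (r : ℝ) (f : ℤ → ℂ) : 0 ≤ normH r f := Real.sqrt_nonneg _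

lemma MemH.eNormH_eq {r : ℝ} {f : ℤ → ℂ} (hf : MemH r f) :
    eNormH r (fun k => ‖f k‖ₑ) = ENNReal.ofReal (normH r f) := by
  have h : eNormH r (fun k => ‖f k‖ₑ) ^ 2 = ENNReal.ofReal (normH r f) ^ 2 := by
    rw [eNormH_sq, ← ENNReal.ofReal_tsum_of_nonneg (weighted_sq_nonneg r f) hf,
      ← ENNReal.ofReal_pow (normH_nonneg r f), normH,
      Real.sq_sqrt (tsum_nonneg (weighted_sq_nonneg r f))]
  exact le_antisymm (le_of_sq_le_sq_ennreal h.le) (le_of_sq_le_sq_ennreal h.ge)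

lemma memH_of_eNormH_lt_top {r : ℝ} {f : ℤ → ℂ} (h : eNormH r (fun k => ‖f k‖ₑ) < ⊤) :
    MemH r f := by
  have h1 : ∑' n, ENNReal.ofReal (bracket n ^ (2 * r) * ‖f n‖ ^ 2) ≠ ⊤ := by
    rw [← eNormH_sq]
    exact (ENNReal.pow_lt_top h).ne
  have h2 := ENNReal.summable_toReal h1
  refine h2.congr fun n => ?_
  rw [ENNReal.toReal_ofReal (weighted_sq_nonneg r f n)]

lemma MemH.eNormH_lt_top {r : ℝ} {f : ℤ → ℂ} (hf : MemH r f) :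
    eNormH r (fun k => ‖f k‖ₑ) < ⊤ := by
  rw [hf.eNormH_eq]
  exact ENNReal.ofReal_lt_top

lemma MemH.mono {σ s : ℝ} (h : σ ≤ s) {f : ℤ → ℂ} (hf : MemH s f) : MemH σ f :=
  memH_of_eNormH_lt_top ((eNormH_mono h _).trans_lt hf.eNormH_lt_top)

lemma MemH.normH_mono {σ s : ℝ} (h : σ ≤ s) {f : ℤ → ℂ} (hf : MemH s f) :
    normH σ f ≤ normH s f := by
  have := eNormH_mono h (fun k => ‖f k‖ₑ)
  rw [hf.eNormH_eq, (hf.mono h).eNormH_eq] at this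
  exact (ENNReal.ofReal_le_ofReal_iff (Real.sqrt_nonneg _)).1 this

lemma enorm_sub_le' (a b : ℂ) : ‖a - b‖ₑ ≤ ‖a‖ₑ + ‖b‖ₑ := by
  have := enorm_add_le a (-b)
  rwa [enorm_neg, ← sub_eq_add_neg] at this

lemma MemH.sub {r : ℝ} {f g : ℤ → ℂ} (hf : MemH r f) (hg : MemH r g) : MemH r (f - g) := by
  refine memH_of_eNormH_lt_top (lt_of_le_of_lt ?_
    (ENNReal.add_lt_top.2 ⟨hf.eNormH_lt_top, hg.eNormH_lt_top⟩))
  refine (eNormH_mono_fun r (g := (fun k => ‖f k‖ₑ) + fun k => ‖g k‖ₑ) fun k => ?_).trans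
    (eNormH_add_le _ _ _)
  exact enorm_sub_le' _ _

lemma MemH.normH_le_add {r : ℝ} {f g : ℤ → ℂ} (hf : MemH r f) (hg : MemH r g) :
    normH r f ≤ normH r g + normH r (f - g) := by
  have h : eNormH r (fun k => ‖f k‖ₑ) ≤
      eNormH r (fun k => ‖g k‖ₑ) + eNormH r (fun k => ‖(f - g) k‖ₑ) := by
    refine (eNormH_mono_fun r (g := (fun k => ‖g k‖ₑ) + fun k => ‖(f - g) k‖ₑ) fun k => ?_).trans
      (eNormH_add_le _ _ _)
    have := enorm_add_le (g k) (f k - g k)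
    rwa [add_sub_cancel] at this
  rw [hf.eNormH_eq, hg.eNormH_eq, (hf.sub hg).eNormH_eq,
    ← ENNReal.ofReal_add (normH_nonneg _ _) (normH_nonneg _ _)] at h
  exact (ENNReal.ofReal_le_ofReal_iff (add_nonneg (normH_nonneg _ _) (normH_nonneg _ _))).1 h

/-! ### Multilinear forms -/

/-- The value of a coefficient at a terminal node. -/
def leafVal (a : Node) (z : ℂ) : ℂ := if sign a = 1 then z else starRingEnd ℂ z

lemma leafProduct_eq (c : List Node) (n : Node → ℤ) (f : ℤ → ℂ) :
    leafProduct c n f = ∏ a ∈ leaves c, leafVal a (f (n a)) := rfl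

lemma enorm_leafVal (a : Node) (z : ℂ) : ‖leafVal a z‖ₑ = ‖z‖ₑ := by
  unfold leafVal
  split_ifs
  · rfl
  · rw [← ofReal_norm, RCLike.norm_conj, ofReal_norm]

lemma leafVal_sub (a : Node) (z w : ℂ) : leafVal a z - leafVal a w = leafVal a (z - w) := by
  unfold leafVal
  split_ifs
  · rfl
  · rw [map_sub]

/-- The multiplier of a boundary term, with a general weight at the root. -/
def multiplier (K : ℝ) (μ : ℤ → ℝ) (c : List Node) (n : Node → ℤ) : ℝ :=
  open Classical in
  if HighlyNonresonant K c n then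
    μ (n root₁) * (((c.tail.map fun a => -sign a).prod : ℤ) : ℝ)
      / (∏ j ∈ Finset.Icc 1 c.length, (cumPhase n c j : ℝ))
  else 0

lemma boundaryTerm_eq (K s : ℝ) (c : List Node) (f : ℤ → ℂ) (n : Node → ℤ) :
    boundaryTerm K s c f n =
      (multiplier K (fun m => bracket m ^ (2 * s)) c n : ℂ) * leafProduct c n f := by
  unfold boundaryTerm multiplier
  split_ifs
  · rfl
  · simp

lemma abs_prod_neg_sign (l : List Node) :
    |(((l.map fun a => -sign a).prod : ℤ) : ℝ)| = 1 := by
  induction l with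
  | nil => simp
  | cons a l ih =>
    rw [List.map_cons, List.prod_cons]
    push_cast at ih ⊢
    rw [abs_mul, ih, mul_one]
    rcases sign_eq a with h | h <;> simp [h]

/-- Weights which are dominated by the one of the `H^s`-energy. -/
def IsWeight (s : ℝ) (μ : ℤ → ℝ) : Prop := ∀ m, |μ m| ≤ bracket m ^ (2 * s)

lemma enorm_ofReal_complex (x : ℝ) : ‖(x : ℂ)‖ₑ = ENNReal.ofReal |x| := by
  rw [← ofReal_norm, Complex.norm_real, Real.norm_eq_abs]

lemma enorm_multiplier_le {K s : ℝ} {μ : ℤ → ℝ} (hμ : IsWeight s μ) (c : List Node)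
    (n : Node → ℤ) : ‖(multiplier K μ c n : ℂ)‖ₑ ≤ absMultiplier K s c n := by
  rw [enorm_ofReal_complex]
  unfold multiplier absMultiplier
  split_ifs
  · refine ENNReal.ofReal_le_ofReal ?_
    rw [abs_div, abs_mul, abs_prod_neg_sign, mul_one, Finset.abs_prod, div_eq_mul_inv, phaseProd,
      ← Finset.prod_inv_distrib]
    simp_rw [Real.rpow_neg_one]
    gcongr
    exact hμ _
  · simp

lemma enorm_leafProduct_le {H : ℤ → ℝ≥0∞} {f : ℤ → ℂ} (hf : ∀ k, ‖f k‖ₑ ≤ H k) (c : List Node)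
    (n : Node → ℤ) : ‖leafProduct c n f‖ₑ ≤ ∏ a ∈ leaves c, H (n a) := by
  rw [leafProduct_eq]
  have : ‖∏ a ∈ leaves c, leafVal a (f (n a))‖ₑ = ∏ a ∈ leaves c, ‖leafVal a (f (n a))‖ₑ := by
    simp only [enorm, nnnorm_prod, ENNReal.ofNNReal_finsetProd]
  rw [this]
  exact Finset.prod_le_prod' fun a _ => by rw [enorm_leafVal]; exact hf _

lemma enorm_prod_sub_prod_le {ι : Type*} [DecidableEq ι] (S : Finset ι) {x y : ι → ℂ}
    {h : ι → ℝ≥0∞} {η : ℝ≥0∞} (hx : ∀ i, ‖x i‖ₑ ≤ h i) (hy : ∀ i, ‖y i‖ₑ ≤ h i)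
    (hxy : ∀ i, ‖x i - y i‖ₑ ≤ η * h i) :
    ‖∏ i ∈ S, x i - ∏ i ∈ S, y i‖ₑ ≤ S.card * η * ∏ i ∈ S, h i := by
  induction S using Finset.induction_on with
  | empty => simp
  | @insert a S ha ih =>
    rw [Finset.prod_insert ha, Finset.prod_insert ha, Finset.prod_insert ha,
      Finset.card_insert_of_notMem ha]
    have e : x a * ∏ i ∈ S, x i - y a * ∏ i ∈ S, y i =
        (x a - y a) * ∏ i ∈ S, x i + y a * (∏ i ∈ S, x i - ∏ i ∈ S, y i) := by ring
    have hX : ‖∏ i ∈ S, x i‖ₑ ≤ ∏ i ∈ S, h i := by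
      have : ‖∏ i ∈ S, x i‖ₑ = ∏ i ∈ S, ‖x i‖ₑ := by
        simp only [enorm, nnnorm_prod, ENNReal.ofNNReal_finsetProd]
      rw [this]
      exact Finset.prod_le_prod' fun i _ => hx i
    rw [e]
    refine (enorm_add_le _ _).trans ?_
    rw [enorm_mul, enorm_mul]
    calc _ ≤ (η * h a) * (∏ i ∈ S, h i) + h a * (S.card * η * ∏ i ∈ S, h i) := by
          gcongr
          · exact hxy a
          · exact hy a
      _ = _ := by
          push_cast
          ring

/-- `H` dominates `f`, `g` and, up to the factor `η`, their difference. -/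
structure Dominates (H : ℤ → ℝ≥0∞) (η : ℝ≥0∞) (f g : ℤ → ℂ) : Prop where
  left : ∀ k, ‖f k‖ₑ ≤ H k
  right : ∀ k, ‖g k‖ₑ ≤ H k
  sub : ∀ k, ‖f k - g k‖ₑ ≤ η * H k

lemma Dominates.leafProduct_sub {H : ℤ → ℝ≥0∞} {η : ℝ≥0∞} {f g : ℤ → ℂ}
    (h : Dominates H η f g) {c : List Node} (hc : IsTree c) (n : Node → ℤ) :
    ‖leafProduct c n f - leafProduct c n g‖ₑ ≤
      ((2 * c.length + 2 : ℕ) : ℝ≥0∞) * η * ∏ a ∈ leaves c, H (n a) := by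
  classical
  rw [leafProduct_eq, leafProduct_eq, ← card_leaves hc]
  refine enorm_prod_sub_prod_le _ (fun a => ?_) (fun a => ?_) (fun a => ?_)
  · rw [enorm_leafVal]; exact h.left _
  · rw [enorm_leafVal]; exact h.right _
  · rw [leafVal_sub, enorm_leafVal]; exact h.sub _

lemma summable_of_tsum_enorm_le {ι : Type*} {F : ι → ℂ} {B : ℝ≥0∞} (hB : B < ⊤)
    (h : ∑' i, ‖F i‖ₑ ≤ B) : Summable F := by
  have := tsum_enorm_ne_top_iff_summable_nnnorm.1 (h.trans_lt hB).ne
  exact Summable.of_nnnorm this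

lemma norm_tsum_le_of_tsum_enorm_le {ι : Type*} {F : ι → ℂ} {B : ℝ} (hB : 0 ≤ B)
    (h : ∑' i, ‖F i‖ₑ ≤ ENNReal.ofReal B) : ‖∑' i, F i‖ ≤ B := by
  have h1 := (enorm_tsum_le_tsum_enorm (f := F)).trans h
  rw [← ofReal_norm] at h1
  exact (ENNReal.ofReal_le_ofReal_iff hB).1 h1

/-- A boundary form. -/
def boundarySummand (K : ℝ) (μ : ℤ → ℝ) (c : List Node) (f : ℤ → ℂ) (n : Node → ℤ) : ℂ :=
  multiplier K μ c n * leafProduct c n f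

open Classical in
/-- A summand of a nearly resonant form. -/
def nearSummand (K : ℝ) (μ : ℤ → ℝ) (c : List Node) (b : Node) (f : ℤ → ℂ) (n : Node → ℤ) : ℂ :=
  (if HighlyNonresonant K (c ++ [b]) n then 0 else (multiplier K μ c n : ℂ)) *
    leafProduct (c ++ [b]) n f

open Classical in
/-- A summand of a resonant form. -/
def resonantSummand (K : ℝ) (N : ℕ∞) (μ : ℤ → ℝ) (c : List Node) (b : Node) (f : ℤ → ℂ)
    (n : Node → ℤ) : ℂ :=
  (if LowFreq N (n b) then (multiplier K μ c n : ℂ) else 0) *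
    (f (n b) * starRingEnd ℂ (f (n b)) * leafProduct c n f)

section

variable {K s σ : ℝ} {μ : ℤ → ℝ}

lemma enorm_boundarySummand_le (hμ : IsWeight s μ) {H : ℤ → ℝ≥0∞} {f : ℤ → ℂ}
    (hf : ∀ k, ‖f k‖ₑ ≤ H k) (c : List Node) (n : Node → ℤ) :
    ‖boundarySummand K μ c f n‖ₑ ≤ absMultiplier K s c n * ∏ a ∈ leaves c, H (n a) := by
  rw [boundarySummand, enorm_mul]
  exact mul_le_mul' (enorm_multiplier_le hμ c n) (enorm_leafProduct_le hf c n)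

lemma enorm_near_coeff_le (hμ : IsWeight s μ) (c : List Node) (b : Node) (n : Node → ℤ) :
    open Classical in
    ‖(if HighlyNonresonant K (c ++ [b]) n then 0 else (multiplier K μ c n : ℂ))‖ₑ ≤
      absNearMultiplier K s c b n := by
  unfold absNearMultiplier
  split_ifs
  · simp
  · exact enorm_multiplier_le hμ c n

lemma enorm_nearSummand_le (hμ : IsWeight s μ) {H : ℤ → ℝ≥0∞} {f : ℤ → ℂ}
    (hf : ∀ k, ‖f k‖ₑ ≤ H k) (c : List Node) (b : Node) (n : Node → ℤ) :
    ‖nearSummand K μ c b f n‖ₑ ≤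
      absNearMultiplier K s c b n * ∏ a ∈ leaves (c ++ [b]), H (n a) := by
  rw [nearSummand, enorm_mul]
  exact mul_le_mul' (enorm_near_coeff_le hμ c b n) (enorm_leafProduct_le hf _ n)

lemma enorm_nearSummand_sub_le (hμ : IsWeight s μ) {H : ℤ → ℝ≥0∞} {η : ℝ≥0∞} {f g : ℤ → ℂ}
    (h : Dominates H η f g) {c : List Node} (hc : IsTree c) {b : Node} (hb : b ∈ leaves c)
    (n : Node → ℤ) :
    ‖nearSummand K μ c b f n - nearSummand K μ c b g n‖ₑ ≤
      ((2 * c.length + 4 : ℕ) : ℝ≥0∞) * η *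
        (absNearMultiplier K s c b n * ∏ a ∈ leaves (c ++ [b]), H (n a)) := by
  rw [nearSummand, nearSummand, ← mul_sub, enorm_mul]
  refine (mul_le_mul' (enorm_near_coeff_le hμ c b n) (h.leafProduct_sub (hc.snoc hb) n)).trans
    (le_of_eq ?_)
  rw [List.length_append, List.length_singleton]
  push_cast
  ring

lemma enorm_resonant_coeff_le (hμ : IsWeight s μ) (N : ℕ∞) (c : List Node) (b : Node)
    (n : Node → ℤ) :
    open Classical in
    ‖(if LowFreq N (n b) then (multiplier K μ c n : ℂ) else 0)‖ₑ ≤ absMultiplier K s c n := by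
  split_ifs
  · exact enorm_multiplier_le hμ c n
  · simp

lemma enorm_conj (z : ℂ) : ‖starRingEnd ℂ z‖ₑ = ‖z‖ₑ := by
  rw [← ofReal_norm, RCLike.norm_conj, ofReal_norm]

lemma enorm_resonantSummand_le (hμ : IsWeight s μ) (N : ℕ∞) {H : ℤ → ℝ≥0∞} {f : ℤ → ℂ}
    (hf : ∀ k, ‖f k‖ₑ ≤ H k) (c : List Node) (b : Node) (n : Node → ℤ) :
    ‖resonantSummand K N μ c b f n‖ₑ ≤
      absMultiplier K s c n * H (n b) ^ 2 * ∏ a ∈ leaves c, H (n a) := by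
  rw [resonantSummand, enorm_mul, enorm_mul, enorm_mul, enorm_conj, ← sq, mul_assoc]
  exact mul_le_mul' (enorm_resonant_coeff_le hμ N c b n)
    (mul_le_mul' (pow_le_pow_left' (hf _) 2) (enorm_leafProduct_le hf c n))

lemma enorm_resonantSummand_sub_le (hμ : IsWeight s μ) (N : ℕ∞) {H : ℤ → ℝ≥0∞} {η : ℝ≥0∞}
    {f g : ℤ → ℂ} (h : Dominates H η f g) {c : List Node} (hc : IsTree c) (b : Node)
    (n : Node → ℤ) :
    ‖resonantSummand K N μ c b f n - resonantSummand K N μ c b g n‖ₑ ≤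
      ((2 * c.length + 4 : ℕ) : ℝ≥0∞) * η *
        (absMultiplier K s c n * H (n b) ^ 2 * ∏ a ∈ leaves c, H (n a)) := by
  rw [resonantSummand, resonantSummand, ← mul_sub, enorm_mul]
  set x := f (n b)
  set y := g (n b)
  have e : x * starRingEnd ℂ x * leafProduct c n f - y * starRingEnd ℂ y * leafProduct c n g =
      (x - y) * starRingEnd ℂ x * leafProduct c n f +
      y * starRingEnd ℂ (x - y) * leafProduct c n f +
      y * starRingEnd ℂ y * (leafProduct c n f - leafProduct c n g) := by
    rw [map_sub]
    ring
  have hx := h.left (n b)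
  have hy := h.right (n b)
  have hxy := h.sub (n b)
  have hP := enorm_leafProduct_le h.left c n
  have hD := h.leafProduct_sub hc n
  have key : ‖x * starRingEnd ℂ x * leafProduct c n f -
      y * starRingEnd ℂ y * leafProduct c n g‖ₑ ≤ ((2 * c.length + 4 : ℕ) : ℝ≥0∞) * η *
        (H (n b) ^ 2 * ∏ a ∈ leaves c, H (n a)) := by
    rw [e]
    refine (enorm_add_le _ _).trans ((add_le_add_left (enorm_add_le _ _) _).trans ?_)
    simp only [enorm_mul, enorm_conj]
    calc _ ≤ (η * H (n b)) * H (n b) * (∏ a ∈ leaves c, H (n a)) +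
          H (n b) * (η * H (n b)) * (∏ a ∈ leaves c, H (n a)) +
          H (n b) * H (n b) *
            (((2 * c.length + 2 : ℕ) : ℝ≥0∞) * η * ∏ a ∈ leaves c, H (n a)) := by
          gcongr
      _ = _ := by
          push_cast
          ring
  refine (mul_le_mul' (enorm_resonant_coeff_le hμ N c b n) key).trans (le_of_eq ?_)
  ring

/-- The bound for one form of the `(J + 1)`-st generation. -/
def treeBound (K s ρ : ℝ) (J : ℕ) : ℝ :=
  treeConst K decayExp (J + 1) * kernelConst (kernelExp s) ^ (J + 2) * ρ ^ (2 * J + 6)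

lemma Regime.treeBound_nonneg (hr : Regime s σ) (hK : 0 < K) {ρ : ℝ} (hρ : 0 ≤ ρ) (J : ℕ) :
    0 ≤ treeBound K s ρ J := by
  have h1 := treeConst_nonneg (θ := decayExp) hK (J + 1)
  have h2 := one_le_kernelConst hr.half_lt
  unfold treeBound
  positivity

variable {H : ℤ → ℝ≥0∞} {ρ : ℝ} {J : ℕ} {c : List Node}

lemma Regime.boundary_sum_le (hr : Regime s σ) (hK : 0 < K) (N : ℕ∞) (hρ : 1 ≤ ρ)
    (hH : eNormH σ H ≤ ENNReal.ofReal ρ) (hc : c ∈ orderedBiTrees (J + 1)) :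
    ∑' n : indexFunctions N c, absMultiplier K s c n * ∏ a ∈ leaves c, H (n.1 a) ≤
      ENNReal.ofReal (treeBound K s ρ J) := by
  refine (hr.tsum_absMultiplier_le hK N (isRootedTree_of_mem hc) H).trans ?_
  have h1 := treeConst_nonneg (θ := decayExp) hK (J + 1)
  have h2 := one_le_kernelConst hr.half_lt
  rw [length_of_mem hc]
  calc _ ≤ ENNReal.ofReal (treeConst K decayExp (J + 1) * kernelConst (kernelExp s) ^ (J + 1)) *
        ENNReal.ofReal ρ ^ (2 * (J + 1) + 2) := by gcongr
    _ ≤ _ := by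
        rw [← ENNReal.ofReal_pow (by linarith), ← ENNReal.ofReal_mul (by positivity), treeBound]
        refine ENNReal.ofReal_le_ofReal ?_
        exact mul_le_mul (mul_le_mul_of_nonneg_left (pow_le_pow_right₀ h2 (by omega)) h1)
          (pow_le_pow_right₀ hρ (by omega)) (by positivity) (by positivity)

lemma Regime.resonant_sum_le (hr : Regime s σ) (hK : 0 < K) (N : ℕ∞) (hρ : 1 ≤ ρ)
    (hH : eNormH σ H ≤ ENNReal.ofReal ρ) (hc : c ∈ orderedBiTrees (J + 1)) {b : Node}
    (hb : b ∈ leaves c) :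
    ∑' n : indexFunctions N c, absMultiplier K s c n * H (n.1 b) ^ 2 *
        ∏ a ∈ leaves c, H (n.1 a) ≤ ENNReal.ofReal (treeBound K s ρ J) := by
  refine (hr.tsum_resonant_le hK N (isRootedTree_of_mem hc) hb H).trans ?_
  have h1 := treeConst_nonneg (θ := decayExp) hK (J + 1)
  have h2 := one_le_kernelConst hr.half_lt
  rw [length_of_mem hc]
  calc _ ≤ ENNReal.ofReal (treeConst K decayExp (J + 1) * kernelConst (kernelExp s) ^ (J + 1)) *
        ENNReal.ofReal ρ ^ (2 * (J + 1) + 4) := by gcongr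
    _ ≤ _ := by
        rw [← ENNReal.ofReal_pow (by linarith), ← ENNReal.ofReal_mul (by positivity), treeBound]
        refine ENNReal.ofReal_le_ofReal ?_
        exact mul_le_mul (mul_le_mul_of_nonneg_left (pow_le_pow_right₀ h2 (by omega)) h1)
          (pow_le_pow_right₀ hρ (by omega)) (by positivity) (by positivity)

lemma Regime.near_sum_le (hr : Regime s σ) (hK : 0 < K) (N : ℕ∞) (hρ : 1 ≤ ρ)
    (hH : eNormH σ H ≤ ENNReal.ofReal ρ) (hc : c ∈ orderedBiTrees (J + 1)) {b : Node}
    (hb : b ∈ leaves c) :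
    ∑' n : indexFunctions N (c ++ [b]), absNearMultiplier K s c b n *
        ∏ a ∈ leaves (c ++ [b]), H (n.1 a) ≤
      ENNReal.ofReal (2 * (K + 2) * (2 * (J : ℝ) + 6) ^ 3 * treeBound K s ρ J) := by
  refine (hr.tsum_near_le hK N (isRootedTree_of_mem hc) hb H).trans ?_
  have h1 := treeConst_nonneg (θ := decayExp) hK (J + 1)
  have h2 := one_le_kernelConst hr.half_lt
  rw [length_of_mem hc]
  calc _ ≤ ENNReal.ofReal (2 * ((K + 2) * (2 * ((J + 1 : ℕ) : ℝ) + 4) ^ 3) *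
          treeConst K decayExp (J + 1) * kernelConst (kernelExp s) ^ (J + 1 + 1)) *
        ENNReal.ofReal ρ ^ (2 * (J + 1) + 4) := by gcongr
    _ = _ := by
        rw [← ENNReal.ofReal_pow (by linarith), ← ENNReal.ofReal_mul (by positivity), treeBound]
        congr 1
        push_cast
        ring

end

/-! ### The flux of the modified energy -/

/-- The nearly resonant form in which the terminal node `b` of `c` is expanded. -/
def nearForm (K : ℝ) (N : ℕ∞) (μ : ℤ → ℝ) (c : List Node) (b : Node) (f : ℤ → ℂ) : ℂ :=
  -Complex.I * (sign b : ℂ) * ∑' n : indexFunctions N (c ++ [b]), nearSummand K μ c b f n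

/-- The resonant form in which the cubic resonance is placed at the terminal node `b` of `c`. -/
def resonantForm (K : ℝ) (N : ℕ∞) (μ : ℤ → ℝ) (c : List Node) (b : Node) (f : ℤ → ℂ) : ℂ :=
  Complex.I * (sign b : ℂ) * ∑' n : indexFunctions N c, resonantSummand K N μ c b f n

/-- The contribution of the bi-trees of the `(J + 1)`-st generation to the flux. -/
def genFlux (K : ℝ) (N : ℕ∞) (μ : ℤ → ℝ) (J : ℕ) (f : ℤ → ℂ) : ℂ :=
  ∑ c ∈ orderedBiTrees (J + 1), ∑ b ∈ leaves c, (nearForm K N μ c b f + resonantForm K N μ c b f)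

/-- The flux of the modified energy. -/
def flux (K : ℝ) (N : ℕ∞) (μ : ℤ → ℝ) (f : ℤ → ℂ) : ℝ := ∑' J : ℕ, (genFlux K N μ J f).re

lemma norm_I_mul_sign (b : Node) : ‖Complex.I * (sign b : ℂ)‖ = 1 := by
  rcases sign_eq b with h | h <;> simp [h]

lemma norm_neg_I_mul_sign (b : Node) : ‖-Complex.I * (sign b : ℂ)‖ = 1 := by
  rcases sign_eq b with h | h <;> simp [h]

section

variable {K s σ : ℝ} {μ : ℤ → ℝ} {H : ℤ → ℝ≥0∞} {ρ : ℝ} {J : ℕ} {c : List Node}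

lemma Regime.summable_boundarySummand (hr : Regime s σ) (hK : 0 < K) (hμ : IsWeight s μ) (N : ℕ∞)
    (hρ : 1 ≤ ρ) (hH : eNormH σ H ≤ ENNReal.ofReal ρ) {f : ℤ → ℂ} (hf : ∀ k, ‖f k‖ₑ ≤ H k)
    (hc : c ∈ orderedBiTrees (J + 1)) :
    (Summable fun n : indexFunctions N c => boundarySummand K μ c f n) ∧
      ‖∑' n : indexFunctions N c, boundarySummand K μ c f n‖ ≤ treeBound K s ρ J := by
  have h := (ENNReal.tsum_le_tsum fun n : indexFunctions N c =>
    enorm_boundarySummand_le (K := K) hμ hf c n).trans (hr.boundary_sum_le hK N hρ hH hc)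
  exact ⟨summable_of_tsum_enorm_le ENNReal.ofReal_lt_top h,
    norm_tsum_le_of_tsum_enorm_le (hr.treeBound_nonneg hK (by linarith) J) h⟩

lemma Regime.summable_nearSummand (hr : Regime s σ) (hK : 0 < K) (hμ : IsWeight s μ) (N : ℕ∞)
    (hρ : 1 ≤ ρ) (hH : eNormH σ H ≤ ENNReal.ofReal ρ) {f : ℤ → ℂ} (hf : ∀ k, ‖f k‖ₑ ≤ H k)
    (hc : c ∈ orderedBiTrees (J + 1)) {b : Node} (hb : b ∈ leaves c) :
    (Summable fun n : indexFunctions N (c ++ [b]) => nearSummand K μ c b f n) ∧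
      ‖∑' n : indexFunctions N (c ++ [b]), nearSummand K μ c b f n‖ ≤
        2 * (K + 2) * (2 * (J : ℝ) + 6) ^ 3 * treeBound K s ρ J := by
  have h := (ENNReal.tsum_le_tsum fun n : indexFunctions N (c ++ [b]) =>
    enorm_nearSummand_le (K := K) hμ hf c b n).trans (hr.near_sum_le hK N hρ hH hc hb)
  have := hr.treeBound_nonneg hK (by linarith : 0 ≤ ρ) J
  exact ⟨summable_of_tsum_enorm_le ENNReal.ofReal_lt_top h,
    norm_tsum_le_of_tsum_enorm_le (by positivity) h⟩

lemma Regime.summable_resonantSummand (hr : Regime s σ) (hK : 0 < K) (hμ : IsWeight s μ) (N : ℕ∞)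
    (hρ : 1 ≤ ρ) (hH : eNormH σ H ≤ ENNReal.ofReal ρ) {f : ℤ → ℂ} (hf : ∀ k, ‖f k‖ₑ ≤ H k)
    (hc : c ∈ orderedBiTrees (J + 1)) {b : Node} (hb : b ∈ leaves c) :
    (Summable fun n : indexFunctions N c => resonantSummand K N μ c b f n) ∧
      ‖∑' n : indexFunctions N c, resonantSummand K N μ c b f n‖ ≤ treeBound K s ρ J := by
  have h := (ENNReal.tsum_le_tsum fun n : indexFunctions N c =>
    enorm_resonantSummand_le (K := K) hμ N hf c b n).trans (hr.resonant_sum_le hK N hρ hH hc hb)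
  exact ⟨summable_of_tsum_enorm_le ENNReal.ofReal_lt_top h,
    norm_tsum_le_of_tsum_enorm_le (hr.treeBound_nonneg hK (by linarith) J) h⟩

lemma tsum_sub_le_of_enorm_le {ι : Type*} {F G : ι → ℂ} {w : ι → ℝ≥0∞} {m : ℕ} {η B : ℝ}
    (hη : 0 ≤ η) (hB : 0 ≤ B) (hF : Summable F) (hG : Summable G)
    (h : ∀ i, ‖F i - G i‖ₑ ≤ (m : ℝ≥0∞) * ENNReal.ofReal η * w i)
    (hw : ∑' i, w i ≤ ENNReal.ofReal B) : ‖∑' i, F i - ∑' i, G i‖ ≤ m * η * B := by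
  rw [← hF.tsum_sub hG]
  refine norm_tsum_le_of_tsum_enorm_le (by positivity) ?_
  refine (ENNReal.tsum_le_tsum h).trans ?_
  rw [ENNReal.tsum_mul_left, ENNReal.ofReal_mul (by positivity), ENNReal.ofReal_mul (by positivity),
    ENNReal.ofReal_natCast]
  gcongr

lemma Regime.nearForm_sub_le (hr : Regime s σ) (hK : 0 < K) (hμ : IsWeight s μ) (N : ℕ∞)
    (hρ : 1 ≤ ρ) (hH : eNormH σ H ≤ ENNReal.ofReal ρ) {η : ℝ} (hη : 0 ≤ η) {f g : ℤ → ℂ}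
    (h : Dominates H (ENNReal.ofReal η) f g)
    (hc : c ∈ orderedBiTrees (J + 1)) {b : Node} (hb : b ∈ leaves c) :
    ‖nearForm K N μ c b f - nearForm K N μ c b g‖ ≤
      (2 * (J : ℝ) + 6) * η * (2 * (K + 2) * (2 * (J : ℝ) + 6) ^ 3 * treeBound K s ρ J) := by
  have hT := hr.treeBound_nonneg hK (by linarith : 0 ≤ ρ) J
  rw [nearForm, nearForm, ← mul_sub, norm_mul, norm_neg_I_mul_sign, one_mul]
  refine (tsum_sub_le_of_enorm_le (m := 2 * c.length + 4) hη (by positivity)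
    (hr.summable_nearSummand hK hμ N hρ hH h.left hc hb).1
    (hr.summable_nearSummand hK hμ N hρ hH h.right hc hb).1
    (fun n => enorm_nearSummand_sub_le hμ h (isRootedTree_of_mem hc).isTree hb n)
    (hr.near_sum_le hK N hρ hH hc hb)).trans (le_of_eq ?_)
  rw [length_of_mem hc]
  push_cast
  ring

lemma Regime.resonantForm_sub_le (hr : Regime s σ) (hK : 0 < K) (hμ : IsWeight s μ) (N : ℕ∞)
    (hρ : 1 ≤ ρ) (hH : eNormH σ H ≤ ENNReal.ofReal ρ) {η : ℝ} (hη : 0 ≤ η) {f g : ℤ → ℂ}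
    (h : Dominates H (ENNReal.ofReal η) f g)
    (hc : c ∈ orderedBiTrees (J + 1)) {b : Node} (hb : b ∈ leaves c) :
    ‖resonantForm K N μ c b f - resonantForm K N μ c b g‖ ≤
      (2 * (J : ℝ) + 6) * η * treeBound K s ρ J := by
  have hT := hr.treeBound_nonneg hK (by linarith : 0 ≤ ρ) J
  rw [resonantForm, resonantForm, ← mul_sub, norm_mul, norm_I_mul_sign, one_mul]
  refine (tsum_sub_le_of_enorm_le (m := 2 * c.length + 4) hη hT
    (hr.summable_resonantSummand hK hμ N hρ hH h.left hc hb).1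
    (hr.summable_resonantSummand hK hμ N hρ hH h.right hc hb).1
    (fun n => enorm_resonantSummand_sub_le hμ N h (isRootedTree_of_mem hc).isTree b n)
    (hr.resonant_sum_le hK N hρ hH hc hb)).trans (le_of_eq ?_)
  rw [length_of_mem hc]
  push_cast
  ring

lemma Regime.sum_sum_treeBound_le (hr : Regime s σ) (hK : 0 < K) (hρ : 1 ≤ ρ) (J : ℕ) :
    ∑ c ∈ orderedBiTrees (J + 1), ∑ _b ∈ leaves c, (2 * (J : ℝ) + 6) *
      (2 * (K + 2) * (2 * (J : ℝ) + 6) ^ 3 * treeBound K s ρ J + treeBound K s ρ J) ≤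
    genBound K s ρ J := by
  have hT := hr.treeBound_nonneg hK (by linarith : 0 ≤ ρ) J
  have h1 : ∀ c ∈ orderedBiTrees (J + 1), ∑ _b ∈ leaves c, (2 * (J : ℝ) + 6) *
      (2 * (K + 2) * (2 * (J : ℝ) + 6) ^ 3 * treeBound K s ρ J + treeBound K s ρ J) ≤
      2 * (K + 2) * (2 * (J : ℝ) + 6) ^ 5 * treeBound K s ρ J := by
    intro c hc
    rw [Finset.sum_const, card_leaves (isRootedTree_of_mem hc).isTree, length_of_mem hc,
      nsmul_eq_mul]
    set X : ℝ := 2 * (J : ℝ) + 6 with hX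
    have hX6 : 6 ≤ X := by
      have : (0 : ℝ) ≤ J := Nat.cast_nonneg J
      linarith
    have e : ((2 * (J + 1) + 2 : ℕ) : ℝ) = X - 2 := by
      rw [hX]
      push_cast
      ring
    rw [e]
    have h2 : (X - 2) * (X * (2 * (K + 2) * X ^ 3 + 1)) ≤ 2 * (K + 2) * X ^ 5 := by
      have h3 : X ≤ X ^ 3 := by
        nlinarith [mul_nonneg (by linarith : 0 ≤ X) (by nlinarith : 0 ≤ X ^ 2 - 1)]
      have h4 : 0 ≤ X * (2 * (2 * (K + 2) * X ^ 3) - X + 2) := by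
        have : 0 ≤ K * X ^ 3 := by positivity
        refine mul_nonneg (by linarith) ?_
        nlinarith
      nlinarith
    calc _ = (X - 2) * (X * (2 * (K + 2) * X ^ 3 + 1)) * treeBound K s ρ J := by ring
      _ ≤ _ := by gcongr
  refine (Finset.sum_le_sum h1).trans (le_of_eq ?_)
  rw [Finset.sum_const, nsmul_eq_mul, genBound, treeBound]
  ring

lemma Regime.norm_genFlux_le (hr : Regime s σ) (hK : 0 < K) (hμ : IsWeight s μ) (N : ℕ∞)
    (hρ : 1 ≤ ρ) (hH : eNormH σ H ≤ ENNReal.ofReal ρ) {f : ℤ → ℂ} (hf : ∀ k, ‖f k‖ₑ ≤ H k)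
    (J : ℕ) : ‖genFlux K N μ J f‖ ≤ genBound K s ρ J := by
  have hT := hr.treeBound_nonneg hK (by linarith : 0 ≤ ρ) J
  refine le_trans ?_ (hr.sum_sum_treeBound_le hK hρ J)
  refine (norm_sum_le _ _).trans (Finset.sum_le_sum fun c hc => ?_)
  refine (norm_sum_le _ _).trans (Finset.sum_le_sum fun b hb => ?_)
  refine (norm_add_le _ _).trans ?_
  rw [nearForm, resonantForm, norm_mul, norm_mul (Complex.I * _), norm_neg_I_mul_sign,
    norm_I_mul_sign, one_mul, one_mul]
  refine (add_le_add (hr.summable_nearSummand hK hμ N hρ hH hf hc hb).2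
    (hr.summable_resonantSummand hK hμ N hρ hH hf hc hb).2).trans ?_
  refine le_mul_of_one_le_left (by positivity) ?_
  have : (0 : ℝ) ≤ J := Nat.cast_nonneg J
  linarith

lemma Regime.norm_genFlux_sub_le (hr : Regime s σ) (hK : 0 < K) (hμ : IsWeight s μ) (N : ℕ∞)
    (hρ : 1 ≤ ρ) (hH : eNormH σ H ≤ ENNReal.ofReal ρ) {η : ℝ} (hη : 0 ≤ η) {f g : ℤ → ℂ}
    (h : Dominates H (ENNReal.ofReal η) f g) (J : ℕ) :
    ‖genFlux K N μ J f - genFlux K N μ J g‖ ≤ η * genBound K s ρ J := by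
  refine le_trans ?_ (mul_le_mul_of_nonneg_left (hr.sum_sum_treeBound_le hK hρ J) hη)
  rw [genFlux, genFlux, ← Finset.sum_sub_distrib, Finset.mul_sum]
  refine (norm_sum_le _ _).trans (Finset.sum_le_sum fun c hc => ?_)
  rw [← Finset.sum_sub_distrib, Finset.mul_sum]
  refine (norm_sum_le _ _).trans (Finset.sum_le_sum fun b hb => ?_)
  rw [add_sub_add_comm]
  refine (norm_add_le _ _).trans ?_
  refine (add_le_add (hr.nearForm_sub_le hK hμ N hρ hH hη h hc hb)
    (hr.resonantForm_sub_le hK hμ N hρ hH hη h hc hb)).trans (le_of_eq ?_)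
  ring

lemma Regime.summable_re_genFlux (hr : Regime s σ) (hK : 0 < K) (hμ : IsWeight s μ) (N : ℕ∞)
    (hρ : 1 ≤ ρ) (hH : eNormH σ H ≤ ENNReal.ofReal ρ) {f : ℤ → ℂ} (hf : ∀ k, ‖f k‖ₑ ≤ H k) :
    Summable fun J => (genFlux K N μ J f).re :=
  Summable.of_norm_bounded (summable_genBound hK hr.lower (by linarith)) fun J =>
    (Complex.abs_re_le_norm _).trans (hr.norm_genFlux_le hK hμ N hρ hH hf J)

/-- A bound for the flux on a ball. -/
def fluxBound (K s ρ : ℝ) : ℝ := ∑' J, genBound K s ρ J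

lemma Regime.abs_flux_le (hr : Regime s σ) (hK : 0 < K) (hμ : IsWeight s μ) (N : ℕ∞)
    (hρ : 1 ≤ ρ) (hH : eNormH σ H ≤ ENNReal.ofReal ρ) {f : ℤ → ℂ} (hf : ∀ k, ‖f k‖ₑ ≤ H k) :
    |flux K N μ f| ≤ fluxBound K s ρ := by
  rw [← Real.norm_eq_abs]
  exact tsum_of_norm_bounded (summable_genBound hK hr.lower (by linarith)).hasSum fun J =>
    (Complex.abs_re_le_norm _).trans (hr.norm_genFlux_le hK hμ N hρ hH hf J)

lemma Regime.abs_flux_sub_le (hr : Regime s σ) (hK : 0 < K) (hμ : IsWeight s μ) (N : ℕ∞)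
    (hρ : 1 ≤ ρ) (hH : eNormH σ H ≤ ENNReal.ofReal ρ) {η : ℝ} (hη : 0 ≤ η) {f g : ℤ → ℂ}
    (h : Dominates H (ENNReal.ofReal η) f g) :
    |flux K N μ f - flux K N μ g| ≤ η * fluxBound K s ρ := by
  rw [flux, flux, ← (hr.summable_re_genFlux hK hμ N hρ hH h.left).tsum_sub
    (hr.summable_re_genFlux hK hμ N hρ hH h.right), ← Real.norm_eq_abs]
  refine tsum_of_norm_bounded
    ((summable_genBound hK hr.lower (by linarith)).hasSum.mul_left η) fun J => ?_
  rw [← Complex.sub_re]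
  exact (Complex.abs_re_le_norm _).trans (hr.norm_genFlux_sub_le hK hμ N hρ hH hη h J)

lemma exists_dominates {f g : ℤ → ℂ} (hf : MemH σ f) (hg : MemH σ g) {η : ℝ} (hη : 0 < η)
    (hfg : normH σ (f - g) ≤ η) :
    ∃ H : ℤ → ℝ≥0∞, eNormH σ H ≤ ENNReal.ofReal (normH σ f + normH σ g + 1) ∧
      Dominates H (ENNReal.ofReal η) f g := by
  refine ⟨((fun k => ‖f k‖ₑ) + fun k => ‖g k‖ₑ) +
    fun k => ENNReal.ofReal η⁻¹ * ‖(f - g) k‖ₑ, ?_, ?_, ?_, ?_⟩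
  · refine (eNormH_add_le _ _ _).trans ((add_le_add_left (eNormH_add_le _ _ _) _).trans ?_)
    rw [eNormH_const_mul, hf.eNormH_eq, hg.eNormH_eq, (hf.sub hg).eNormH_eq,
      ← ENNReal.ofReal_mul (by positivity), ← ENNReal.ofReal_add (normH_nonneg _ _)
      (normH_nonneg _ _), ← ENNReal.ofReal_add (add_nonneg (normH_nonneg _ _)
      (normH_nonneg _ _)) (mul_nonneg (by positivity) (normH_nonneg _ _))]
    refine ENNReal.ofReal_le_ofReal ?_
    gcongr
    rw [← div_eq_inv_mul, div_le_one hη]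
    exact hfg
  · intro k
    simp only [Pi.add_apply]
    exact (le_self_add).trans le_self_add
  · intro k
    simp only [Pi.add_apply]
    exact (le_add_self).trans le_self_add
  · intro k
    simp only [Pi.add_apply, mul_add]
    refine le_trans (le_of_eq ?_) le_add_self
    rw [← mul_assoc, ← ENNReal.ofReal_mul hη.le, mul_inv_cancel₀ hη.ne', ENNReal.ofReal_one,
      one_mul, Pi.sub_apply]

/-- The flux is Lipschitz continuous on bounded sets. -/
lemma Regime.abs_flux_sub_le_of_normH (hr : Regime s σ) (hK : 0 < K) (hμ : IsWeight s μ) (N : ℕ∞)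
    {f g : ℤ → ℂ} (hf : MemH σ f) (hg : MemH σ g) {η : ℝ} (hη : 0 < η)
    (hfg : normH σ (f - g) ≤ η) (hρ : normH σ f + normH σ g + 1 ≤ ρ) :
    |flux K N μ f - flux K N μ g| ≤ η * fluxBound K s ρ := by
  obtain ⟨H, h1, h2⟩ := exists_dominates hf hg hη hfg
  have e1 := normH_nonneg σ f
  have e2 := normH_nonneg σ g
  exact hr.abs_flux_sub_le hK hμ N (by linarith) (h1.trans (ENNReal.ofReal_le_ofReal hρ)) hη.le h2

lemma Regime.abs_flux_le_of_normH (hr : Regime s σ) (hK : 0 < K) (hμ : IsWeight s μ) (N : ℕ∞)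
    {f : ℤ → ℂ} (hf : MemH σ f) (hρ : 1 ≤ ρ) (hfρ : normH σ f ≤ ρ) :
    |flux K N μ f| ≤ fluxBound K s ρ :=
  hr.abs_flux_le hK hμ N hρ (hf.eNormH_eq.le.trans (ENNReal.ofReal_le_ofReal hfρ)) fun _ => le_rfl

/-! ### Convergence of the correction terms -/

lemma isWeight_bracket (s : ℝ) : IsWeight s fun m => bracket m ^ (2 * s) := fun m => by
  rw [abs_of_nonneg (Real.rpow_nonneg (bracket_pos _).le _)]

/-- The boundary form of the `(J + 1)`-st generation, before taking the real part. -/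
def boundarySum (K : ℝ) (N : ℕ∞) (μ : ℤ → ℝ) (J : ℕ) (f : ℤ → ℂ) : ℂ :=
  ∑ c ∈ orderedBiTrees (J + 1), ∑' n : indexFunctions N c, boundarySummand K μ c f n

lemma boundaryForm_eq (K : ℝ) (N : ℕ∞) (s : ℝ) (J : ℕ) (f : ℤ → ℂ) :
    boundaryForm K N s (J + 1) f =
      (boundarySum K N (fun m => bracket m ^ (2 * s)) J f).re := by
  rw [boundaryForm, boundarySum]
  simp only [boundaryTerm_eq, boundarySummand]

lemma Regime.norm_boundarySum_le (hr : Regime s σ) (hK : 0 < K) (hμ : IsWeight s μ) (N : ℕ∞)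
    (hρ : 1 ≤ ρ) (hH : eNormH σ H ≤ ENNReal.ofReal ρ) {f : ℤ → ℂ} (hf : ∀ k, ‖f k‖ₑ ≤ H k)
    (J : ℕ) : ‖boundarySum K N μ J f‖ ≤ genBound K s ρ J := by
  have hT := hr.treeBound_nonneg hK (by linarith : 0 ≤ ρ) J
  refine le_trans ?_ (hr.sum_sum_treeBound_le hK hρ J)
  refine (norm_sum_le _ _).trans (Finset.sum_le_sum fun c hc => ?_)
  refine (hr.summable_boundarySummand hK hμ N hρ hH hf hc).2.trans ?_
  obtain ⟨b, hb⟩ := exists_mem_leaves (isRootedTree_of_mem hc).isTree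
  have hJ : (0 : ℝ) ≤ J := Nat.cast_nonneg J
  have h1 : treeBound K s ρ J ≤ (2 * (J : ℝ) + 6) *
      (2 * (K + 2) * (2 * (J : ℝ) + 6) ^ 3 * treeBound K s ρ J + treeBound K s ρ J) := by
    have : 0 ≤ 2 * (K + 2) * (2 * (J : ℝ) + 6) ^ 3 * treeBound K s ρ J := by positivity
    nlinarith
  exact h1.trans (Finset.single_le_sum
    (f := fun _ : Node => (2 * (J : ℝ) + 6) *
      (2 * (K + 2) * (2 * (J : ℝ) + 6) ^ 3 * treeBound K s ρ J + treeBound K s ρ J))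
    (fun _ _ => by positivity) hb)

theorem Regime.correctionsConverge (hr : Regime s σ) (hK : 0 < K) (N : ℕ∞) {f : ℤ → ℂ}
    (hf : MemH σ f) : CorrectionsConverge K N s f := by
  have hρ : 1 ≤ normH σ f + 1 := by linarith [normH_nonneg σ f]
  have hH : eNormH σ (fun k => ‖f k‖ₑ) ≤ ENNReal.ofReal (normH σ f + 1) :=
    hf.eNormH_eq.le.trans (ENNReal.ofReal_le_ofReal (by linarith))
  constructor
  · intro J c hc
    match J with
    | 0 => simp [orderedBiTrees] at hc
    | J + 1 =>
      simp only [boundaryTerm_eq]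
      exact (hr.summable_boundarySummand hK (isWeight_bracket s) N hρ hH (fun _ => le_rfl) hc).1
  · refine Summable.of_norm_bounded
      (summable_genBound hK hr.lower (by linarith : 0 ≤ normH σ f + 1))
      fun J => ?_
    rw [boundaryForm_eq]
    exact (Complex.abs_re_le_norm _).trans
      (hr.norm_boundarySum_le hK (isWeight_bracket s) N hρ hH (fun _ => le_rfl) J)

end

/-! ### The cubic nonlinearity -/

/-- The trilinear convolution of a nonnegative sequence with itself. -/
def cubic (H : ℤ → ℝ≥0∞) (k : ℤ) : ℝ≥0∞ :=
  ∑' z : ℤ × ℤ, H z.1 * H z.2 * H (k - z.1 + z.2)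

/-- The square of the weight `⟨k⟩^r` as an extended nonnegative number. -/
def sqWeight (r : ℝ) (k : ℤ) : ℝ≥0∞ := ENNReal.ofReal (bracket k ^ (2 * r))

lemma tsum_sqWeight_lt_top {r : ℝ} (hr : r < -(1 / 2)) : ∑' k, sqWeight r k < ⊤ := by
  have hs : Summable fun k : ℤ => bracket k ^ (2 * r) := by
    have h1 : Summable fun k : ℤ => |(k : ℝ)| ^ (-(-(2 * r))) :=
      Real.summable_abs_int_rpow (by linarith)
    rw [← Finset.summable_compl_iff {(0 : ℤ)}] at h1 ⊢
    refine Summable.of_nonneg_of_le (fun k => Real.rpow_nonneg (bracket_pos _).le _)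
      (fun k => ?_) h1
    rw [neg_neg]
    have hk : (k : ℤ) ≠ 0 := by
      have := k.2
      simpa using this
    refine Real.rpow_le_rpow_of_nonpos (by positivity) ?_ (by linarith)
    unfold bracket
    refine Real.le_sqrt_of_sq_le ?_
    rw [sq_abs]
    linarith
  unfold sqWeight
  rw [← ENNReal.ofReal_tsum_of_nonneg (fun k => Real.rpow_nonneg (bracket_pos _).le _) hs]
  exact ENNReal.ofReal_lt_top

lemma tsum_sqWeight_mul_le {a b : ℝ} (ha : a ≤ 0) (hb : b ≤ 0) (m : ℤ) :
    ∑' k, sqWeight a (k + m) * sqWeight b k ≤ 2 * ∑' k, sqWeight (a + b) k := by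
  have h1 : ∀ k, sqWeight a (k + m) * sqWeight b k ≤
      sqWeight (a + b) (k + m) + sqWeight (a + b) k := by
    intro k
    unfold sqWeight
    rw [← ENNReal.ofReal_mul (Real.rpow_nonneg (bracket_pos _).le _), ← ENNReal.ofReal_add
      (Real.rpow_nonneg (bracket_pos _).le _) (Real.rpow_nonneg (bracket_pos _).le _)]
    refine ENNReal.ofReal_le_ofReal ?_
    rw [mul_add, Real.rpow_add (bracket_pos _), Real.rpow_add (bracket_pos _)]
    have n1 : 0 ≤ bracket (k + m) ^ (2 * a) := Real.rpow_nonneg (bracket_pos _).le _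
    have n2 : 0 ≤ bracket (k + m) ^ (2 * b) := Real.rpow_nonneg (bracket_pos _).le _
    have n3 : 0 ≤ bracket k ^ (2 * a) := Real.rpow_nonneg (bracket_pos _).le _
    have n4 : 0 ≤ bracket k ^ (2 * b) := Real.rpow_nonneg (bracket_pos _).le _
    rcases le_total (bracket (k + m)) (bracket k) with h | h
    · have : bracket k ^ (2 * b) ≤ bracket (k + m) ^ (2 * b) :=
        Real.rpow_le_rpow_of_nonpos (bracket_pos _) h (by linarith)
      nlinarith [mul_nonneg n3 n4]
    · have : bracket (k + m) ^ (2 * a) ≤ bracket k ^ (2 * a) :=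
        Real.rpow_le_rpow_of_nonpos (bracket_pos _) h (by linarith)
      nlinarith [mul_nonneg n1 n2]
  refine (ENNReal.tsum_le_tsum h1).trans ?_
  rw [ENNReal.tsum_add, two_mul]
  exact add_le_add ((Equiv.addRight m).tsum_eq (sqWeight (a + b))).le le_rfl

/-- The constant in the bound for the cubic nonlinearity. -/
def cubicConst (s σ : ℝ) : ℝ≥0∞ :=
  ((2 * ∑' k, sqWeight (-s + σ) k) * (2 * ∑' k, sqWeight (-s + -s) k)) ^ (1 / 2 : ℝ)

lemma Regime.cubicConst_lt_top {s σ : ℝ} (hr : Regime s σ) : cubicConst s σ < ⊤ := by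
  have h1 := hr.lower
  have h2 := hr.sigma_lt
  refine ENNReal.rpow_lt_top_of_nonneg (by norm_num) (ENNReal.mul_ne_top ?_ ?_)
  · exact ENNReal.mul_ne_top (by norm_num) (tsum_sqWeight_lt_top (by linarith)).ne
  · exact ENNReal.mul_ne_top (by norm_num) (tsum_sqWeight_lt_top (by linarith)).ne

lemma ofReal_rpow_sq (r : ℝ) (k : ℤ) : ENNReal.ofReal (bracket k ^ r) ^ 2 = sqWeight r k := by
  rw [sqWeight, ← ENNReal.ofReal_pow (Real.rpow_nonneg (bracket_pos _).le _), ← Real.rpow_natCast,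
    ← Real.rpow_mul (bracket_pos _).le]
  congr 2
  push_cast
  ring

lemma Regime.eNormH_cubic_le {s σ : ℝ} (hr : Regime s σ) (H : ℤ → ℝ≥0∞) :
    eNormH σ (cubic H) ≤ cubicConst s σ * eNormH s H ^ 3 := by
  have h1 := hr.lower
  have h2 := hr.sigma_lt
  have h3 := hr.upper
  set h : ℤ → ℝ≥0∞ := fun k => ENNReal.ofReal (bracket k ^ s) * H k with hh
  have hH : ∀ k, H k = ENNReal.ofReal (bracket k ^ (-s)) * h k := by
    intro k
    rw [hh, ← mul_assoc, ← ENNReal.ofReal_mul (Real.rpow_nonneg (bracket_pos _).le _),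
      ← Real.rpow_add (bracket_pos _), neg_add_cancel, Real.rpow_zero, ENNReal.ofReal_one, one_mul]
  set S := ∑' k, h k ^ 2 with hS
  set C₁ := 2 * ∑' k, sqWeight (-s + -s) k with hC₁
  set C₂ := 2 * ∑' k, sqWeight (-s + σ) k with hC₂
  have hB : ∀ k : ℤ, ∑' z : ℤ × ℤ, h (k - z.1 + z.2) ^ 2 * (sqWeight (-s) z.1 * sqWeight (-s) z.2) ≤
      C₁ * S := by
    intro k
    rw [ENNReal.tsum_prod (f := fun x y => h (k - x + y) ^ 2 * (sqWeight (-s) x * sqWeight (-s) y))]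
    have e : ∀ x : ℤ, ∑' y : ℤ, h (k - x + y) ^ 2 * (sqWeight (-s) x * sqWeight (-s) y) =
        ∑' y : ℤ, h y ^ 2 * (sqWeight (-s) (x + (y - k)) * sqWeight (-s) x) := by
      intro x
      rw [← (Equiv.addLeft (k - x)).tsum_eq
        fun y => h y ^ 2 * (sqWeight (-s) (x + (y - k)) * sqWeight (-s) x)]
      refine tsum_congr fun y => ?_
      rw [Equiv.coe_addLeft, show x + (k - x + y - k) = y by ring, mul_comm (sqWeight (-s) x)]
    simp_rw [e]
    rw [ENNReal.tsum_comm]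
    calc _ ≤ ∑' y : ℤ, h y ^ 2 * C₁ := by
          refine ENNReal.tsum_le_tsum fun y => ?_
          rw [ENNReal.tsum_mul_left]
          gcongr
          exact tsum_sqWeight_mul_le (by linarith) (by linarith) _
      _ = _ := by rw [ENNReal.tsum_mul_right, mul_comm]
  have hA : ∑' k : ℤ, ∑' z : ℤ × ℤ, (h z.1 ^ 2 * h z.2 ^ 2) *
      (sqWeight (-s) (k - z.1 + z.2) * sqWeight σ k) ≤ C₂ * S ^ 2 := by
    rw [ENNReal.tsum_comm]
    calc _ ≤ ∑' z : ℤ × ℤ, (h z.1 ^ 2 * h z.2 ^ 2) * C₂ := by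
          refine ENNReal.tsum_le_tsum fun z => ?_
          rw [ENNReal.tsum_mul_left]
          gcongr
          have := tsum_sqWeight_mul_le (a := -s) (b := σ) (by linarith) (by linarith) (z.2 - z.1)
          refine le_trans (le_of_eq (tsum_congr fun k => ?_)) this
          rw [show k - z.1 + z.2 = k + (z.2 - z.1) by ring]
      _ = _ := by
          rw [ENNReal.tsum_mul_right, ENNReal.tsum_prod (f := fun x y => h x ^ 2 * h y ^ 2)]
          simp_rw [ENNReal.tsum_mul_left]
          rw [ENNReal.tsum_mul_right, mul_comm, sq]
  refine le_of_sq_le_sq_ennreal ?_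
  have hL : eNormH s H ^ 2 = S := by rw [eNormH, l2norm_sq]
  have hc : cubicConst s σ ^ 2 = C₂ * C₁ := by
    rw [cubicConst, ← ENNReal.rpow_natCast, ← ENNReal.rpow_mul, hC₁, hC₂]
    norm_num
  rw [mul_pow, hc, ← pow_mul, pow_mul', hL, eNormH, l2norm_sq]
  calc ∑' k, (ENNReal.ofReal (bracket k ^ σ) * cubic H k) ^ 2
      ≤ ∑' k, (∑' z : ℤ × ℤ, (h z.1 ^ 2 * h z.2 ^ 2) *
          (sqWeight (-s) (k - z.1 + z.2) * sqWeight σ k)) * (C₁ * S) := by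
        refine ENNReal.tsum_le_tsum fun k => ?_
        rw [cubic, ← ENNReal.tsum_mul_left]
        have e : ∀ z : ℤ × ℤ, ENNReal.ofReal (bracket k ^ σ) *
            (H z.1 * H z.2 * H (k - z.1 + z.2)) =
            (h z.1 * h z.2 * (ENNReal.ofReal (bracket (k - z.1 + z.2) ^ (-s)) *
              ENNReal.ofReal (bracket k ^ σ))) *
            (h (k - z.1 + z.2) * (ENNReal.ofReal (bracket z.1 ^ (-s)) *
              ENNReal.ofReal (bracket z.2 ^ (-s)))) := by
          intro z
          rw [hH z.1, hH z.2, hH (k - z.1 + z.2)]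
          ring
        simp_rw [e]
        refine (sq_tsum_mul_le _ _).trans ?_
        simp only [mul_pow, ofReal_rpow_sq]
        gcongr
        exact hB k
    _ = _ * (C₁ * S) := by rw [ENNReal.tsum_mul_right]
    _ ≤ (C₂ * S ^ 2) * (C₁ * S) := by gcongr
    _ = _ := by ring

lemma lt_top_of_eNormH_lt_top {σ : ℝ} {H : ℤ → ℝ≥0∞} (h : eNormH σ H < ⊤) (k : ℤ) : H k < ⊤ := by
  have h1 : ENNReal.ofReal (bracket k ^ σ) * H k < ⊤ :=
    (le_l2norm (fun k => ENNReal.ofReal (bracket k ^ σ) * H k) k).trans_lt h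
  have h2 : ENNReal.ofReal (bracket k ^ σ) ≠ 0 := by
    rw [Ne, ENNReal.ofReal_eq_zero, not_le]
    exact Real.rpow_pos_of_pos (bracket_pos _) _
  exact lt_top_iff_ne_top.2 (ENNReal.lt_top_of_mul_ne_top_right h1.ne h2).ne

/-- One summand of the cubic nonlinearity. -/
def cubicTerm (f : ℤ → ℂ) (k : ℤ) (z : ℤ × ℤ) : ℂ :=
  f z.1 * starRingEnd ℂ (f z.2) * f (k - z.1 + z.2)

lemma enorm_cubicTerm (f : ℤ → ℂ) (k : ℤ) (z : ℤ × ℤ) :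
    ‖cubicTerm f k z‖ₑ = ‖f z.1‖ₑ * ‖f z.2‖ₑ * ‖f (k - z.1 + z.2)‖ₑ := by
  rw [cubicTerm, enorm_mul, enorm_mul, enorm_conj]

lemma Regime.summable_cubicTerm {s σ : ℝ} (hr : Regime s σ) {f : ℤ → ℂ} (hf : MemH s f) (k : ℤ) :
    Summable (cubicTerm f k) := by
  have h1 : eNormH σ (cubic fun k => ‖f k‖ₑ) < ⊤ :=
    (hr.eNormH_cubic_le _).trans_lt (ENNReal.mul_lt_top hr.cubicConst_lt_top
      (ENNReal.pow_lt_top hf.eNormH_lt_top))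
  refine summable_of_tsum_enorm_le (lt_top_of_eNormH_lt_top h1 k) (le_of_eq ?_)
  exact tsum_congr fun z => enorm_cubicTerm f k z

open Classical in
/-- The nonresonant part of the cubic nonlinearity. -/
def nonresonantPart (f : ℤ → ℂ) (k : ℤ) : ℂ :=
  ∑' z : ℤ × ℤ, if z.1 ≠ k ∧ z.1 ≠ z.2 then cubicTerm f k z else 0

lemma Regime.summable_nonresonant {s σ : ℝ} (hr : Regime s σ) {f : ℤ → ℂ} (hf : MemH s f) (k : ℤ) :
    open Classical in
    Summable fun z : ℤ × ℤ => if z.1 ≠ k ∧ z.1 ≠ z.2 then cubicTerm f k z else 0 := by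
  refine Summable.of_norm_bounded (hr.summable_cubicTerm hf k).norm fun z => ?_
  split_ifs
  · exact le_rfl
  · simp

lemma mul_conj_eq_norm_sq (z : ℂ) : z * starRingEnd ℂ z = ((‖z‖ ^ 2 : ℝ) : ℂ) := by
  rw [Complex.mul_conj, Complex.normSq_eq_norm_sq]

theorem Regime.nonlinearity_eq {s σ : ℝ} (hr : Regime s σ) {f : ℤ → ℂ} (hf : MemH s f) (k : ℤ) :
    nonlinearity f k = nonresonantPart f k - f k * starRingEnd ℂ (f k) * f k := by
  classical
  have hsq : Summable fun m => ‖f m‖ ^ 2 := by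
    have h0 := hf.mono (σ := 0) (by linarith [hr.lower])
    unfold MemH at h0
    simpa using h0
  obtain ⟨M, hM⟩ : ∃ M : ℂ, M = ((∑' m : ℤ, ‖f m‖ ^ 2 : ℝ) : ℂ) := ⟨_, rfl⟩
  have hMs : HasSum (fun m => f m * starRingEnd ℂ (f m)) M := by
    simp_rw [mul_conj_eq_norm_sq]
    rw [hM]
    exact Complex.hasSum_ofReal.2 hsq.hasSum
  have hA : HasSum (fun z : ℤ × ℤ => if z.1 = k then cubicTerm f k z else 0) (M * f k) := by
    have hinj : Function.Injective fun y : ℤ => ((k, y) : ℤ × ℤ) := fun a b h => by simpa using h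
    rw [← hinj.hasSum_iff]
    · have e : (fun z : ℤ × ℤ => if z.1 = k then cubicTerm f k z else 0) ∘ (fun y : ℤ => (k, y)) =
          fun y => f y * starRingEnd ℂ (f y) * f k := by
        funext y
        simp only [Function.comp_apply, if_true, cubicTerm, sub_self, zero_add]
        ring
      rw [e]
      exact hMs.mul_right (f k)
    · rintro ⟨x, y⟩ hxy
      have : x ≠ k := fun h => hxy ⟨y, by simp [h]⟩
      simp [this]
  have hB : HasSum (fun z : ℤ × ℤ => if z.1 = z.2 then cubicTerm f k z else 0) (M * f k) := by
    have hinj : Function.Injective fun y : ℤ => ((y, y) : ℤ × ℤ) := fun a b h => by simpa using h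
    rw [← hinj.hasSum_iff]
    · have e : (fun z : ℤ × ℤ => if z.1 = z.2 then cubicTerm f k z else 0) ∘ (fun y : ℤ => (y, y)) =
          fun y => f y * starRingEnd ℂ (f y) * f k := by
        funext y
        simp only [Function.comp_apply, if_true, cubicTerm, sub_add_cancel]
      rw [e]
      exact hMs.mul_right (f k)
    · rintro ⟨x, y⟩ hxy
      have : x ≠ y := fun h => hxy ⟨y, by simp [h]⟩
      simp [this]
  have hC : HasSum (fun z : ℤ × ℤ => if z = (k, k) then cubicTerm f k z else 0)
      (cubicTerm f k (k, k)) := by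
    have h := hasSum_single (f := fun z : ℤ × ℤ => if z = (k, k) then cubicTerm f k z else 0) (k, k)
      fun z hz => if_neg hz
    rwa [if_pos rfl] at h
  have hD := (hr.summable_nonresonant hf k).hasSum
  have e : ∀ z : ℤ × ℤ, cubicTerm f k z =
      (if z.1 ≠ k ∧ z.1 ≠ z.2 then cubicTerm f k z else 0) +
      (if z.1 = k then cubicTerm f k z else 0) + (if z.1 = z.2 then cubicTerm f k z else 0) -
      (if z = (k, k) then cubicTerm f k z else 0) := by
    rintro ⟨x, y⟩
    generalize cubicTerm f k (x, y) = w
    simp only [Prod.mk.injEq]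
    by_cases h1 : x = k
    · by_cases h2 : y = k
      · simp [h1, h2]
      · simp [h1, h2, Ne.symm h2]
    · by_cases h2 : x = y
      · have h3 : y ≠ k := h2 ▸ h1
        simp [h2, h3]
      · simp [h1, h2]
  have hsum : ∑' z : ℤ × ℤ, cubicTerm f k z = nonresonantPart f k + M * f k + M * f k -
      cubicTerm f k (k, k) := by
    rw [tsum_congr e]
    exact (((hD.add hA).add hB).sub hC).tsum_eq
  have hnl : nonlinearity f k = (∑' z : ℤ × ℤ, cubicTerm f k z) - 2 * M * f k := by
    rw [hM]
    rfl
  rw [hnl, hsum, cubicTerm]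
  simp only [sub_self, zero_add]
  ring

lemma enorm_nonresonantPart_le (f : ℤ → ℂ) (k : ℤ) :
    ‖nonresonantPart f k‖ₑ ≤ cubic (fun k => ‖f k‖ₑ) k := by
  classical
  refine enorm_tsum_le_tsum_enorm.trans (ENNReal.tsum_le_tsum fun z => ?_)
  split_ifs
  · exact (enorm_cubicTerm f k z).le
  · simp

/-! ### Expansion of the time derivative of a form -/

/-- A summand of the form in which the nonresonant nonlinearity is placed at the terminal node `b`
of `c`. -/
def expandSummand (K : ℝ) (μ : ℤ → ℝ) (c : List Node) (b : Node) (f : ℤ → ℂ) (n : Node → ℤ) : ℂ :=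
  multiplier K μ c n * leafProduct (c ++ [b]) n f

/-- A summand of a boundary form, multiplied by the total phase. -/
def leadSummand (K : ℝ) (μ : ℤ → ℝ) (c : List Node) (f : ℤ → ℂ) (n : Node → ℤ) : ℂ :=
  (cumPhase n c c.length : ℂ) * boundarySummand K μ c f n

lemma multiplier_congr (K : ℝ) (μ : ℤ → ℝ) {c : List Node} (hc : IsTree c) {n n' : Node → ℤ}
    (h : ∀ a ∈ nodes c, n a = n' a) : multiplier K μ c n = multiplier K μ c n' := by
  unfold multiplier
  have e := highlyNonresonant_congr (K := K) hc h
  by_cases h1 : HighlyNonresonant K c n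
  · rw [if_pos h1, if_pos (e.1 h1), h root₁ (root₁_mem_nodes c)]
    simp only [cumPhase_congr hc h]
  · rw [if_neg h1, if_neg fun h2 => h1 (e.2 h2)]

lemma absMultiplier_congr (K s : ℝ) {c : List Node} (hc : IsTree c) {n n' : Node → ℤ}
    (h : ∀ a ∈ nodes c, n a = n' a) : absMultiplier K s c n = absMultiplier K s c n' := by
  unfold absMultiplier phaseProd
  have e := highlyNonresonant_congr (K := K) hc h
  by_cases h1 : HighlyNonresonant K c n
  · rw [if_pos h1, if_pos (e.1 h1), h root₁ (root₁_mem_nodes c)]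
    simp only [cumPhase_congr hc h]
  · rw [if_neg h1, if_neg fun h2 => h1 (e.2 h2)]

/-- The sum of the moduli of the coefficients and of their trilinear convolution. -/
def enlarged (f : ℤ → ℂ) : ℤ → ℝ≥0∞ := (fun k => ‖f k‖ₑ) + cubic fun k => ‖f k‖ₑ

lemma enorm_le_enlarged (f : ℤ → ℂ) (k : ℤ) : ‖f k‖ₑ ≤ enlarged f k := by
  rw [enlarged, Pi.add_apply]
  exact le_self_add

lemma cubic_le_enlarged (f : ℤ → ℂ) (k : ℤ) : cubic (fun k => ‖f k‖ₑ) k ≤ enlarged f k := by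
  rw [enlarged, Pi.add_apply]
  exact le_add_self

lemma prod_erase_mul_le {c : List Node} {b : Node} (hb : b ∈ leaves c) (f : ℤ → ℂ)
    (n : Node → ℤ) {x : ℝ≥0∞} (hx : x ≤ enlarged f (n b)) :
    (∏ a ∈ (leaves c).erase b, ‖f (n a)‖ₑ) * x ≤ ∏ a ∈ leaves c, enlarged f (n a) := by
  rw [← Finset.prod_erase_mul _ _ hb]
  exact mul_le_mul' (Finset.prod_le_prod' fun a _ => enorm_le_enlarged f _) hx

lemma tsum_expand_le (N : ℕ∞) {c : List Node} (hc : IsTree c) {b : Node} (hb : b ∈ leaves c)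
    {w : (Node → ℤ) → ℝ≥0∞} (hw : ∀ n n' : Node → ℤ, (∀ a ∈ nodes c, n a = n' a) → w n = w n')
    (f : ℤ → ℂ) :
    ∑' n : indexFunctions N (c ++ [b]), w n * ∏ a ∈ leaves (c ++ [b]), ‖f (n.1 a)‖ₑ ≤
      ∑' n : indexFunctions N c, w n * ∏ a ∈ leaves c, enlarged f (n.1 a) := by
  classical
  rw [tsum_indexFunctions_snoc_ennreal N hc hb
    fun n => w n * ∏ a ∈ leaves (c ++ [b]), ‖f (n a)‖ₑ]
  refine ENNReal.tsum_le_tsum fun n => ?_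
  have h1 : ∀ z : ℤ × ℤ, (if Admissible N (n.1 b) z then w (extend n b z) *
      ∏ a ∈ leaves (c ++ [b]), ‖f (extend n b z a)‖ₑ else 0) ≤
      w n * (∏ a ∈ (leaves c).erase b, ‖f (n.1 a)‖ₑ) *
        (‖f z.1‖ₑ * ‖f z.2‖ₑ * ‖f (n.1 b - z.1 + z.2)‖ₑ) := by
    intro z
    split_ifs
    · rw [prod_leaves_extend hc hb n.1 z fun _ k => ‖f k‖ₑ,
        hw _ n.1 fun a ha => extend_of_mem_nodes hb n.1 z ha]
      exact le_of_eq (by ring)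
    · exact zero_le
  refine (ENNReal.tsum_le_tsum h1).trans ?_
  rw [ENNReal.tsum_mul_left, mul_assoc]
  gcongr
  exact prod_erase_mul_le hb f n (cubic_le_enlarged f _)

lemma leafVal_mul (b : Node) (x y w : ℂ) :
    leafVal b (x * starRingEnd ℂ y * w) =
      leafVal (child b 0) x * leafVal (child b 1) y * leafVal (child b 2) w := by
  unfold leafVal
  simp only [sign_child, Fin.isValue, zero_ne_one, if_false, if_true,
    show ((2 : Fin 3) = 1) = False by simp]
  rcases sign_eq b with h | h
  · norm_num [h]
  · norm_num [h]

lemma leafVal_tsum {ι : Type*} (b : Node) (F : ι → ℂ) :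
    leafVal b (∑' i, F i) = ∑' i, leafVal b (F i) := by
  unfold leafVal
  split_ifs
  · rfl
  · exact Complex.conj_tsum F

lemma leafVal_zero (b : Node) : leafVal b 0 = 0 := by
  unfold leafVal
  split_ifs <;> simp

open Classical in
/-- The nonresonant part of the truncated nonlinearity. -/
def lowNonresonant (N : ℕ∞) (f : ℤ → ℂ) (k : ℤ) : ℂ :=
  if LowFreq N k then nonresonantPart f k else 0

open Classical in
lemma lowNonresonant_eq (N : ℕ∞) (f : ℤ → ℂ) (k : ℤ) :
    lowNonresonant N f k = ∑' z : ℤ × ℤ, if Admissible N k z then cubicTerm f k z else 0 := by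
  unfold lowNonresonant Admissible nonresonantPart
  split_ifs with h
  · simp [h]
  · simp [h]

lemma enorm_lowNonresonant_le (N : ℕ∞) (f : ℤ → ℂ) (k : ℤ) :
    ‖lowNonresonant N f k‖ₑ ≤ enlarged f k := by
  unfold lowNonresonant
  split_ifs
  · exact (enorm_nonresonantPart_le f k).trans (cubic_le_enlarged f k)
  · simp

lemma expandSummand_extend (K : ℝ) (μ : ℤ → ℝ) {c : List Node} (hc : IsTree c) {b : Node}
    (hb : b ∈ leaves c) (f : ℤ → ℂ) (n : Node → ℤ) (z : ℤ × ℤ) :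
    expandSummand K μ c b f (extend n b z) =
      multiplier K μ c n * (∏ a ∈ (leaves c).erase b, leafVal a (f (n a))) *
        leafVal b (cubicTerm f (n b) z) := by
  rw [expandSummand, leafProduct_eq, prod_leaves_extend hc hb n z fun a k => leafVal a (f k),
    cubicTerm, leafVal_mul,
    multiplier_congr K μ hc (n' := n) fun a ha => extend_of_mem_nodes hb n z ha]
  ring

/-- The form with the nonresonant nonlinearity at the terminal node `b`, written on `c`. -/
def insertSummand (K : ℝ) (N : ℕ∞) (μ : ℤ → ℝ) (c : List Node) (b : Node) (f : ℤ → ℂ)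
    (n : Node → ℤ) : ℂ :=
  multiplier K μ c n * (∏ a ∈ (leaves c).erase b, leafVal a (f (n a))) *
    leafVal b (lowNonresonant N f (n b))

lemma tsum_insertSummand (K : ℝ) (N : ℕ∞) (μ : ℤ → ℝ) {c : List Node} (hc : IsTree c) {b : Node}
    (hb : b ∈ leaves c) {f : ℤ → ℂ}
    (h : Summable fun n : indexFunctions N (c ++ [b]) => expandSummand K μ c b f n) :
    ∑' n : indexFunctions N c, insertSummand K N μ c b f n =
      ∑' n : indexFunctions N (c ++ [b]), expandSummand K μ c b f n := by
  classical
  rw [tsum_indexFunctions_snoc N hc hb h]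
  refine tsum_congr fun n => ?_
  rw [insertSummand, lowNonresonant_eq, leafVal_tsum, ← tsum_mul_left]
  refine tsum_congr fun z => ?_
  split_ifs
  · rw [expandSummand_extend K μ hc hb]
  · rw [leafVal_zero, mul_zero]

section

variable {K s σ : ℝ} {μ : ℤ → ℝ}

lemma enorm_insertSummand_le (hμ : IsWeight s μ) (N : ℕ∞) {c : List Node} {b : Node}
    (hb : b ∈ leaves c) (f : ℤ → ℂ) (n : Node → ℤ) :
    ‖insertSummand K N μ c b f n‖ₑ ≤
      absMultiplier K s c n * ∏ a ∈ leaves c, enlarged f (n a) := by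
  rw [insertSummand, enorm_mul, enorm_mul, enorm_leafVal, mul_assoc]
  refine mul_le_mul' (enorm_multiplier_le hμ c n) ?_
  have : ‖∏ a ∈ (leaves c).erase b, leafVal a (f (n a))‖ₑ =
      ∏ a ∈ (leaves c).erase b, ‖f (n a)‖ₑ := by
    simp only [enorm, nnnorm_prod, ENNReal.ofNNReal_finsetProd]
    exact Finset.prod_congr rfl fun a _ => enorm_leafVal a _
  rw [this]
  exact prod_erase_mul_le hb f n (enorm_lowNonresonant_le N f _)

lemma enorm_expandSummand_le (hμ : IsWeight s μ) (c : List Node) (b : Node) (f : ℤ → ℂ)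
    (n : Node → ℤ) :
    ‖expandSummand K μ c b f n‖ₑ ≤
      absMultiplier K s c n * ∏ a ∈ leaves (c ++ [b]), ‖f (n a)‖ₑ := by
  rw [expandSummand, enorm_mul]
  exact mul_le_mul' (enorm_multiplier_le hμ c n) (enorm_leafProduct_le (fun _ => le_rfl) _ n)

open Classical in
lemma leadSummand_snoc (hK : 0 < K) (μ : ℤ → ℝ) {c : List Node} (hc : IsRootedTree c) {b : Node}
    (hb : b ∈ leaves c) (f : ℤ → ℂ) {n : Node → ℤ} (hn : IsIndex (c ++ [b]) n) :
    leadSummand K μ (c ++ [b]) f n =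
      -(sign b : ℂ) * (if HighlyNonresonant K (c ++ [b]) n then expandSummand K μ c b f n
        else 0) := by
  rw [leadSummand, boundarySummand, expandSummand]
  by_cases h : HighlyNonresonant K (c ++ [b]) n
  · have h' := (highlyNonresonant_snoc.1 h).1
    obtain ⟨-, -, p3⟩ := phase_bounds hK (hc.snoc hb) hn h
    have p4 := p3 (c.length + 1) (by simp)
    have hne : (cumPhase n (c ++ [b]) (c.length + 1) : ℝ) ≠ 0 := by
      intro h0
      rw [h0, abs_zero] at p4
      linarith
    have hne' : (cumPhase n (c ++ [b]) (c.length + 1) : ℂ) ≠ 0 := by exact_mod_cast hne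
    have hprod : ∏ j ∈ Finset.Icc 1 c.length, (cumPhase n (c ++ [b]) j : ℝ) =
        ∏ j ∈ Finset.Icc 1 c.length, (cumPhase n c j : ℝ) :=
      Finset.prod_congr rfl fun j hj => by rw [cumPhase_append n c [b] (Finset.mem_Icc.1 hj).2]
    have hm : multiplier K μ (c ++ [b]) n =
        -(sign b : ℝ) * multiplier K μ c n / (cumPhase n (c ++ [b]) (c.length + 1) : ℝ) := by
      rw [multiplier, multiplier, if_pos h, if_pos h', List.length_append, List.length_singleton,
        Finset.prod_Icc_succ_top (by omega), hprod, List.tail_append_of_ne_nil hc.ne_nil,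
        List.map_append, List.prod_append]
      simp only [List.map_cons, List.map_nil, List.prod_cons, List.prod_nil, mul_one]
      push_cast
      rw [div_mul_eq_div_div]
      ring
    rw [hm, if_pos h, List.length_append, List.length_singleton]
    push_cast
    field_simp
  · have hm : multiplier K μ (c ++ [b]) n = 0 := by rw [multiplier, if_neg h]
    simp [hm, h]

lemma leadSummand_add_expandSummand (hK : 0 < K) (μ : ℤ → ℝ) {c : List Node}
    (hc : IsRootedTree c) {b : Node} (hb : b ∈ leaves c) (f : ℤ → ℂ) {n : Node → ℤ}
    (hn : IsIndex (c ++ [b]) n) :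
    -Complex.I * leadSummand K μ (c ++ [b]) f n +
      -Complex.I * (sign b : ℂ) * expandSummand K μ c b f n =
      -Complex.I * (sign b : ℂ) * nearSummand K μ c b f n := by
  classical
  rw [leadSummand_snoc hK μ hc hb f hn, nearSummand, expandSummand]
  split_ifs <;> ring

lemma enorm_leadSummand_snoc_le (hK : 0 < K) (hμ : IsWeight s μ) {c : List Node}
    (hc : IsRootedTree c) {b : Node} (hb : b ∈ leaves c) (f : ℤ → ℂ) {n : Node → ℤ}
    (hn : IsIndex (c ++ [b]) n) :
    ‖leadSummand K μ (c ++ [b]) f n‖ₑ ≤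
      absMultiplier K s c n * ∏ a ∈ leaves (c ++ [b]), ‖f (n a)‖ₑ := by
  classical
  rw [leadSummand_snoc hK μ hc hb f hn, enorm_mul]
  have h1 : ‖-(sign b : ℂ)‖ₑ = 1 := by
    rcases sign_eq b with h | h <;> simp [h]
  rw [h1, one_mul]
  split_ifs
  · exact enorm_expandSummand_le hμ c b f n
  · simp

lemma leadSummand_root (K : ℝ) (μ : ℤ → ℝ) (f : ℤ → ℂ) {n : Node → ℤ}
    (hn : IsIndex [root₁] n) :
    leadSummand K μ [root₁] f n = (μ (n root₁) : ℂ) * leafProduct [root₁] n f := by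
  have h1 : HighlyNonresonant K [root₁] n := by
    intro j h1 h2
    simp only [List.length_singleton] at h2
    omega
  have h2 : cumPhase n [root₁] 1 = phase n root₁ := cumPhase_one IsRootedTree.base n
  have h3 := one_le_abs_phase hn (a := root₁) (by simp)
  have h4 : (phase n root₁ : ℂ) ≠ 0 := by
    intro h0
    have : phase n root₁ = 0 := by exact_mod_cast h0
    rw [this] at h3
    norm_num at h3
  rw [leadSummand, boundarySummand, multiplier, if_pos h1]
  simp only [List.length_singleton, h2, List.tail_cons, List.map_nil, List.prod_nil,
    Finset.Icc_self, Finset.prod_singleton]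
  push_cast
  field_simp

end

/-! ### Time derivatives -/

lemma leafVal_neg_I_mul (a : Node) (w : ℂ) :
    leafVal a (-Complex.I * w) = -Complex.I * (sign a : ℂ) * leafVal a w := by
  unfold leafVal
  rcases sign_eq a with h | h
  · simp [h]
  · simp [h]

open Classical in
lemma Regime.hasDerivAt_coeff {s σ : ℝ} (hr : Regime s σ) {N : ℕ∞} {u : ℝ → ℤ → ℂ}
    (hu : Solves N u) {t : ℝ} (ht : MemH s (u t)) (k : ℤ) :
    HasDerivAt (fun τ => u τ k) (-Complex.I * ((k : ℂ) ^ 4 * u t k + lowNonresonant N (u t) k -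
      (if LowFreq N k then u t k * starRingEnd ℂ (u t k) else 0) * u t k)) t := by
  convert hu.2 t k using 2
  unfold lowNonresonant
  split_ifs
  · rw [hr.nonlinearity_eq ht]
    ring
  · ring

open Classical in
lemma Regime.hasDerivAt_leafVal {s σ : ℝ} (hr : Regime s σ) {N : ℕ∞} {u : ℝ → ℤ → ℂ}
    (hu : Solves N u) {t : ℝ} (ht : MemH s (u t)) (a : Node) (k : ℤ) :
    HasDerivAt (fun τ => leafVal a (u τ k)) (-Complex.I * (sign a : ℂ) *
      ((k : ℂ) ^ 4 * leafVal a (u t k) + leafVal a (lowNonresonant N (u t) k) -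
      (if LowFreq N k then u t k * starRingEnd ℂ (u t k) else 0) * leafVal a (u t k))) t := by
  have h := hr.hasDerivAt_coeff hu ht k
  have h1 : HasDerivAt (fun τ => leafVal a (u τ k)) (leafVal a (-Complex.I *
      ((k : ℂ) ^ 4 * u t k + lowNonresonant N (u t) k -
      (if LowFreq N k then u t k * starRingEnd ℂ (u t k) else 0) * u t k))) t := by
    unfold leafVal
    by_cases ha : sign a = 1
    · simp only [if_pos ha]
      exact h
    · simp only [if_neg ha]
      exact h.star
  rw [leafVal_neg_I_mul] at h1
  convert h1 using 2
  unfold leafVal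
  by_cases ha : sign a = 1
  · simp only [if_pos ha]
  · simp only [if_neg ha, map_sub, map_add, map_mul, map_pow, map_intCast]
    split_ifs
    · simp only [map_mul, Complex.conj_conj]
      ring
    · simp

/-- The time derivative of a summand of a boundary form along a solution. -/
def boundaryRate (K : ℝ) (N : ℕ∞) (μ : ℤ → ℝ) (c : List Node) (f : ℤ → ℂ) (n : Node → ℤ) : ℂ :=
  -Complex.I * leadSummand K μ c f n +
    ∑ b ∈ leaves c, (-Complex.I * (sign b : ℂ) * insertSummand K N μ c b f n +
      Complex.I * (sign b : ℂ) * resonantSummand K N μ c b f n)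

lemma Regime.hasDerivAt_boundarySummand {s σ : ℝ} (hr : Regime s σ) (K : ℝ) {N : ℕ∞} (μ : ℤ → ℝ)
    {u : ℝ → ℤ → ℂ} (hu : Solves N u) {t : ℝ} (ht : MemH s (u t)) {c : List Node} (hc : IsTree c)
    {n : Node → ℤ} (hn : n ∈ indexFunctions N c) :
    HasDerivAt (fun τ => boundarySummand K μ c (u τ) n) (boundaryRate K N μ c (u t) n) t := by
  classical
  have h := (HasDerivAt.fun_finsetProd (u := leaves c) (f := fun a τ => leafVal a (u τ (n a)))
    fun a _ => hr.hasDerivAt_leafVal hu ht a (n a)).const_mul (multiplier K μ c n : ℂ)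
  refine h.congr_deriv ?_
  have h1 : (cumPhase n c c.length : ℂ) = ∑ b ∈ leaves c, (sign b : ℂ) * (n b : ℂ) ^ 4 := by
    rw [← sum_leaves_sign_mul hc hn]
    push_cast
    rfl
  rw [boundaryRate, leadSummand, h1, Finset.sum_mul, Finset.mul_sum, Finset.mul_sum,
    ← Finset.sum_add_distrib]
  refine Finset.sum_congr rfl fun b hb => ?_
  have h2 : leafProduct c n (u t) =
      (∏ a ∈ (leaves c).erase b, leafVal a (u t (n a))) * leafVal b (u t (n b)) := by
    rw [leafProduct_eq, Finset.prod_erase_mul _ _ hb]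
  rw [boundarySummand, insertSummand, resonantSummand, h2, smul_eq_mul]
  split_ifs <;> ring

lemma Regime.hasDerivAt_norm_sq {s σ : ℝ} (hr : Regime s σ) {N : ℕ∞}
    {u : ℝ → ℤ → ℂ} (hu : Solves N u) {t : ℝ} (ht : MemH s (u t)) (k : ℤ) :
    HasDerivAt (fun τ => 1 / 2 * ‖u τ k‖ ^ 2)
      (-Complex.I * (starRingEnd ℂ (u t k) * lowNonresonant N (u t) k)).re t := by
  classical
  have h := (hr.hasDerivAt_coeff hu ht k).norm_sq.const_mul (1 / 2 : ℝ)
  refine h.congr_deriv ?_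
  rw [Complex.inner, ← mul_assoc, one_div, inv_mul_cancel₀ two_ne_zero, one_mul]
  have e : -Complex.I * ((k : ℂ) ^ 4 * u t k + lowNonresonant N (u t) k -
      (if LowFreq N k then u t k * starRingEnd ℂ (u t k) else 0) * u t k) *
      starRingEnd ℂ (u t k) =
      -Complex.I * (starRingEnd ℂ (u t k) * lowNonresonant N (u t) k) - Complex.I *
        ((((k : ℝ) ^ 4 * ‖u t k‖ ^ 2 - (if LowFreq N k then ‖u t k‖ ^ 2 else 0) *
          ‖u t k‖ ^ 2 : ℝ)) : ℂ) := by
    have := mul_conj_eq_norm_sq (u t k)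
    split_ifs
    · push_cast at this ⊢
      rw [← this]
      ring
    · push_cast at this ⊢
      rw [← this]
      ring
  rw [e, Complex.sub_re, Complex.re_mul_ofReal, Complex.I_re, zero_mul, sub_zero]

/-! ### Integration of series term by term -/

theorem integral_tsum_of_hasDerivAt {ι : Type*} [Countable ι] {θ θ' : ι → ℝ → ℂ} {a b B : ℝ}
    (hab : a ≤ b) (hθ : ∀ i t, HasDerivAt (θ i) (θ' i t) t)
    (hB : ∀ t ∈ Icc a b, ∑' i, ‖θ' i t‖ₑ ≤ ENNReal.ofReal B)
    (ha : Summable fun i => θ i a) (hb : Summable fun i => θ i b) :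
    IntervalIntegrable (fun t => ∑' i, θ' i t) MeasureTheory.volume a b ∧
      ∫ t in a..b, ∑' i, θ' i t = ∑' i, θ i b - ∑' i, θ i a := by
  have hd : ∀ i, θ' i = deriv (θ i) := fun i => funext fun t => (hθ i t).deriv.symm
  have hm : ∀ i, Measurable (θ' i) := fun i => hd i ▸ measurable_deriv (θ i)
  have hB' : ∀ t ∈ Icc a b, ∑' i, ‖θ' i t‖ₑ ≤ ENNReal.ofReal (max B 0) := fun t ht =>
    (hB t ht).trans (ENNReal.ofReal_le_ofReal (le_max_left _ _))
  have hint : ∀ g : ℝ → ℂ, Measurable g → (∀ t ∈ Icc a b, ‖g t‖ ≤ max B 0) →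
      IntervalIntegrable g MeasureTheory.volume a b := by
    intro g hg hgb
    rw [intervalIntegrable_iff_integrableOn_Ioc_of_le hab]
    refine MeasureTheory.Measure.integrableOn_of_bounded (by simp) hg.aestronglyMeasurable
      (M := max B 0) ?_
    filter_upwards [MeasureTheory.ae_restrict_mem measurableSet_Ioc] with t ht
    exact hgb t (Ioc_subset_Icc_self ht)
  have hi : ∀ i, IntervalIntegrable (θ' i) MeasureTheory.volume a b := by
    refine fun i => hint _ (hm i) fun t ht => ?_
    have := (ENNReal.le_tsum i).trans (hB' t ht)
    rw [← ofReal_norm] at this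
    exact (ENNReal.ofReal_le_ofReal_iff (le_max_right _ _)).1 this
  refine ⟨hint _ (Measurable.tsum hm) fun t ht =>
    norm_tsum_le_of_tsum_enorm_le (le_max_right _ _) (hB' t ht), ?_⟩
  rw [intervalIntegral.integral_of_le hab, MeasureTheory.integral_tsum
    (fun i => (hm i).aestronglyMeasurable), ← hb.tsum_sub ha]
  · refine tsum_congr fun i => ?_
    rw [← intervalIntegral.integral_of_le hab,
      intervalIntegral.integral_eq_sub_of_hasDerivAt (fun t _ => hθ i t) (hi i)]
  · rw [← MeasureTheory.lintegral_tsum fun i => (hm i).enorm.aemeasurable]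
    refine ne_top_of_le_ne_top ?_ (MeasureTheory.setLIntegral_mono' measurableSet_Ioc
      fun t ht => hB' t (Ioc_subset_Icc_self ht))
    rw [MeasureTheory.setLIntegral_const]
    exact ENNReal.mul_ne_top ENNReal.ofReal_ne_top (by simp)

/-! ### Bounds for the rates -/

/-- The part of the time derivative which is removed by the previous generation. -/
def genLead (K : ℝ) (N : ℕ∞) (μ : ℤ → ℝ) (J : ℕ) (f : ℤ → ℂ) : ℂ :=
  ∑ c ∈ orderedBiTrees (J + 1),
    -Complex.I * ∑' n : indexFunctions N c, leadSummand K μ c f n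

/-- A bound for one form in `genLead`. -/
def leadBound (A K s ρ : ℝ) : ℕ → ℝ
  | 0 => A * ρ ^ 2
  | J + 1 => treeBound K s ρ J

section

variable {K s σ : ℝ} {μ : ℤ → ℝ} {ρ A : ℝ} {J : ℕ} {c : List Node} {f : ℤ → ℂ}

lemma Regime.leadBound_nonneg (hr : Regime s σ) (hK : 0 < K) (hA : 0 ≤ A) (hρ : 0 ≤ ρ) (J : ℕ) :
    0 ≤ leadBound A K s ρ J := by
  match J with
  | 0 => unfold leadBound; positivity
  | J + 1 => exact hr.treeBound_nonneg hK hρ J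

lemma Regime.tsum_expandSummand_le (hr : Regime s σ) (hK : 0 < K) (hμ : IsWeight s μ) (N : ℕ∞)
    (hρ : 1 ≤ ρ) (hf : eNormH σ (enlarged f) ≤ ENNReal.ofReal ρ) (hc : c ∈ orderedBiTrees (J + 1))
    {b : Node} (hb : b ∈ leaves c) :
    ∑' n : indexFunctions N (c ++ [b]), ‖expandSummand K μ c b f n‖ₑ ≤
      ENNReal.ofReal (treeBound K s ρ J) := by
  refine (ENNReal.tsum_le_tsum fun n : indexFunctions N (c ++ [b]) =>
    enorm_expandSummand_le (K := K) hμ c b f n.1).trans ?_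
  have hT := (isRootedTree_of_mem hc).isTree
  exact (tsum_expand_le N hT hb (w := absMultiplier K s c)
    (fun n n' h => absMultiplier_congr K s hT h) f).trans
    (hr.boundary_sum_le (H := enlarged f) hK N hρ hf hc)

lemma Regime.tsum_insertSummand_le (hr : Regime s σ) (hK : 0 < K) (hμ : IsWeight s μ) (N : ℕ∞)
    (hρ : 1 ≤ ρ) (hf : eNormH σ (enlarged f) ≤ ENNReal.ofReal ρ) (hc : c ∈ orderedBiTrees (J + 1))
    {b : Node} (hb : b ∈ leaves c) :
    ∑' n : indexFunctions N c, ‖insertSummand K N μ c b f n‖ₑ ≤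
      ENNReal.ofReal (treeBound K s ρ J) :=
  (ENNReal.tsum_le_tsum fun n : indexFunctions N c =>
    enorm_insertSummand_le (K := K) hμ N hb f n.1).trans
    (hr.boundary_sum_le (H := enlarged f) hK N hρ hf hc)

lemma Regime.tsum_resonantSummand_le (hr : Regime s σ) (hK : 0 < K) (hμ : IsWeight s μ) (N : ℕ∞)
    (hρ : 1 ≤ ρ) (hf : eNormH σ (enlarged f) ≤ ENNReal.ofReal ρ) (hc : c ∈ orderedBiTrees (J + 1))
    {b : Node} (hb : b ∈ leaves c) :
    ∑' n : indexFunctions N c, ‖resonantSummand K N μ c b f n‖ₑ ≤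
      ENNReal.ofReal (treeBound K s ρ J) :=
  (ENNReal.tsum_le_tsum fun n : indexFunctions N c =>
    enorm_resonantSummand_le (K := K) hμ N (enorm_le_enlarged f) c b n.1).trans
    (hr.resonant_sum_le (H := enlarged f) hK N hρ hf hc hb)

lemma tsum_leadSummand_root_le (N : ℕ∞) (hA : ∀ m, |μ m| ≤ A * bracket m ^ (2 * σ)) (hA0 : 0 ≤ A)
    (hρ : 0 ≤ ρ) (hf : eNormH σ (enlarged f) ≤ ENNReal.ofReal ρ) :
    ∑' n : indexFunctions N [root₁], ‖leadSummand K μ [root₁] f n‖ₑ ≤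
      ENNReal.ofReal (A * ρ ^ 2) := by
  have hw : ∀ n n' : Node → ℤ, (∀ a ∈ nodes [], n a = n' a) →
      ENNReal.ofReal |μ (n root₁)| = ENNReal.ofReal |μ (n' root₁)| := fun n n' h => by
    rw [h root₁ (root₁_mem_nodes _)]
  have h1 : ∀ n : indexFunctions N [root₁], ‖leadSummand K μ [root₁] f n‖ₑ ≤
      ENNReal.ofReal |μ (n.1 root₁)| * ∏ a ∈ leaves [root₁], ‖f (n.1 a)‖ₑ := by
    intro n
    rw [leadSummand_root K μ f (isIndex_of_mem n.2), enorm_mul, enorm_ofReal_complex]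
    gcongr
    exact enorm_leafProduct_le (fun _ => le_rfl) _ _
  refine (ENNReal.tsum_le_tsum h1).trans
    ((tsum_expand_le N IsTree.nil root₁_mem_leaves_nil hw f).trans ?_)
  have h2 : ∀ n : indexFunctions N [], ENNReal.ofReal |μ (n.1 root₁)| *
      ∏ a ∈ leaves [], enlarged f (n.1 a) ≤ ENNReal.ofReal A *
        (ENNReal.ofReal (bracket (indexEquivNil N n) ^ σ) *
          enlarged f (indexEquivNil N n)) ^ 2 := by
    intro n
    have e : indexEquivNil N n = n.1 root₁ := rfl
    have e2 : n.1 root₂ = n.1 root₁ := n.2.2.1.symm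
    rw [leaves_nil, Finset.prod_pair root₁_ne_root₂, e, e2, mul_pow, ofReal_rpow_sq, sqWeight,
      ← mul_assoc, ← mul_assoc, ← ENNReal.ofReal_mul hA0, sq, ← mul_assoc]
    gcongr
    exact hA _
  refine (ENNReal.tsum_le_tsum h2).trans ?_
  rw [(indexEquivNil N).tsum_eq fun m => ENNReal.ofReal A *
    (ENNReal.ofReal (bracket m ^ σ) * enlarged f m) ^ 2, ENNReal.tsum_mul_left,
    ENNReal.ofReal_mul hA0, ENNReal.ofReal_pow hρ, ← l2norm_sq]
  gcongr
  exact hf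

lemma Regime.tsum_leadSummand_le (hr : Regime s σ) (hK : 0 < K) (hμ : IsWeight s μ) (N : ℕ∞)
    (hρ : 1 ≤ ρ) (hf : eNormH σ (enlarged f) ≤ ENNReal.ofReal ρ)
    (hA : ∀ m, |μ m| ≤ A * bracket m ^ (2 * σ)) (hA0 : 0 ≤ A) (hc : c ∈ orderedBiTrees (J + 1)) :
    ∑' n : indexFunctions N c, ‖leadSummand K μ c f n‖ₑ ≤
      ENNReal.ofReal (leadBound A K s ρ J) := by
  match J with
  | 0 =>
    have : c = [root₁] := by simpa [orderedBiTrees] using hc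
    subst this
    exact tsum_leadSummand_root_le N hA hA0 (by linarith) hf
  | J + 1 =>
    obtain ⟨c', hc', hc''⟩ := Finset.mem_biUnion.1 hc
    obtain ⟨b, hb, rfl⟩ := Finset.mem_image.1 hc''
    have hT := isRootedTree_of_mem hc'
    refine (ENNReal.tsum_le_tsum fun n : indexFunctions N (c' ++ [b]) =>
      enorm_leadSummand_snoc_le hK hμ hT hb f (isIndex_of_mem n.2)).trans ?_
    exact (tsum_expand_le N hT.isTree hb (w := absMultiplier K s c')
      (fun n n' h => absMultiplier_congr K s hT.isTree h)
      f).trans (hr.boundary_sum_le (H := enlarged f) hK N hρ hf hc')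

lemma Regime.tsum_boundaryRate_le (hr : Regime s σ) (hK : 0 < K) (hμ : IsWeight s μ) (N : ℕ∞)
    (hρ : 1 ≤ ρ) (hf : eNormH σ (enlarged f) ≤ ENNReal.ofReal ρ)
    (hA : ∀ m, |μ m| ≤ A * bracket m ^ (2 * σ)) (hA0 : 0 ≤ A) (hc : c ∈ orderedBiTrees (J + 1)) :
    ∑' n : indexFunctions N c, ‖boundaryRate K N μ c f n‖ₑ ≤
      ENNReal.ofReal (leadBound A K s ρ J + (leaves c).card * (2 * treeBound K s ρ J)) := by
  have hT := hr.treeBound_nonneg hK (by linarith : 0 ≤ ρ) J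
  have h1 : ∀ n : indexFunctions N c, ‖boundaryRate K N μ c f n‖ₑ ≤ ‖leadSummand K μ c f n‖ₑ +
      ∑ b ∈ leaves c, (‖insertSummand K N μ c b f n‖ₑ + ‖resonantSummand K N μ c b f n‖ₑ) := by
    intro n
    refine (enorm_add_le _ _).trans (add_le_add ?_ ((enorm_sum_le _ _).trans
      (Finset.sum_le_sum fun b _ => (enorm_add_le _ _).trans (add_le_add ?_ ?_))))
    · rw [enorm_mul, ← ofReal_norm, norm_neg, Complex.norm_I, ENNReal.ofReal_one, one_mul]
    · rw [enorm_mul, ← ofReal_norm, norm_neg_I_mul_sign, ENNReal.ofReal_one, one_mul]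
    · rw [enorm_mul, ← ofReal_norm, norm_I_mul_sign, ENNReal.ofReal_one, one_mul]
  refine (ENNReal.tsum_le_tsum h1).trans ?_
  rw [ENNReal.tsum_add, Summable.tsum_finsetSum fun _ _ => ENNReal.summable,
    ENNReal.ofReal_add (hr.leadBound_nonneg hK hA0 (by linarith) J) (by positivity)]
  refine add_le_add (hr.tsum_leadSummand_le hK hμ N hρ hf hA hA0 hc) ?_
  refine (Finset.sum_le_sum fun b hb => ?_).trans (le_of_eq (Finset.sum_const
    (ENNReal.ofReal (2 * treeBound K s ρ J)))) |>.trans (le_of_eq ?_)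
  · rw [ENNReal.tsum_add, two_mul, ENNReal.ofReal_add hT hT]
    exact add_le_add (hr.tsum_insertSummand_le hK hμ N hρ hf hc hb)
      (hr.tsum_resonantSummand_le hK hμ N hρ hf hc hb)
  · rw [nsmul_eq_mul, ENNReal.ofReal_mul (Nat.cast_nonneg _), ENNReal.ofReal_natCast]

lemma Regime.insert_eq_near_sub (hr : Regime s σ) (hK : 0 < K) (hμ : IsWeight s μ) (N : ℕ∞)
    (hρ : 1 ≤ ρ) (hf : eNormH σ (enlarged f) ≤ ENNReal.ofReal ρ)
    (hA : ∀ m, |μ m| ≤ A * bracket m ^ (2 * σ)) (hA0 : 0 ≤ A) (hc : c ∈ orderedBiTrees (J + 1))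
    {b : Node} (hb : b ∈ leaves c) :
    -Complex.I * (sign b : ℂ) * ∑' n : indexFunctions N c, insertSummand K N μ c b f n =
      nearForm K N μ c b f -
        -Complex.I * ∑' n : indexFunctions N (c ++ [b]), leadSummand K μ (c ++ [b]) f n := by
  have hT := isRootedTree_of_mem hc
  have hc' : c ++ [b] ∈ orderedBiTrees (J + 1 + 1) :=
    Finset.mem_biUnion.2 ⟨c, hc, Finset.mem_image.2 ⟨b, hb, rfl⟩⟩
  have h1 := summable_of_tsum_enorm_le ENNReal.ofReal_lt_top
    (hr.tsum_expandSummand_le hK hμ N hρ hf hc hb)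
  have h2 := summable_of_tsum_enorm_le ENNReal.ofReal_lt_top
    (hr.tsum_leadSummand_le hK hμ N hρ hf hA hA0 hc')
  rw [tsum_insertSummand K N μ hT.isTree hb h1, nearForm, eq_sub_iff_add_eq, ← tsum_mul_left,
    ← tsum_mul_left, ← tsum_mul_left, ← (h1.mul_left _).tsum_add (h2.mul_left _)]
  refine tsum_congr fun n => ?_
  rw [add_comm, leadSummand_add_expandSummand hK μ hT hb f (isIndex_of_mem n.2)]

lemma Regime.tsum_boundaryRate_eq (hr : Regime s σ) (hK : 0 < K) (hμ : IsWeight s μ) (N : ℕ∞)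
    (hρ : 1 ≤ ρ) (hf : eNormH σ (enlarged f) ≤ ENNReal.ofReal ρ)
    (hA : ∀ m, |μ m| ≤ A * bracket m ^ (2 * σ)) (hA0 : 0 ≤ A) (hc : c ∈ orderedBiTrees (J + 1)) :
    ∑' n : indexFunctions N c, boundaryRate K N μ c f n =
      -Complex.I * ∑' n : indexFunctions N c, leadSummand K μ c f n +
      ∑ b ∈ leaves c, (nearForm K N μ c b f -
        -Complex.I * ∑' n : indexFunctions N (c ++ [b]), leadSummand K μ (c ++ [b]) f n +
        resonantForm K N μ c b f) := by
  have h1 := summable_of_tsum_enorm_le ENNReal.ofReal_lt_top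
    (hr.tsum_leadSummand_le hK hμ N hρ hf hA hA0 hc)
  have h2 := fun b hb => summable_of_tsum_enorm_le ENNReal.ofReal_lt_top
    (hr.tsum_insertSummand_le hK hμ N hρ hf hc (b := b) hb)
  have h3 := fun b hb => summable_of_tsum_enorm_le ENNReal.ofReal_lt_top
    (hr.tsum_resonantSummand_le hK hμ N hρ hf hc (b := b) hb)
  have h4 : ∀ b ∈ leaves c, Summable fun n : indexFunctions N c =>
      -Complex.I * (sign b : ℂ) * insertSummand K N μ c b f n +
      Complex.I * (sign b : ℂ) * resonantSummand K N μ c b f n := fun b hb =>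
    ((h2 b hb).mul_left _).add ((h3 b hb).mul_left _)
  unfold boundaryRate
  rw [(h1.mul_left _).tsum_add (summable_sum h4), tsum_mul_left, Summable.tsum_finsetSum h4]
  congr 1
  refine Finset.sum_congr rfl fun b hb => ?_
  rw [((h2 b hb).mul_left _).tsum_add ((h3 b hb).mul_left _), tsum_mul_left, tsum_mul_left,
    hr.insert_eq_near_sub hK hμ N hρ hf hA hA0 hc hb, resonantForm]

lemma Regime.sum_tsum_boundaryRate (hr : Regime s σ) (hK : 0 < K) (hμ : IsWeight s μ) (N : ℕ∞)
    (hρ : 1 ≤ ρ) (hf : eNormH σ (enlarged f) ≤ ENNReal.ofReal ρ)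
    (hA : ∀ m, |μ m| ≤ A * bracket m ^ (2 * σ)) (hA0 : 0 ≤ A) (J : ℕ) :
    ∑ c ∈ orderedBiTrees (J + 1), ∑' n : indexFunctions N c, boundaryRate K N μ c f n =
      genLead K N μ J f - genLead K N μ (J + 1) f + genFlux K N μ J f := by
  rw [Finset.sum_congr rfl fun c hc => hr.tsum_boundaryRate_eq hK hμ N hρ hf hA hA0 hc,
    genLead, genLead, genFlux, sum_orderedBiTrees J fun c =>
      -Complex.I * ∑' n : indexFunctions N c, leadSummand K μ c f n]
  simp only [Finset.sum_add_distrib, Finset.sum_sub_distrib]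
  ring

lemma Regime.norm_genLead_succ_le (hr : Regime s σ) (hK : 0 < K) (hμ : IsWeight s μ) (N : ℕ∞)
    (hρ : 1 ≤ ρ) (hf : eNormH σ (enlarged f) ≤ ENNReal.ofReal ρ)
    (hA : ∀ m, |μ m| ≤ A * bracket m ^ (2 * σ)) (hA0 : 0 ≤ A) (J : ℕ) :
    ‖genLead K N μ (J + 1) f‖ ≤ genBound K s ρ J := by
  have hT := hr.treeBound_nonneg hK (by linarith : 0 ≤ ρ) J
  refine le_trans ?_ (hr.sum_sum_treeBound_le hK hρ J)
  rw [← sum_orderedBiTrees J fun _ => (2 * (J : ℝ) + 6) *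
      (2 * (K + 2) * (2 * (J : ℝ) + 6) ^ 3 * treeBound K s ρ J + treeBound K s ρ J)]
  refine (norm_sum_le _ _).trans (Finset.sum_le_sum fun c hc => ?_)
  rw [norm_mul, norm_neg, Complex.norm_I, one_mul]
  refine (norm_tsum_le_of_tsum_enorm_le hT
    (hr.tsum_leadSummand_le hK hμ N hρ hf hA hA0 hc)).trans ?_
  have hJ : (0 : ℝ) ≤ J := Nat.cast_nonneg J
  have : 0 ≤ 2 * (K + 2) * (2 * (J : ℝ) + 6) ^ 3 * treeBound K s ρ J := by positivity
  nlinarith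

lemma genLead_zero (K : ℝ) (N : ℕ∞) (hρ : 1 ≤ ρ)
    (hf : eNormH σ (enlarged f) ≤ ENNReal.ofReal ρ)
    (hA : ∀ m, |μ m| ≤ A * bracket m ^ (2 * σ)) (hA0 : 0 ≤ A) :
    genLead K N μ 0 f =
      ∑' m, (μ m : ℂ) * (-Complex.I * (starRingEnd ℂ (f m) * lowNonresonant N f m)) := by
  have h0 : orderedBiTrees (0 + 1) = {[root₁]} := rfl
  have hm : ∀ n, multiplier K μ [] n = μ (n root₁) := fun n => by
    have : HighlyNonresonant K [] n := fun j _ h => by simp at h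
    simp [multiplier, this]
  rw [genLead, h0, Finset.sum_singleton]
  have h1 : ∀ n : indexFunctions N ([] ++ [root₁]), leadSummand K μ [root₁] f n =
      expandSummand K μ [] root₁ f n := fun n => by
    rw [leadSummand_root K μ f (isIndex_of_mem n.2), expandSummand, hm]
    rfl
  have h2 : Summable fun n : indexFunctions N ([] ++ [root₁]) =>
      expandSummand K μ [] root₁ f n :=
    (summable_of_tsum_enorm_le ENNReal.ofReal_lt_top (tsum_leadSummand_root_le (K := K) N hA hA0
      (by linarith) hf)).congr fun n => h1 n
  have h3 : ∑' n : indexFunctions N [root₁], leadSummand K μ [root₁] f n =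
      ∑' n : indexFunctions N ([] ++ [root₁]), expandSummand K μ [] root₁ f n :=
    tsum_congr h1
  rw [h3, ← tsum_insertSummand K N μ IsTree.nil root₁_mem_leaves_nil h2, ← tsum_mul_left,
    ← (indexEquivNil N).tsum_eq]
  refine tsum_congr fun n => ?_
  have e : indexEquivNil N n = n.1 root₁ := rfl
  have e2 : n.1 root₂ = n.1 root₁ := n.2.2.1.symm
  have e3 : (leaves []).erase root₁ = {root₂} := by
    rw [leaves_nil]
    decide
  rw [insertSummand, hm, e3, Finset.prod_singleton, e, e2]
  have e4 : ∀ z, leafVal root₁ z = z := fun z => by simp [leafVal, sign, root₁]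
  have e5 : ∀ z, leafVal root₂ z = starRingEnd ℂ z := fun z => by
    simp [leafVal, sign, root₂]
  rw [e4, e5]
  ring

end

/-! ### Continuity in time -/

lemma normH_sub_comm (r : ℝ) (f g : ℤ → ℂ) : normH r (f - g) = normH r (g - f) := by
  unfold normH
  simp only [Pi.sub_apply, norm_sub_rev]

lemma MemH.abs_normH_sub_le {r : ℝ} {f g : ℤ → ℂ} (hf : MemH r f) (hg : MemH r g) :
    |normH r f - normH r g| ≤ normH r (f - g) := by
  have h1 := hf.normH_le_add hg
  have h2 := hg.normH_le_add hf
  rw [normH_sub_comm] at h2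
  rw [abs_le]
  constructor <;> linarith

lemma ContinuousInH.continuous_normH {r : ℝ} {u : ℝ → ℤ → ℂ} (hu : ContinuousInH r u) :
    Continuous fun t => normH r (u t) := by
  refine continuous_iff_continuousAt.2 fun t₀ => ?_
  rw [ContinuousAt, tendsto_iff_dist_tendsto_zero]
  exact squeeze_zero (fun _ => dist_nonneg)
    (fun t => (hu.1 t).abs_normH_sub_le (hu.1 t₀)) (hu.2 t₀)

lemma ContinuousInH.mono {σ s : ℝ} (h : σ ≤ s) {u : ℝ → ℤ → ℂ} (hu : ContinuousInH s u) :
    ContinuousInH σ u :=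
  ⟨fun t => (hu.1 t).mono h, fun t₀ => squeeze_zero (fun _ => normH_nonneg _ _)
    (fun t => ((hu.1 t).sub (hu.1 t₀)).normH_mono h) (hu.2 t₀)⟩

lemma fluxBound_nonneg {K s ρ : ℝ} (hK : 0 < K) (hs : 3 / 10 < s) (hρ : 0 ≤ ρ) :
    0 ≤ fluxBound K s ρ :=
  tsum_nonneg fun J => genBound_nonneg hK hs hρ J

section

variable {K s σ : ℝ} {μ : ℤ → ℝ} {N : ℕ∞} {u : ℝ → ℤ → ℂ}

lemma Regime.continuous_flux (hr : Regime s σ) (hK : 0 < K) (hμ : IsWeight s μ) (N : ℕ∞)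
    (hu : ContinuousInH σ u) : Continuous fun t => flux K N μ (u t) := by
  refine continuous_iff_continuousAt.2 fun t₀ => Metric.tendsto_nhds.2 fun ε hε => ?_
  set ρ := 2 * normH σ (u t₀) + 2 with hρ
  have hρ0 : 0 ≤ ρ := by linarith [normH_nonneg σ (u t₀)]
  have hF := fluxBound_nonneg hK hr.lower hρ0
  set η := min 1 (ε / (fluxBound K s ρ + 1)) with hη
  have hη0 : 0 < η := lt_min one_pos (by positivity)
  filter_upwards [(hu.2 t₀).eventually (gt_mem_nhds hη0)] with t ht
  have h1 := (hu.1 t).normH_le_add (hu.1 t₀)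
  have h2 : η ≤ 1 := min_le_left _ _
  refine (hr.abs_flux_sub_le_of_normH hK hμ N (hu.1 t) (hu.1 t₀) hη0 ht.le
    (ρ := ρ) (by linarith)).trans_lt ?_
  calc η * fluxBound K s ρ ≤ ε / (fluxBound K s ρ + 1) * fluxBound K s ρ := by
        gcongr
        exact min_le_right _ _
    _ < ε := by
        rw [div_mul_eq_mul_div, div_lt_iff₀ (by positivity)]
        nlinarith

lemma Regime.eNormH_enlarged_le (hr : Regime s σ) {f : ℤ → ℂ} (hf : MemH s f) {R : ℝ}
    (hR : normH s f ≤ R) :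
    eNormH σ (enlarged f) ≤ ENNReal.ofReal (R + (cubicConst s σ).toReal * R ^ 3 + 1) := by
  have hσ : σ ≤ s := by linarith [hr.sigma_lt]
  have hR0 : 0 ≤ R := (normH_nonneg s f).trans hR
  have h1 : eNormH s (fun k => ‖f k‖ₑ) ≤ ENNReal.ofReal R :=
    hf.eNormH_eq.le.trans (ENNReal.ofReal_le_ofReal hR)
  rw [enlarged, ENNReal.ofReal_add (by positivity) zero_le_one, ENNReal.ofReal_add hR0
    (by positivity), ENNReal.ofReal_mul ENNReal.toReal_nonneg, ENNReal.ofReal_toReal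
    hr.cubicConst_lt_top.ne, ENNReal.ofReal_pow hR0]
  refine ((eNormH_add_le _ _ _).trans (add_le_add ((eNormH_mono hσ _).trans h1)
    ((hr.eNormH_cubic_le _).trans ?_))).trans le_self_add
  gcongr

lemma Regime.exists_enlarged_le (hr : Regime s σ) (hu : ContinuousInH s u) (a b : ℝ) :
    ∃ ρ : ℝ, 1 ≤ ρ ∧ ∀ t ∈ Icc a b, eNormH σ (enlarged (u t)) ≤ ENNReal.ofReal ρ := by
  obtain ⟨R, hR⟩ := isCompact_Icc.exists_bound_of_continuousOn
    (s := Icc a b) hu.continuous_normH.continuousOn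
  have h0 : 0 ≤ max R 0 := le_max_right _ _
  refine ⟨max R 0 + (cubicConst s σ).toReal * max R 0 ^ 3 + 1, ?_, fun t ht =>
    hr.eNormH_enlarged_le (hu.1 t) (((le_abs_self _).trans (hR t ht)).trans (le_max_left _ _))⟩
  have : 0 ≤ (cubicConst s σ).toReal * max R 0 ^ 3 :=
    mul_nonneg ENNReal.toReal_nonneg (by positivity)
  linarith

/-! ### The energy identity for weights of finite support -/

variable {A : ℝ}

lemma intervalIntegrable_of_hasDerivAt {E : Type*} [NormedAddCommGroup E] [NormedSpace ℝ E]
    [CompleteSpace E] {g g' : ℝ → E} {a b B : ℝ} (hab : a ≤ b)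
    (hg : ∀ t, HasDerivAt g (g' t) t) (hB : ∀ t ∈ Icc a b, ‖g' t‖ ≤ B) :
    IntervalIntegrable g' MeasureTheory.volume a b := by
  rw [intervalIntegrable_iff_integrableOn_Ioc_of_le hab]
  have : g' = deriv g := funext fun t => (hg t).deriv.symm
  refine MeasureTheory.Measure.integrableOn_of_bounded (by simp)
    (this ▸ stronglyMeasurable_deriv g).aestronglyMeasurable (M := B) ?_
  filter_upwards [MeasureTheory.ae_restrict_mem measurableSet_Ioc] with t ht
  exact hB t (Ioc_subset_Icc_self ht)

lemma Regime.integral_boundarySum (hr : Regime s σ) (hK : 0 < K) (hμ : IsWeight s μ)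
    (hA : ∀ m, |μ m| ≤ A * bracket m ^ (2 * σ)) (hA0 : 0 ≤ A)
    (hu : IsFiniteEnergySolution N s u) {a b : ℝ} (hab : a ≤ b) (J : ℕ) :
    IntervalIntegrable (fun t => genLead K N μ J (u t) - genLead K N μ (J + 1) (u t) +
        genFlux K N μ J (u t)) MeasureTheory.volume a b ∧
      ∫ t in a..b, (genLead K N μ J (u t) - genLead K N μ (J + 1) (u t) +
        genFlux K N μ J (u t)) = boundarySum K N μ J (u b) - boundarySum K N μ J (u a) := by
  have e : (fun t => genLead K N μ J (u t) - genLead K N μ (J + 1) (u t) +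
      genFlux K N μ J (u t)) = fun t => ∑ c ∈ orderedBiTrees (J + 1),
        ∑' n : indexFunctions N c, boundaryRate K N μ c (u t) n := by
    funext t
    obtain ⟨ρ, hρ, h⟩ := hr.exists_enlarged_le hu.1 t t
    exact (hr.sum_tsum_boundaryRate hK hμ N hρ (h t (by simp)) hA hA0 J).symm
  have hs : ∀ t, ∀ c ∈ orderedBiTrees (J + 1),
      Summable fun n : indexFunctions N c => boundarySummand K μ c (u t) n := by
    intro t c hc
    obtain ⟨ρ, hρ, h⟩ := hr.exists_enlarged_le hu.1 t t
    exact (hr.summable_boundarySummand hK hμ N hρ (h t (by simp))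
      (enorm_le_enlarged (u t)) hc).1
  obtain ⟨ρ, hρ, hb⟩ := hr.exists_enlarged_le hu.1 a b
  have key := fun (c : List Node) (hc : c ∈ orderedBiTrees (J + 1)) =>
    integral_tsum_of_hasDerivAt (θ := fun (n : indexFunctions N c) t =>
      boundarySummand K μ c (u t) n) (θ' := fun n t => boundaryRate K N μ c (u t) n) hab
      (fun n t => hr.hasDerivAt_boundarySummand K μ hu.2 (hu.1.1 t)
        (isRootedTree_of_mem hc).isTree n.2)
      (fun t ht => hr.tsum_boundaryRate_le hK hμ N hρ (hb t ht) hA hA0 hc) (hs a c hc) (hs b c hc)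
  have hi : IntervalIntegrable (fun t => ∑ c ∈ orderedBiTrees (J + 1),
      ∑' n : indexFunctions N c, boundaryRate K N μ c (u t) n) MeasureTheory.volume a b :=
    ⟨MeasureTheory.integrable_finsetSum _ fun c hc => (key c hc).1.1,
      MeasureTheory.integrable_finsetSum _ fun c hc => (key c hc).1.2⟩
  refine ⟨e ▸ hi, ?_⟩
  rw [e, intervalIntegral.integral_finsetSum fun c hc => (key c hc).1, boundarySum, boundarySum,
    ← Finset.sum_sub_distrib]
  exact Finset.sum_congr rfl fun c hc => (key c hc).2

lemma Regime.norm_genLead_zero_le (hr : Regime s σ) (hK : 0 < K) (hμ : IsWeight s μ) (N : ℕ∞)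
    {ρ : ℝ} (hρ : 1 ≤ ρ) {f : ℤ → ℂ} (hf : eNormH σ (enlarged f) ≤ ENNReal.ofReal ρ)
    (hA : ∀ m, |μ m| ≤ A * bracket m ^ (2 * σ)) (hA0 : 0 ≤ A) :
    ‖genLead K N μ 0 f‖ ≤ leadBound A K s ρ 0 := by
  have h0 : orderedBiTrees (0 + 1) = {[root₁]} := rfl
  rw [genLead, h0, Finset.sum_singleton, norm_mul, norm_neg, Complex.norm_I, one_mul]
  exact norm_tsum_le_of_tsum_enorm_le (hr.leadBound_nonneg hK hA0 (by linarith) 0)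
    (hr.tsum_leadSummand_le hK hμ N hρ hf hA hA0 (J := 0) (by simp [orderedBiTrees]))

lemma Regime.integral_genLead_zero (hr : Regime s σ) (hK : 0 < K) (hμ : IsWeight s μ)
    (hA : ∀ m, |μ m| ≤ A * bracket m ^ (2 * σ)) (hA0 : 0 ≤ A) {S : Finset ℤ}
    (hS : ∀ m ∉ S, μ m = 0) (hu : IsFiniteEnergySolution N s u) {a b : ℝ} (hab : a ≤ b) :
    IntervalIntegrable (fun t => (genLead K N μ 0 (u t)).re) MeasureTheory.volume a b ∧
      ∫ t in a..b, (genLead K N μ 0 (u t)).re =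
        ∑' m, μ m * (1 / 2 * ‖u b m‖ ^ 2) - ∑' m, μ m * (1 / 2 * ‖u a m‖ ^ 2) := by
  have hfin : ∀ t, ∑' m, μ m * (1 / 2 * ‖u t m‖ ^ 2) = ∑ m ∈ S, μ m * (1 / 2 * ‖u t m‖ ^ 2) :=
    fun t => tsum_eq_sum fun m hm => by rw [hS m hm, zero_mul]
  have hd : ∀ t, HasDerivAt (fun τ => ∑' m, μ m * (1 / 2 * ‖u τ m‖ ^ 2))
      (genLead K N μ 0 (u t)).re t := by
    intro t
    simp_rw [hfin]
    obtain ⟨ρ, hρ, h⟩ := hr.exists_enlarged_le hu.1 t t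
    rw [genLead_zero K N hρ (h t (by simp)) hA hA0, tsum_eq_sum (s := S) fun m hm => by
      rw [hS m hm, Complex.ofReal_zero, zero_mul], Complex.re_sum]
    simp_rw [Complex.re_ofReal_mul]
    exact HasDerivAt.fun_sum fun m _ => (hr.hasDerivAt_norm_sq hu.2 (hu.1.1 t) m).const_mul _
  obtain ⟨ρ, hρ, hb⟩ := hr.exists_enlarged_le hu.1 a b
  have hi := intervalIntegrable_of_hasDerivAt hab hd fun t ht =>
    (Complex.abs_re_le_norm _).trans (hr.norm_genLead_zero_le hK hμ N hρ (hb t ht) hA hA0)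
  exact ⟨hi, intervalIntegral.integral_eq_sub_of_hasDerivAt (fun t _ => hd t) hi⟩

lemma Regime.integral_partial (hr : Regime s σ) (hK : 0 < K) (hμ : IsWeight s μ)
    (hA : ∀ m, |μ m| ≤ A * bracket m ^ (2 * σ)) (hA0 : 0 ≤ A) {S : Finset ℤ}
    (hS : ∀ m ∉ S, μ m = 0) (hu : IsFiniteEnergySolution N s u) {a b : ℝ} (hab : a ≤ b) (L : ℕ) :
    IntervalIntegrable (fun t => (genLead K N μ L (u t)).re -
        ∑ J ∈ Finset.range L, (genFlux K N μ J (u t)).re) MeasureTheory.volume a b ∧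
      ∫ t in a..b, ((genLead K N μ L (u t)).re -
        ∑ J ∈ Finset.range L, (genFlux K N μ J (u t)).re) =
        (∑' m, μ m * (1 / 2 * ‖u b m‖ ^ 2) -
          ∑ J ∈ Finset.range L, (boundarySum K N μ J (u b)).re) -
        (∑' m, μ m * (1 / 2 * ‖u a m‖ ^ 2) -
          ∑ J ∈ Finset.range L, (boundarySum K N μ J (u a)).re) := by
  induction L with
  | zero => simpa using hr.integral_genLead_zero hK hμ hA hA0 hS hu hab
  | succ L ih =>
    obtain ⟨i1, e1⟩ := ih
    obtain ⟨i2, e2⟩ := hr.integral_boundarySum hK hμ hA hA0 hu hab L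
    have i3 : IntervalIntegrable (fun t => (genLead K N μ L (u t) - genLead K N μ (L + 1) (u t) +
        genFlux K N μ L (u t)).re) MeasureTheory.volume a b := ⟨i2.1.re, i2.2.re⟩
    have e3 : ∫ t in a..b, (genLead K N μ L (u t) - genLead K N μ (L + 1) (u t) +
        genFlux K N μ L (u t)).re =
        (boundarySum K N μ L (u b)).re - (boundarySum K N μ L (u a)).re := by
      rw [← Complex.sub_re, ← e2]
      exact Complex.reCLM.intervalIntegral_comp_comm i2
    have e : (fun t => (genLead K N μ (L + 1) (u t)).re -
        ∑ J ∈ Finset.range (L + 1), (genFlux K N μ J (u t)).re) =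
        fun t => ((genLead K N μ L (u t)).re -
        ∑ J ∈ Finset.range L, (genFlux K N μ J (u t)).re) -
        (genLead K N μ L (u t) - genLead K N μ (L + 1) (u t) + genFlux K N μ L (u t)).re := by
      funext t
      rw [Finset.sum_range_succ, Complex.add_re, Complex.sub_re]
      ring
    refine ⟨e ▸ i1.sub i3, ?_⟩
    rw [e, intervalIntegral.integral_sub i1 i3, e1, e3, Finset.sum_range_succ,
      Finset.sum_range_succ]
    ring

/-- The modified energy with a general weight. -/
def weightedEnergy (K : ℝ) (N : ℕ∞) (μ : ℤ → ℝ) (f : ℤ → ℂ) : ℝ :=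
  ∑' m, μ m * (1 / 2 * ‖f m‖ ^ 2) - ∑' J, (boundarySum K N μ J f).re

lemma Regime.summable_re_boundarySum (hr : Regime s σ) (hK : 0 < K) (hμ : IsWeight s μ) (N : ℕ∞)
    {ρ : ℝ} (hρ : 1 ≤ ρ) {f : ℤ → ℂ} (hf : eNormH σ (enlarged f) ≤ ENNReal.ofReal ρ) :
    Summable fun J => (boundarySum K N μ J f).re :=
  Summable.of_norm_bounded (summable_genBound hK hr.lower (by linarith)) fun J =>
    (Complex.abs_re_le_norm _).trans
      (hr.norm_boundarySum_le hK hμ N hρ hf (enorm_le_enlarged f) J)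

theorem Regime.weightedEnergy_sub_of_support (hr : Regime s σ) (hK : 0 < K) (hμ : IsWeight s μ)
    (hA : ∀ m, |μ m| ≤ A * bracket m ^ (2 * σ)) (hA0 : 0 ≤ A) {S : Finset ℤ}
    (hS : ∀ m ∉ S, μ m = 0) (hu : IsFiniteEnergySolution N s u) {a b : ℝ} (hab : a ≤ b) :
    weightedEnergy K N μ (u b) - weightedEnergy K N μ (u a) =
      ∫ t in a..b, -flux K N μ (u t) := by
  have hE : ∀ t, Tendsto (fun L => ∑' m, μ m * (1 / 2 * ‖u t m‖ ^ 2) -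
      ∑ J ∈ Finset.range (L + 1), (boundarySum K N μ J (u t)).re) atTop
      (𝓝 (weightedEnergy K N μ (u t))) := by
    intro t
    obtain ⟨ρ, hρ, h⟩ := hr.exists_enlarged_le hu.1 t t
    exact tendsto_const_nhds.sub ((hr.summable_re_boundarySum hK hμ N hρ
      (h t (by simp))).hasSum.tendsto_sum_nat.comp (tendsto_add_atTop_nat 1))
  obtain ⟨ρ, hρ, hb⟩ := hr.exists_enlarged_le hu.1 a b
  have hsum := summable_genBound hK hr.lower (by linarith : 0 ≤ ρ)
  have hnn := fun J => genBound_nonneg hK hr.lower (by linarith : 0 ≤ ρ) J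
  have hI : Tendsto (fun L => ∫ t in a..b, ((genLead K N μ (L + 1) (u t)).re -
      ∑ J ∈ Finset.range (L + 1), (genFlux K N μ J (u t)).re)) atTop
      (𝓝 (∫ t in a..b, -flux K N μ (u t))) := by
    refine intervalIntegral.tendsto_integral_filter_of_dominated_convergence
      (fun _ => fluxBound K s ρ + fluxBound K s ρ) (Eventually.of_forall fun L => ?_)
      (Eventually.of_forall fun L => MeasureTheory.ae_of_all _ fun t ht => ?_)
      (intervalIntegrable_const) (MeasureTheory.ae_of_all _ fun t ht => ?_)
    · rw [uIoc_of_le hab]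
      exact (hr.integral_partial hK hμ hA hA0 hS hu hab (L + 1)).1.1.aestronglyMeasurable
    · rw [uIoc_of_le hab] at ht
      have ht' := hb t (Ioc_subset_Icc_self ht)
      refine (norm_sub_le _ _).trans (add_le_add ?_ ?_)
      · exact ((Complex.abs_re_le_norm _).trans (hr.norm_genLead_succ_le hK hμ N hρ ht' hA hA0
          L)).trans (hsum.le_tsum L fun J _ => hnn J)
      · refine (norm_sum_le _ _).trans (le_trans (Finset.sum_le_sum fun J _ =>
          (Complex.abs_re_le_norm _).trans
            (hr.norm_genFlux_le hK hμ N hρ ht' (enorm_le_enlarged _) J)) ?_)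
        exact hsum.sum_le_tsum _ fun J _ => hnn J
    · rw [uIoc_of_le hab] at ht
      have ht' := hb t (Ioc_subset_Icc_self ht)
      have h1 : Tendsto (fun L => (genLead K N μ (L + 1) (u t)).re) atTop (𝓝 0) :=
        squeeze_zero_norm (fun L => (Complex.abs_re_le_norm _).trans
          (hr.norm_genLead_succ_le hK hμ N hρ ht' hA hA0 L)) hsum.tendsto_atTop_zero
      have h2 := (hr.summable_re_genFlux hK hμ N hρ ht'
        (enorm_le_enlarged _)).hasSum.tendsto_sum_nat.comp (tendsto_add_atTop_nat 1)
      have h3 := h1.sub h2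
      rwa [zero_sub] at h3
  refine tendsto_nhds_unique ((hE b).sub (hE a)) (hI.congr fun L => ?_)
  exact (hr.integral_partial hK hμ hA hA0 hS hu hab (L + 1)).2

end

/-! ### Truncation of the weight -/

/-- The restriction of a weight to the frequencies `|m| ≤ M`. -/
def truncWeight (μ : ℤ → ℝ) (M : ℕ) (m : ℤ) : ℝ := if m.natAbs ≤ M then μ m else 0

lemma tendsto_tsum_trunc {ι : Type*} {E : Type*} [NormedAddCommGroup E] [CompleteSpace E]
    {F : ι → E} (hF : Summable fun i => ‖F i‖) (g : ι → ℕ) :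
    Tendsto (fun M => ∑' i, if g i ≤ M then F i else 0) atTop (𝓝 (∑' i, F i)) := by
  refine tendsto_tsum_of_dominated_convergence hF (fun i => ?_)
    (Eventually.of_forall fun M i => ?_)
  · refine tendsto_const_nhds.congr' ?_
    filter_upwards [eventually_ge_atTop (g i)] with M hM
    rw [if_pos hM]
  · split_ifs
    · exact le_rfl
    · simp

lemma multiplier_truncWeight (K : ℝ) (μ : ℤ → ℝ) (M : ℕ) (c : List Node) (n : Node → ℤ) :
    multiplier K (truncWeight μ M) c n =
      if (n root₁).natAbs ≤ M then multiplier K μ c n else 0 := by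
  unfold multiplier truncWeight
  split_ifs <;> simp

lemma boundarySummand_truncWeight (K : ℝ) (μ : ℤ → ℝ) (M : ℕ) (c : List Node) (f : ℤ → ℂ)
    (n : Node → ℤ) : boundarySummand K (truncWeight μ M) c f n =
      if (n root₁).natAbs ≤ M then boundarySummand K μ c f n else 0 := by
  unfold boundarySummand
  rw [multiplier_truncWeight]
  split_ifs <;> simp

lemma nearSummand_truncWeight (K : ℝ) (μ : ℤ → ℝ) (M : ℕ) (c : List Node) (b : Node)
    (f : ℤ → ℂ) (n : Node → ℤ) : nearSummand K (truncWeight μ M) c b f n =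
      if (n root₁).natAbs ≤ M then nearSummand K μ c b f n else 0 := by
  unfold nearSummand
  rw [multiplier_truncWeight]
  split_ifs <;> simp

lemma resonantSummand_truncWeight (K : ℝ) (N : ℕ∞) (μ : ℤ → ℝ) (M : ℕ) (c : List Node) (b : Node)
    (f : ℤ → ℂ) (n : Node → ℤ) : resonantSummand K N (truncWeight μ M) c b f n =
      if (n root₁).natAbs ≤ M then resonantSummand K N μ c b f n else 0 := by
  unfold resonantSummand
  rw [multiplier_truncWeight]
  split_ifs <;> simp

section

variable {K s σ : ℝ} {μ : ℤ → ℝ} {N : ℕ∞} {u : ℝ → ℤ → ℂ}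

lemma IsWeight.trunc (hμ : IsWeight s μ) (M : ℕ) : IsWeight s (truncWeight μ M) := by
  intro m
  unfold truncWeight
  split_ifs
  · exact hμ m
  · rw [abs_zero]
    exact Real.rpow_nonneg (bracket_pos _).le _

lemma IsWeight.exists_trunc_le (hμ : IsWeight s μ) (hσ : σ ≤ s) (M : ℕ) :
    ∃ A : ℝ, 0 ≤ A ∧ ∀ m, |truncWeight μ M m| ≤ A * bracket m ^ (2 * σ) := by
  refine ⟨bracket M ^ (2 * (s - σ)), Real.rpow_nonneg (bracket_pos _).le _, fun m => ?_⟩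
  have h0 : 0 ≤ bracket m ^ (2 * σ) := Real.rpow_nonneg (bracket_pos _).le _
  unfold truncWeight
  split_ifs with h
  · refine (hμ m).trans ?_
    have e : bracket m ^ (2 * s) = bracket m ^ (2 * (s - σ)) * bracket m ^ (2 * σ) := by
      rw [← Real.rpow_add (bracket_pos _)]
      congr 1
      ring
    rw [e]
    refine mul_le_mul_of_nonneg_right (Real.rpow_le_rpow (bracket_pos _).le ?_ (by linarith)) h0
    unfold bracket
    refine Real.sqrt_le_sqrt ?_
    have h1 : |(m : ℝ)| ≤ M := by
      rw [← Int.cast_abs, Int.abs_eq_natAbs]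
      exact_mod_cast h
    have h2 : (m : ℝ) ^ 2 ≤ (M : ℝ) ^ 2 := sq_le_sq' (neg_le_of_abs_le h1) (le_of_abs_le h1)
    push_cast
    linarith
  · rw [abs_zero]
    exact mul_nonneg (Real.rpow_nonneg (bracket_pos _).le _) h0

lemma truncWeight_eq_zero {M : ℕ} {m : ℤ} (hm : m ∉ Finset.Icc (-(M : ℤ)) M) :
    truncWeight μ M m = 0 := by
  unfold truncWeight
  rw [if_neg]
  rw [Finset.mem_Icc] at hm
  omega

variable {ρ : ℝ} {f : ℤ → ℂ}

lemma Regime.tendsto_boundarySum (hr : Regime s σ) (hK : 0 < K) (hμ : IsWeight s μ) (N : ℕ∞)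
    (hρ : 1 ≤ ρ) (hf : eNormH σ (fun k => ‖f k‖ₑ) ≤ ENNReal.ofReal ρ) (J : ℕ) :
    Tendsto (fun M => boundarySum K N (truncWeight μ M) J f) atTop
      (𝓝 (boundarySum K N μ J f)) := by
  unfold boundarySum
  refine tendsto_finsetSum _ fun c hc => ?_
  simp_rw [boundarySummand_truncWeight]
  exact tendsto_tsum_trunc (hr.summable_boundarySummand hK hμ N hρ hf (fun _ => le_rfl) hc).1.norm
    fun n : indexFunctions N c => (n.1 root₁).natAbs

lemma Regime.tendsto_genFlux (hr : Regime s σ) (hK : 0 < K) (hμ : IsWeight s μ) (N : ℕ∞)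
    (hρ : 1 ≤ ρ) (hf : eNormH σ (fun k => ‖f k‖ₑ) ≤ ENNReal.ofReal ρ) (J : ℕ) :
    Tendsto (fun M => genFlux K N (truncWeight μ M) J f) atTop (𝓝 (genFlux K N μ J f)) := by
  unfold genFlux nearForm resonantForm
  refine tendsto_finsetSum _ fun c hc => tendsto_finsetSum _ fun b hb => ?_
  simp_rw [nearSummand_truncWeight, resonantSummand_truncWeight]
  exact ((tendsto_tsum_trunc
    (hr.summable_nearSummand hK hμ N hρ hf (fun _ => le_rfl) hc hb).1.norm
    fun n : indexFunctions N (c ++ [b]) => (n.1 root₁).natAbs).const_mul _).add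
    ((tendsto_tsum_trunc
    (hr.summable_resonantSummand hK hμ N hρ hf (fun _ => le_rfl) hc hb).1.norm
    fun n : indexFunctions N c => (n.1 root₁).natAbs).const_mul _)

lemma Regime.tendsto_flux (hr : Regime s σ) (hK : 0 < K) (hμ : IsWeight s μ) (N : ℕ∞)
    (hρ : 1 ≤ ρ) (hf : eNormH σ (fun k => ‖f k‖ₑ) ≤ ENNReal.ofReal ρ) :
    Tendsto (fun M => flux K N (truncWeight μ M) f) atTop (𝓝 (flux K N μ f)) :=
  tendsto_tsum_of_dominated_convergence (summable_genBound hK hr.lower (by linarith : 0 ≤ ρ))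
    (fun J => (Complex.continuous_re.tendsto _).comp (hr.tendsto_genFlux hK hμ N hρ hf J))
    (Eventually.of_forall fun M J => (Complex.abs_re_le_norm _).trans
      (hr.norm_genFlux_le hK (hμ.trunc M) N hρ hf (fun _ => le_rfl) J))

lemma summable_weight_mul_sq (hμ : IsWeight s μ) (hf : MemH s f) :
    Summable fun m => ‖μ m * (1 / 2 * ‖f m‖ ^ 2)‖ := by
  refine Summable.of_nonneg_of_le (fun _ => norm_nonneg _) (fun m => ?_) hf
  rw [norm_mul, Real.norm_eq_abs, Real.norm_of_nonneg (by positivity)]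
  have h1 := hμ m
  have h2 : 0 ≤ ‖f m‖ ^ 2 := by positivity
  have h3 := abs_nonneg (μ m)
  nlinarith [mul_le_mul_of_nonneg_right h1 h2, mul_nonneg h3 h2]

lemma Regime.tendsto_weightedEnergy (hr : Regime s σ) (hK : 0 < K) (hμ : IsWeight s μ) (N : ℕ∞)
    (hf : MemH s f) :
    Tendsto (fun M => weightedEnergy K N (truncWeight μ M) f) atTop
      (𝓝 (weightedEnergy K N μ f)) := by
  have hσ : σ ≤ s := by linarith [hr.sigma_lt]
  have hn := normH_nonneg σ f
  have hρ : 1 ≤ normH σ f + 1 := by linarith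
  have hH : eNormH σ (fun k => ‖f k‖ₑ) ≤ ENNReal.ofReal (normH σ f + 1) :=
    (hf.mono hσ).eNormH_eq.le.trans (ENNReal.ofReal_le_ofReal (by linarith))
  refine Tendsto.sub ?_ ?_
  · have e : ∀ M m, truncWeight μ M m * (1 / 2 * ‖f m‖ ^ 2) =
        if m.natAbs ≤ M then μ m * (1 / 2 * ‖f m‖ ^ 2) else 0 := by
      intro M m
      unfold truncWeight
      split_ifs <;> simp
    simp_rw [e]
    exact tendsto_tsum_trunc (summable_weight_mul_sq hμ hf) Int.natAbs
  · exact tendsto_tsum_of_dominated_convergence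
      (summable_genBound hK hr.lower (by linarith : 0 ≤ normH σ f + 1))
      (fun J => (Complex.continuous_re.tendsto _).comp (hr.tendsto_boundarySum hK hμ N hρ hH J))
      (Eventually.of_forall fun M J => (Complex.abs_re_le_norm _).trans
        (hr.norm_boundarySum_le hK (hμ.trunc M) N hρ hH (fun _ => le_rfl) J))

/-! ### The energy identity -/

theorem Regime.weightedEnergy_sub (hr : Regime s σ) (hK : 0 < K) (hμ : IsWeight s μ)
    (hu : IsFiniteEnergySolution N s u) {a b : ℝ} (hab : a ≤ b) :
    weightedEnergy K N μ (u b) - weightedEnergy K N μ (u a) =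
      ∫ t in a..b, -flux K N μ (u t) := by
  have hσ : σ ≤ s := by linarith [hr.sigma_lt]
  have huσ := hu.1.mono hσ
  obtain ⟨ρ, hρ, hb⟩ := hr.exists_enlarged_le hu.1 a b
  have hb' : ∀ t ∈ Icc a b, eNormH σ (fun k => ‖u t k‖ₑ) ≤ ENNReal.ofReal ρ := fun t ht =>
    (eNormH_mono_fun σ (enorm_le_enlarged (u t))).trans (hb t ht)
  have hI : Tendsto (fun M => ∫ t in a..b, -flux K N (truncWeight μ M) (u t)) atTop
      (𝓝 (∫ t in a..b, -flux K N μ (u t))) := by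
    refine intervalIntegral.tendsto_integral_filter_of_dominated_convergence
      (fun _ => fluxBound K s ρ) (Eventually.of_forall fun M => ?_)
      (Eventually.of_forall fun M => MeasureTheory.ae_of_all _ fun t ht => ?_)
      intervalIntegrable_const (MeasureTheory.ae_of_all _ fun t ht => ?_)
    · exact (hr.continuous_flux hK (hμ.trunc M) N huσ).neg.aestronglyMeasurable
    · rw [uIoc_of_le hab] at ht
      rw [norm_neg]
      exact hr.abs_flux_le hK (hμ.trunc M) N hρ (hb' t (Ioc_subset_Icc_self ht)) fun _ => le_rfl
    · rw [uIoc_of_le hab] at ht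
      exact (hr.tendsto_flux hK hμ N hρ (hb' t (Ioc_subset_Icc_self ht))).neg
  refine tendsto_nhds_unique ((hr.tendsto_weightedEnergy hK hμ N (hu.1.1 b)).sub
    (hr.tendsto_weightedEnergy hK hμ N (hu.1.1 a))) (hI.congr fun M => ?_)
  obtain ⟨A, hA0, hA⟩ := hμ.exists_trunc_le hσ M
  exact (hr.weightedEnergy_sub_of_support hK (hμ.trunc M) hA hA0
    (fun m hm => truncWeight_eq_zero hm) hu hab).symm

lemma modifiedEnergy_eq (K : ℝ) (N : ℕ∞) (s : ℝ) (f : ℤ → ℂ) :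
    modifiedEnergy K N s f = weightedEnergy K N (fun m => bracket m ^ (2 * s)) f := by
  unfold modifiedEnergy weightedEnergy normH
  rw [Real.sq_sqrt (tsum_nonneg (weighted_sq_nonneg s f)), ← tsum_mul_left]
  congr 1
  · exact tsum_congr fun m => by ring
  · exact tsum_congr fun J => boundaryForm_eq K N s J f

theorem Regime.hasDerivAt_modifiedEnergy (hr : Regime s σ) (hK : 0 < K)
    (hu : IsFiniteEnergySolution N s u) (t : ℝ) :
    HasDerivAt (fun τ => modifiedEnergy K N s (u τ))
      (-flux K N (fun m => bracket m ^ (2 * s)) (u t)) t := by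
  have hσ : σ ≤ s := by linarith [hr.sigma_lt]
  have hc := (hr.continuous_flux hK (isWeight_bracket s) N (hu.1.mono hσ)).neg
  have h1 : HasDerivAt (fun τ => modifiedEnergy K N s (u (t - 1)) +
      ∫ r in (t - 1)..τ, -flux K N (fun m => bracket m ^ (2 * s)) (u r))
      (-flux K N (fun m => bracket m ^ (2 * s)) (u t)) t :=
    (hc.integral_hasStrictDerivAt (t - 1) t).hasDerivAt.const_add _
  refine h1.congr_of_eventuallyEq ?_
  filter_upwards [lt_mem_nhds (show t - 1 < t by linarith)] with τ hτ
  rw [← hr.weightedEnergy_sub hK (isWeight_bracket s) hu hτ.le, modifiedEnergy_eq,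
    modifiedEnergy_eq]
  ring

/-! ### Truncated equations -/

lemma eq_zero_of_not_lowFreq (hu : Solves N u) {n : ℤ} (hn : ¬ LowFreq N n) (t : ℝ) :
    u t n = 0 := by
  have hd : ∀ t : ℝ, HasDerivAt
      (fun τ : ℝ => Complex.exp (Complex.I * (n : ℂ) ^ 4 * τ) * u τ n) 0 t := by
    intro t
    have h1 := hu.2 t n
    rw [if_neg hn, add_zero] at h1
    have h2 : HasDerivAt (fun τ : ℝ => Complex.exp (Complex.I * (n : ℂ) ^ 4 * τ))
        (Complex.exp (Complex.I * (n : ℂ) ^ 4 * t) * (Complex.I * (n : ℂ) ^ 4)) t := by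
      have h3 : HasDerivAt (fun τ : ℝ => Complex.I * (n : ℂ) ^ 4 * (τ : ℂ))
          (Complex.I * (n : ℂ) ^ 4) t := by
        simpa using (Complex.ofRealCLM.hasDerivAt (x := t)).const_mul (Complex.I * (n : ℂ) ^ 4)
      exact h3.cexp
    refine (h2.mul h1).congr_deriv ?_
    ring
  have hc := is_const_of_deriv_eq_zero (fun t => (hd t).differentiableAt)
    (fun t => (hd t).deriv) t 0
  simp only [hu.1 n hn, mul_zero] at hc
  exact (mul_eq_zero.1 hc).resolve_left (Complex.exp_ne_zero _)

lemma Solves.isFiniteEnergySolution (hN : N ≠ ⊤) (hu : Solves N u) (s : ℝ) :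
    IsFiniteEnergySolution N s u := by
  obtain ⟨M, rfl⟩ := ENat.ne_top_iff_exists.1 hN
  have hz : ∀ t, ∀ n ∉ Finset.Icc (-(M : ℤ)) M, u t n = 0 := by
    intro t n hn
    refine eq_zero_of_not_lowFreq hu (fun h => hn ?_) t
    have : n.natAbs ≤ M := ENat.natCast_le_natCast.1 h
    rw [Finset.mem_Icc]
    omega
  refine ⟨⟨fun t => summable_of_ne_finset_zero (s := Finset.Icc (-(M : ℤ)) M) fun n hn => by
    rw [hz t n hn]; simp, fun t₀ => ?_⟩, hu⟩
  have e : ∀ t, normH s (u t - u t₀) = Real.sqrt (∑ n ∈ Finset.Icc (-(M : ℤ)) M,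
      bracket n ^ (2 * s) * ‖u t n - u t₀ n‖ ^ 2) := by
    intro t
    unfold normH
    rw [tsum_eq_sum (s := Finset.Icc (-(M : ℤ)) M) fun n hn => by
      rw [Pi.sub_apply, hz t n hn, hz t₀ n hn]; simp]
    rfl
  simp_rw [e]
  have hc : Continuous fun t => Real.sqrt (∑ n ∈ Finset.Icc (-(M : ℤ)) M,
      bracket n ^ (2 * s) * ‖u t n - u t₀ n‖ ^ 2) := by
    refine Real.continuous_sqrt.comp (continuous_finsetSum _ fun n _ => ?_)
    have h : Continuous fun t => u t n :=
      continuous_iff_continuousAt.2 fun t => (hu.2 t n).continuousAt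
    fun_prop
  have := hc.tendsto t₀
  simpa using this

end

end FourNLS

end

/-- The energy estimate. `K` is the implicit constant in the definition of the nearly resonant
sets; the constant `C` depends only on `s`, `ε`, `K` and `R`. -/
theorem proposition3p3 (s : ℝ) (hs : 3 / 10 < s) (hs' : s ≤ 1 / 2) :
    ∃ ε₀ : ℝ, 0 < ε₀ ∧ ∀ ε σ : ℝ, 0 < ε → ε < ε₀ → σ = s - 1 / 2 - ε →
      ∀ K : ℝ, 0 < K →
        (∀ (N : ℕ∞) (f : ℤ → ℂ), FourNLS.MemH σ f → FourNLS.CorrectionsConverge K N s f) ∧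
        ∀ R : ℝ, 0 < R → ∃ C : ℝ, ∀ T : ℝ, 0 < T → ∀ (N : ℕ∞) (u : ℝ → ℤ → ℂ),
          FourNLS.IsSolution N s σ u →
          (∀ t ∈ Set.Icc 0 T, FourNLS.normH σ (u t) ≤ R) →
          ∃ D : ℝ → ℝ, FourNLS.IsEnergyDerivative K N s σ T u D ∧
            ∀ t ∈ Set.Icc 0 T, |D t| ≤ C := by
  refine ⟨(s - 3 / 10) / 3, by linarith, fun ε σ hε hε' hσ K hK => ?_⟩
  have hr : FourNLS.Regime s σ := ⟨hs, hs', by linarith, by linarith⟩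
  refine ⟨fun N f hf => hr.correctionsConverge hK N hf, fun R hR =>
    ⟨FourNLS.fluxBound K s (R + 1), fun T _ N u hu hub => ?_⟩⟩
  have hμ := FourNLS.isWeight_bracket s
  have hσs : σ ≤ s := by linarith
  refine ⟨fun t => -FourNLS.flux K N (fun m => FourNLS.bracket m ^ (2 * s)) (u t),
    ⟨fun h t _ => ?_, fun w hw hwu => ⟨fun k t _ =>
      (hr.hasDerivAt_modifiedEnergy hK (hw k) t).differentiableAt, ?_⟩⟩, fun t ht => ?_⟩
  · exact hr.hasDerivAt_modifiedEnergy hK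
      (h.elim (fun hN => (hu.2.1 hN).isFiniteEnergySolution hN s) id) t
  · set ρ := 2 * R + 2 with hρ
    have hF : 0 ≤ FourNLS.fluxBound K s ρ :=
      FourNLS.fluxBound_nonneg hK hs (by linarith)
    refine Metric.tendstoUniformlyOn_iff.2 fun δ hδ => ?_
    set η := min 1 (δ / (FourNLS.fluxBound K s ρ + 1)) with hη
    have hη0 : 0 < η := lt_min one_pos (by positivity)
    filter_upwards [hwu η hη0] with k hk t ht
    have h1 : η ≤ 1 := min_le_left _ _
    have hwt := ((hw k).1.1 t).mono hσs
    have h2 := hwt.normH_le_add (hu.1.1 t)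
    have h3 := hub t ht
    have h4 := hk t ht
    rw [(hr.hasDerivAt_modifiedEnergy hK (hw k) t).deriv, dist_comm, Real.dist_eq,
      neg_sub_neg, abs_sub_comm]
    refine (hr.abs_flux_sub_le_of_normH hK hμ N hwt (hu.1.1 t) hη0 h4
      (ρ := ρ) (by linarith)).trans_lt ?_
    calc η * FourNLS.fluxBound K s ρ
        ≤ δ / (FourNLS.fluxBound K s ρ + 1) * FourNLS.fluxBound K s ρ := by
          gcongr
          exact min_le_right _ _
      _ < δ := by
          rw [div_mul_eq_mul_div, div_lt_iff₀ (by positivity)]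
          nlinarith
  · rw [abs_neg]
    exact hr.abs_flux_le_of_normH hK hμ N (hu.1.1 t) (by linarith) ((hub t ht).trans (by linarith))
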